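/- **Conventions.** A monoid is commutative, written additively; it is *toric* if it is finitely generated, integral, torsion free and saturated, and *sharp* if its only unit is $0$. Put $P^\vee=\mathrm{Hom}(P;\mathbb N)$ and $\dim P=\operatorname{rank}P^{\mathrm{gp}}$. A *face* $S\le P$ is a submonoid whose complement is a prime ideal, and $P^\circ$ is the complement of all proper faces. For $Q\le P$ write $Q^\perp=\{q\in P^\vee: q|_Q=0\}$. A *monoidal complex* is a category of toric monoids whose arrows are injective homomorphisms onto faces, such that each face of each object is the image of a unique arrow from a unique object; a *morphism* is a family of interior homomorphisms (mapping $P^\circ$ into $Q^\circ$), one on each object, which commutes with arrows. A monoid $P$ is also regarded as the complex of its faces. A *refinement* is a morphism $\psi:\mathcal R\to\mathcal P$ with all $\psi_R$ injective and $P^\circ=\bigsqcup_{R\to P}\psi_R(R^\circ)$ for all $P\in\mathcal P$. The model space $X_P=\mathrm{Hom}(P;([0,\infty),\cdot))$ has the weakest topology for which all $x_p(x)=x(p)$ are continuous. Its smooth functions are locally smooth functions of finitely many $x_p$; b-functions are locally of the form $h\,x_p$ with $h>0$ smooth; an interior b-map $f$ to $X_Q$ satisfies, for every $q$, $f^*x_q=h\,x_p$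 for some $p$ and smooth $h>0$; a diffeomorphism is an invertible interior b-map with inverse an interior b-map. $X_P^\circ=\mathrm{Hom}(P;(0,\infty))$. For $S\le P$, the space $X_{S^{-1}P}$ is the open subset $\{x: x(s)\neq0\ \forall s\in S\}$ of $X_P$, and the boundary face $X_S\subset X_P$ is $\{x:x(p)=0\ \forall p\notin S\}$. A *manifold* is a connected second countable Hausdorff space with an atlas of charts onto open subsets of model spaces of toric monoids, with diffeomorphisms as transition functions, and with embedded boundary faces. The codimension of $x\in M$ is the dimension of the sharpening of the stalk $\mathcal B_x$ of b-functions; $M^\circ$ is the set of points of codimension $0$; a boundary face $F$ is the closure of a connected component $F^\circ$ of the set of points of some fixed codimension (embedded: near any of its points, $F^\circ$ has just one local branch). For $x\in F$ the normal monoid ${}^{\mathrm b}M_xF$ consists of the homomorphisms $\mathcal B_x\to\mathbb N$ vanishing on all germs which do not vanish identically on $F$ near $x$. The complex $\mathcal P_M$ has as objects the boundary faces $F$, with monoid $W(F)^\vee$ the flat sections of the (canonically trivial) bundle ${}^{\mathrm b}MF\to F$, and for $G\subset F$ an arrow $W(F)^\vee\to W(G)^\vee$ given by the inclusions ${}^{\mathrm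 b}M_xF\subset{}^{\mathrm b}M_xG$, $x\in G$. An interior b-map $f:M\to N$ induces $f_\natural:\mathcal P_M\to\mathcal P_N$, which sends $F$ to the face $G$ with $f(F^\circ)\subset G^\circ$ and is dual to the pull back $f^*:\mathcal B_{f(x)}\to\mathcal B_x$. There is a canonical isomorphism $P^\vee\cong\mathcal P_{X_P}$ for sharp toric $P$, taking $S^\perp$ to $X_S$ and $\alpha\in S^\perp$ to the section with value $\alpha(p)$ on the germs of $x_p$. **Proposition.** Let $P$ be a sharp toric monoid and $\psi:\mathcal R\to P^\vee$ a refinement. Assume that $\mathcal R$ has finitely many objects or, more generally, that $P^\vee$ is the union of the $\psi_R(R)$ over the *maximal* $R$, i.e. those with $\dim R=\dim P^\vee$. Let $[X_P;\mathcal R]$ be the quotient, with the quotient topology, of $\bigsqcup_{R\text{ maximal}}X_{R^\vee}$ by the equivalence relation generated by the identifications $X_{(Q^\perp)^{-1}R_1^\vee}\cong X_{(Q^\perp)^{-1}R_2^\vee}$, where $Q=R_1\cap R_2$ in $P^\vee$, given by the equality $(Q^\perp)^{-1}R_1^\vee=(Q^\perp)^{-1}R_2^\vee$ in $\mathrm{Hom}(P^\vee;\mathbb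 Z)$. Let $\beta:[X_P;\mathcal R]\to X_P$ be the map given on $X_{R^\vee}$ by the dual $\psi_R^\vee:P\to R^\vee$. Then: 1. $[X_P;\mathcal R]$ is a manifold with generalized corners (in particular Hausdorff, second countable, connected, with embedded boundary faces), with the spaces $X_{R^\vee}$, $R$ maximal, as charts; points of $X_{R_1^\vee}$ and $X_{R_2^\vee}$ have the same image if and only if they lie in $X_{(Q^\perp)^{-1}R_1^\vee}$ and $X_{(Q^\perp)^{-1}R_2^\vee}$ and correspond under the above identification; 2. $\beta$ is an interior b-map; 3. for each boundary face $F$ of $[X_P;\mathcal R]$ the bundle ${}^{\mathrm b}MF$ is trivialized by its flat sections, and there is an isomorphism of monoidal complexes $\mathcal R\cong\mathcal P_{[X_P;\mathcal R]}$ which, together with the canonical isomorphism $P^\vee\cong\mathcal P_{X_P}$, identifies $\beta_\natural$ with $\psi$; 4. $\beta$ restricts to a diffeomorphism from $[X_P;\mathcal R]^\circ$ onto $X_P^\circ$. -/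

import Mathlib

open Filter Topology Set
open scoped NNReal ContDiff

noncomputable section

namespace GCorners

universe u v w u' v' w'

/-! ### Monoids -/

set_option linter.checkUnivs false

section Monoids

variable (P : Type*) [AddCommMonoid P]

/-- Toric monoids: finitely generated, integral, torsion free and saturated. Saturation says that
`a - b` in the group completion lies in `P` as soon as a positive multiple of it does. -/
structure IsToric : Prop where
  fg : AddMonoid.FG P
  integral : ∀ a b c : P, a + c = b + c → a = b
  torsionFree : ∀ (n : ℕ) (a : P), 0 < n → n • a = 0 → a = 0
  saturated : ∀ (n : ℕ) (a b c : P), 0 < n → n • a = n • b + c → ∃ d, a = b + d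

/-- The only unit is `0`. -/
def IsSharp : Prop := ∀ a b : P, a + b = 0 → a = 0

/-- The dimension of a monoid: the rank of its group completion. -/
def monDim : ℕ := Module.finrank ℤ (Algebra.GrothendieckAddGroup P)

/-- The dual monoid `Hom(P, ℕ)`. -/
abbrev Dual : Type _ := P →+ ℕ

variable {P}

/-- A face: a submonoid whose complement is a prime ideal. -/
def IsFace (S : AddSubmonoid P) : Prop := ∀ p q : P, p + q ∈ S → p ∈ S

variable (P) in
/-- The interior of a monoid: the complement of all proper faces. -/
def monInterior : Set P := {p | ∀ S : AddSubmonoid P, IsFace S → S ≠ ⊤ → p ∉ S}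

end Monoids

/-! ### Monoidal complexes -/

/-- The data of a family of monoids with distinguished homomorphisms ("arrows") between them. -/
structure MonoidalData where
  Obj : Type v
  Mon : Obj → Type w
  [inst : ∀ i, AddCommMonoid (Mon i)]
  arrows : ∀ i j, Set (Mon i →+ Mon j)

attribute [instance] MonoidalData.inst

namespace MonoidalData

/-- Monoidal complexes: the objects are toric monoids; the arrows form a category and are
injective homomorphisms onto faces; and every face of every object is the image of a unique arrow
from a unique object. -/
structure IsComplex (C : MonoidalData.{v, w}) : Prop where
  toric : ∀ i, IsToric (C.Mon i)
  id_mem : ∀ i, AddMonoidHom.id (C.Mon i) ∈ C.arrows i i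
  comp_mem : ∀ i j k (f : C.Mon i →+ C.Mon j) (g : C.Mon j →+ C.Mon k),
    f ∈ C.arrows i j → g ∈ C.arrows j k → g.comp f ∈ C.arrows i k
  injective : ∀ i j (f : C.Mon i →+ C.Mon j), f ∈ C.arrows i j → Function.Injective f
  isFace : ∀ i j (f : C.Mon i →+ C.Mon j), f ∈ C.arrows i j → IsFace (AddMonoidHom.mrange f)
  existsUnique : ∀ j (S : AddSubmonoid (C.Mon j)), IsFace S →
    ∃! a : (Σ i, (C.Mon i →+ C.Mon j)), a.2 ∈ C.arrows a.1 j ∧ AddMonoidHom.mrange a.2 = S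

/-- Morphisms: a family of interior homomorphisms which commute with arrows. -/
structure Hom (C : MonoidalData.{v, w}) (D : MonoidalData.{v', w'}) where
  obj : C.Obj → D.Obj
  map : ∀ i, C.Mon i →+ D.Mon (obj i)
  interior : ∀ i, ∀ a ∈ monInterior (C.Mon i), map i a ∈ monInterior (D.Mon (obj i))
  comm : ∀ i j, ∀ f ∈ C.arrows i j, ∃ g ∈ D.arrows (obj i) (obj j),
    (map j).comp f = g.comp (map i)

/-- Isomorphisms: bijective on objects, an isomorphism of monoids on each object, and matching
up the arrows. -/
structure Iso (C : MonoidalData.{v, w}) (D : MonoidalData.{v', w'}) where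
  obj : C.Obj ≃ D.Obj
  map : ∀ i, C.Mon i ≃+ D.Mon (obj i)
  arrows_iff : ∀ i j (f : C.Mon i →+ C.Mon j), f ∈ C.arrows i j ↔
    ((map j).toAddMonoidHom.comp f).comp (map i).symm.toAddMonoidHom ∈ D.arrows (obj i) (obj j)

/-- A morphism as a map on the disjoint union of all the monoids; it remembers both the action on
objects and the homomorphisms. -/
def Hom.total {C : MonoidalData.{v, w}} {D : MonoidalData.{v', w'}} (φ : C.Hom D) :
    (Σ i, C.Mon i) → (Σ j, D.Mon j) := fun a => ⟨φ.obj a.1, φ.map a.1 a.2⟩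

/-- An isomorphism as a map on the disjoint union of all the monoids. -/
def Iso.total {C : MonoidalData.{v, w}} {D : MonoidalData.{v', w'}} (φ : C.Iso D) :
    (Σ i, C.Mon i) → (Σ j, D.Mon j) := fun a => ⟨φ.obj a.1, φ.map a.1 a.2⟩

/-- (Saturated) refinements: all homomorphisms are injective, and the interior of every monoid of
the target is the disjoint union of the images of the interiors of the monoids mapping to it. -/
structure Hom.IsRefinement {C : MonoidalData.{v, w}} {D : MonoidalData.{v', w'}} (φ : C.Hom D) :
    Prop where
  injective : ∀ i, Function.Injective (φ.map i)
  partition : ∀ (j : D.Obj), ∀ b ∈ monInterior (D.Mon j),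
    ∃! i : C.Obj, ∃ a ∈ monInterior (C.Mon i), φ.total ⟨i, a⟩ = ⟨j, b⟩

end MonoidalData

/-- The complex of faces of a monoid, with the inclusions as arrows. -/
abbrev faceComplex (Q : Type u) [AddCommMonoid Q] : MonoidalData.{u, u} where
  Obj := {S : AddSubmonoid Q // IsFace S}
  Mon S := S.1
  arrows S T := {f : S.1 →+ T.1 | ∀ s, (f s : Q) = s}

/-! ### Model spaces -/

/-- The model space `X_P = Hom(P, [0, ∞))`, with the multiplicative monoid `[0, ∞)`. -/
def ModelSpace (P : Type u) [AddCommMonoid P] : Type u :=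
  {x : P → ℝ≥0 // x 0 = 1 ∧ ∀ p q, x (p + q) = x p * x q}

section Model

variable {P : Type*} [AddCommMonoid P] {Q : Type*} [AddCommMonoid Q]

instance : CoeFun (ModelSpace P) (fun _ => P → ℝ≥0) := ⟨Subtype.val⟩

/-- The weakest topology for which all the functions `x ↦ x p` are continuous (the subspace
topology from the product). -/
instance : TopologicalSpace (ModelSpace P) := instTopologicalSpaceSubtype

/-- The map of model spaces induced by a homomorphism. -/
def ModelSpace.comap (f : Q →+ P) (x : ModelSpace P) : ModelSpace Q :=
  ⟨fun q => x (f q), by simpa using x.2.1, fun a b => by simpa using x.2.2 (f a) (f b)⟩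

/-- Smoothness at a point: near `x`, the function `f` is a smooth function of finitely many
algebraic functions. -/
def SmoothAt (f : ModelSpace P → ℝ) (x : ModelSpace P) : Prop :=
  ∃ (n : ℕ) (p : Fin n → P) (g : (Fin n → ℝ) → ℝ), ContDiff ℝ ∞ g ∧
    ∀ᶠ y in 𝓝 x, f y = g (fun i => (y (p i) : ℝ))

/-- `f` is a b-function near `x`, i.e. an algebraic function times a positive smooth function. -/
def ModelBFunAt (f : ModelSpace P → ℝ≥0) (x : ModelSpace P) : Prop :=
  ∃ (p : P) (h : ModelSpace P → ℝ), SmoothAt h x ∧ 0 < h x ∧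
    ∀ᶠ y in 𝓝 x, (f y : ℝ) = h y * (y p : ℝ)

/-- `f` is an interior b-map on the open set `O`: each algebraic function pulls back to
an algebraic function times a smooth positive function on `O`. -/
def ModelBMapOn (f : ModelSpace P → ModelSpace Q) (O : Set (ModelSpace P)) : Prop :=
  ∀ q : Q, ∃ (p : P) (h : ModelSpace P → ℝ),
    ∀ x ∈ O, SmoothAt h x ∧ 0 < h x ∧ (f x q : ℝ) = h x * (x p : ℝ)

variable (P) in
/-- The interior `Hom(P, (0, ∞))` of the model space. -/
def modelInterior : Set (ModelSpace P) := {x | ∀ p, x p ≠ 0}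

/-- The open subspace `X_{S⁻¹P}` of `X_P`: a homomorphism `x` on `P` extends to the localization
iff it does not vanish on `S`, and then the extension is unique, with value `x a / x s` at
`a - s`. -/
def locSpace (S : Set P) : Set (ModelSpace P) := {x | ∀ s ∈ S, x s ≠ 0}

theorem SmoothAt.mul {f g : ModelSpace P → ℝ} {x : ModelSpace P} (hf : SmoothAt f x)
    (hg : SmoothAt g x) : SmoothAt (fun y => f y * g y) x := by
  obtain ⟨n, p, F, hF, hf⟩ := hf
  obtain ⟨m, q, G, hG, hg⟩ := hg
  refine ⟨n + m, Fin.append p q,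
    fun z => F (fun i => z (Fin.castAdd m i)) * G (fun j => z (Fin.natAdd n j)), ?_, ?_⟩
  · refine ContDiff.mul (hF.comp ?_) (hG.comp ?_) <;> fun_prop
  · filter_upwards [hf, hg] with y h1 h2
    simp [h1, h2]

theorem ModelBFunAt.mul {f g : ModelSpace P → ℝ≥0} {x : ModelSpace P} (hf : ModelBFunAt f x)
    (hg : ModelBFunAt g x) : ModelBFunAt (fun y => f y * g y) x := by
  obtain ⟨p, h, hs, h0, hf⟩ := hf
  obtain ⟨q, k, ks, k0, hg⟩ := hg
  refine ⟨p + q, fun y => h y * k y, hs.mul ks, mul_pos h0 k0, ?_⟩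
  filter_upwards [hf, hg] with y h1 h2
  simp only [NNReal.coe_mul, h1, h2, y.2.2 p q]
  ring

theorem ModelBFunAt.one (x : ModelSpace P) : ModelBFunAt (fun _ => 1) x :=
  ⟨0, fun _ => 1, ⟨0, Fin.elim0, fun _ => 1, contDiff_const, by simp⟩, one_pos,
    by filter_upwards with y; simp [y.2.1]⟩

end Model

/-! ### Manifolds with generalized corners -/

/-- The data of an atlas on `M`. A chart is given through its inverse `param i`, which is only
relevant on the subset `dom i` of the model space of `Mon i`. -/
structure GCAtlas (M : Type u) where
  ι : Type v
  Mon : ι → Type w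
  [inst : ∀ i, AddCommMonoid (Mon i)]
  dom : ∀ i, Set (ModelSpace (Mon i))
  param : ∀ i, ModelSpace (Mon i) → M

attribute [instance] GCAtlas.inst

namespace GCAtlas

variable {M : Type u} [TopologicalSpace M] (A : GCAtlas.{u, v, w} M)
variable {N : Type u'} [TopologicalSpace N] (B : GCAtlas.{u', v', w'} N)

/-- `f` is an interior b-map on the open set `U` of `M`: it is continuous there, and its
expressions in charts are interior b-maps. -/
def BMapOn (f : M → N) (U : Set M) : Prop :=
  ContinuousOn f U ∧ ∀ i j, ∃ g : ModelSpace (A.Mon i) → ModelSpace (B.Mon j),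
    (∀ x ∈ A.dom i, A.param i x ∈ U → f (A.param i x) ∈ B.param j '' B.dom j →
      g x ∈ B.dom j ∧ B.param j (g x) = f (A.param i x)) ∧
    ModelBMapOn g {x | x ∈ A.dom i ∧ A.param i x ∈ U ∧ f (A.param i x) ∈ B.param j '' B.dom j}

/-- `f` restricts to a diffeomorphism from the open set `U` onto the open set `V`: it is an
invertible interior b-map whose inverse is an interior b-map. -/
def DiffeoOn (f : M → N) (U : Set M) (V : Set N) : Prop :=
  IsOpen U ∧ IsOpen V ∧ ∃ g : N → M, MapsTo f U V ∧ MapsTo g V U ∧ InvOn g f U V ∧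
    A.BMapOn B f U ∧ B.BMapOn A g V

/-- `f` is a b-function near `x`: its compositions with charts are. -/
def BFunAt (f : M → ℝ≥0) (x : M) : Prop :=
  ∀ i, ∀ y ∈ A.dom i, A.param i y = x → ModelBFunAt (f ∘ A.param i) y

/-- The stalk at `x` of the sheaf of b-functions. -/
def stalk (x : M) : Submonoid (Germ (𝓝 x) ℝ≥0) where
  carrier := {g | ∃ f : M → ℝ≥0, A.BFunAt f x ∧ (f : Germ (𝓝 x) ℝ≥0) = g}
  one_mem' := ⟨fun _ => 1, fun _ y _ _ => ModelBFunAt.one y, rfl⟩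
  mul_mem' := by
    rintro _ _ ⟨f, hf, rfl⟩ ⟨g, hg, rfl⟩
    exact ⟨fun y => f y * g y, fun i y hy h => (hf i y hy h).mul (hg i y hy h), rfl⟩

/-- The germ of a b-function, as an element of the stalk (written additively). -/
def germ {x : M} (f : M → ℝ≥0) (hf : A.BFunAt f x) : Additive (A.stalk x) :=
  Additive.ofMul ⟨(f : Germ (𝓝 x) ℝ≥0), f, hf, rfl⟩

/-- The codimension of `x`: the dimension of the sharpening of the stalk (the quotient of the
stalk by its units). -/
def codim (x : M) : ℕ := monDim (Additive (Associates (A.stalk x)))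

/-- The stratum of points of codimension `l`. The interior of `M` is the stratum `l = 0`. -/
def stratum (l : ℕ) : Set M := {x | A.codim x = l}

/-- `C` is a connected component of `X`. -/
def _root_.GCorners.IsComponent (X C : Set M) : Prop := ∃ x ∈ X, C = connectedComponentIn X x

/-- `γ` is a consistent choice of connected components of the intersections of the stratum of
codimension `l` with the open neighbourhoods of `x`. -/
def IsLocalFace (l : ℕ) (x : M) (γ : Set M → Set M) : Prop :=
  (∀ U, IsOpen U → x ∈ U → IsComponent (A.stratum l ∩ U) (γ U)) ∧
  ∀ U V, IsOpen U → IsOpen V → x ∈ U → U ⊆ V → γ U ⊆ γ V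

/-- The boundary faces are embedded: two local boundary faces at a point `x` agree if they belong
to the same component of a stratum of `M`, i.e. to the same global boundary face. -/
def FacesEmbedded : Prop :=
  ∀ l x γ γ', A.IsLocalFace l x γ → A.IsLocalFace l x γ' → γ univ = γ' univ →
    ∀ U, IsOpen U → x ∈ U → γ U = γ' U

/-- Manifolds with generalized corners, connected and with embedded boundary faces. -/
structure IsManifold : Prop where
  hausdorff : T2Space M
  secondCountable : SecondCountableTopology M
  connected : ConnectedSpace M
  toric : ∀ i, IsToric (A.Mon i)
  isOpen_dom : ∀ i, IsOpen (A.dom i)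
  isOpenEmbedding : ∀ i, IsOpenEmbedding (fun x : A.dom i => A.param i x)
  cover : ∀ m, ∃ i, m ∈ A.param i '' A.dom i
  /-- transition functions are interior b-maps (in both directions, by symmetry in `i, j`) -/
  transition : ∀ i j, ∃ g : ModelSpace (A.Mon i) → ModelSpace (A.Mon j),
    (∀ x ∈ A.dom i, A.param i x ∈ A.param j '' A.dom j →
      g x ∈ A.dom j ∧ A.param j (g x) = A.param i x) ∧
    ModelBMapOn g {x | x ∈ A.dom i ∧ A.param i x ∈ A.param j '' A.dom j}
  embedded : A.FacesEmbedded

/-- A boundary face of codimension `codim`, given through its interior, which is a connected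
component of a stratum. -/
structure BoundaryFace where
  codim : ℕ
  int : Set M
  isComponent : IsComponent (A.stratum codim) int

variable {A} in
/-- The boundary face as a closed subset of `M` (for embedded faces). -/
def BoundaryFace.carrier (F : A.BoundaryFace) : Set M := closure F.int

/-- A germ of b-functions is normal to `F` if it vanishes on `F` near `x`; otherwise it is
tangential. -/
def IsNormal (F : Set M) {x : M} (b : Additive (A.stalk x)) : Prop :=
  ∃ f : M → ℝ≥0, (f : Germ (𝓝 x) ℝ≥0) = (b.toMul : Germ (𝓝 x) ℝ≥0) ∧
    ∀ᶠ y in 𝓝[F] x, f y = 0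

/-- The normal monoid to `F` at `x`: homomorphisms from the stalk to `ℕ` which are trivial on the
tangential germs. -/
def normalMonoid (F : Set M) (x : M) : AddSubmonoid (Additive (A.stalk x) →+ ℕ) where
  carrier := {m | ∀ b, ¬ A.IsNormal F b → m b = 0}
  zero_mem' := fun _ _ => rfl
  add_mem' := fun {m n} hm hn b hb => by simp [hm b hb, hn b hb]

/-- The monoid of flat (locally constant) sections over `F` of the bundle of normal monoids.
Flatness of `s` means that the pairing of `s` with any local b-function is locally constant. As
the bundle is canonically trivial, this is the fibre `W(F)^∨` of the trivialization. -/
def flatSections (F : Set M) : AddSubmonoid (∀ x : F, (Additive (A.stalk (x : M)) →+ ℕ)) where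
  carrier := {s | (∀ x : F, s x ∈ A.normalMonoid F x) ∧
    ∀ (f : M → ℝ≥0) (x : F) (hx : A.BFunAt f x), ∀ᶠ y : F in 𝓝 x, ∀ hy : A.BFunAt f y,
      s y (A.germ f hy) = s x (A.germ f hx)}
  zero_mem' := ⟨fun x => (A.normalMonoid F x).zero_mem, fun _ _ _ => by
    filter_upwards with y hy; rfl⟩
  add_mem' := fun {s t} hs ht => ⟨fun x => (A.normalMonoid F x).add_mem (hs.1 x) (ht.1 x),
    fun f x hx => by
      filter_upwards [hs.2 f x hx, ht.2 f x hx] with y h1 h2 hy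
      simp [h1 hy, h2 hy]⟩

/-- The bundle of normal monoids over `F` is trivialized by its flat sections. -/
def NormalTrivial (F : Set M) : Prop :=
  ∀ x : F, BijOn (fun s : ∀ x : F, (Additive (A.stalk (x : M)) →+ ℕ) => s x)
    {s | s ∈ A.flatSections F} {m | m ∈ A.normalMonoid F x}

/-- The monoidal complex of `M`. The objects are the boundary faces `F`, with monoids `W(F)^∨`. For
`G ⊆ F` there is an arrow from `W(F)^∨` to `W(G)^∨`, induced by the inclusions of
the normal monoid to `F` at `x` into the normal monoid to `G` at `x`, for `x` in `G`. -/
abbrev complex : MonoidalData.{u, u} where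
  Obj := A.BoundaryFace
  Mon F := A.flatSections F.carrier
  arrows F G := {φ : A.flatSections F.carrier →+ A.flatSections G.carrier |
    G.carrier ⊆ F.carrier ∧ ∀ s x (hG : x ∈ G.carrier) (hF : x ∈ F.carrier),
      (φ s).1 ⟨x, hG⟩ = s.1 ⟨x, hF⟩}

variable {A B} in
/-- `φ` is the morphism `f_♮` of monoidal complexes induced by `f : M → N`: it takes `F` to the
boundary face whose interior contains the image of the interior of `F`, and is given there by the
b-differential of `f`, i.e. by composition with the pull back `f^* : B_{N,f(x)} → B_{M,x}` of germs
of b-functions. -/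
def IsInduced (f : M → N) (φ : A.complex.Hom B.complex) : Prop :=
  ∀ F : A.BoundaryFace, MapsTo f F.int (BoundaryFace.int (φ.obj F)) ∧
    ∀ (s : A.flatSections F.carrier) (x : F.carrier),
      ∃ hx : f x ∈ BoundaryFace.carrier (φ.obj F),
        ∀ (b : N → ℝ≥0) (hb : B.BFunAt b (f x)), ∃ hb' : A.BFunAt (b ∘ f) x,
          Subtype.val (p := (· ∈ B.flatSections _)) (φ.map F s) ⟨f x, hx⟩ (B.germ b hb)
            = s.1 x (A.germ (b ∘ f) hb')

end GCAtlas

/-- The model space as a manifold, with the identity as its only chart. -/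
abbrev modelAtlas (P : Type u) [AddCommMonoid P] : GCAtlas.{u, 0, u} (ModelSpace P) where
  ι := Unit
  Mon _ := P
  dom _ := univ
  param _ := id

/-- The canonical identification of the complex of faces of `P^∨` with the monoidal complex of
`X_P`: the face `Q` goes to the boundary face of all `x` vanishing at all `p` which are not
annihilated by `Q`, i.e. to `X_S` with `Q = S^⊥`; and `α ∈ Q` goes to the section which takes the
value `α p` on the germs of the algebraic function of `p`. -/
def IsCanonical {P : Type u} [AddCommMonoid P]
    (σ : (faceComplex (Dual P)).Iso (modelAtlas P).complex) : Prop :=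
  ∀ Q : {S : AddSubmonoid (Dual P) // IsFace S},
    GCAtlas.BoundaryFace.carrier (σ.obj Q)
      = {x : ModelSpace P | ∀ p : P, (∃ α ∈ Q.1, α p ≠ 0) → x p = 0} ∧
    ∀ (α : Q.1) (x : GCAtlas.BoundaryFace.carrier (σ.obj Q)) (p : P),
      ∃ h : (modelAtlas P).BFunAt (fun y => y p) x,
        Subtype.val (p := (· ∈ (modelAtlas P).flatSections _)) (σ.map Q α) x
          ((modelAtlas P).germ _ h) = α.1 p

/-! ### Blow-up of model spaces -/

section BlowUp

variable {P : Type u} [AddCommMonoid P] {R : MonoidalData.{v, w}}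
  (ψ : R.Hom (faceComplex (Dual P)))

/-- `ψ_r` as a homomorphism to `P^∨`. -/
def emb (r : R.Obj) : R.Mon r →+ Dual P :=
  (AddSubmonoid.subtype (Subtype.val (ψ.obj r))).comp (ψ.map r)

/-- The dual homomorphism `ψ_r^∨ : P → (R_r)^∨`. -/
def dualEmb (r : R.Obj) : P →+ Dual (R.Mon r) := (emb ψ r).flip

/-- The monoids `R_r` of full dimension, those with `dim R_r = dim P^∨`. -/
def MaxObj : Type v :=
  let _ := ψ
  {r : R.Obj // monDim (R.Mon r) = monDim (Dual P)}

/-- The face `Q^⊥` of `(R_r)^∨`, where `Q` is the intersection of the images of `R_r` and `R_s` in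
`P^∨`. -/
def interPerp (r s : R.Obj) : Set (Dual (R.Mon r)) :=
  {q | ∀ a : R.Mon r, emb ψ r a ∈ AddMonoidHom.mrange (emb ψ s) → q a = 0}

/-- `x` and `y` lie in the localizations of `X_{R_r^∨}` and `X_{R_s^∨}` at `Q^⊥`, and correspond to
each other under the identification of these spaces: the localized monoids, considered inside
of the dual lattice `Hom(P^∨, ℤ)`, coincide, and the extensions of `x` and `y` to it agree. -/
def Glue (r s : R.Obj) (x : ModelSpace (Dual (R.Mon r))) (y : ModelSpace (Dual (R.Mon s))) :
    Prop :=
  x ∈ locSpace (interPerp ψ r s) ∧ y ∈ locSpace (interPerp ψ s r) ∧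
  ∀ (l : Dual P →+ ℤ) (a b : Dual (R.Mon r)) (c d : Dual (R.Mon s)),
    b ∈ interPerp ψ r s → d ∈ interPerp ψ s r →
    (∀ t, l (emb ψ r t) = (a t : ℤ) - b t) → (∀ t, l (emb ψ s t) = (c t : ℤ) - d t) →
    x a / x b = y c / y d

/-- The blow-up `[X_P; R]`: the quotient of the disjoint union of the spaces `X_{R_r^∨}`, over the
maximal `R_r`, by the equivalence relation generated by the gluings. -/
def BlowUp : Type (max v w) :=
  Quot (fun x y : (Σ r : MaxObj ψ, ModelSpace (Dual (R.Mon r.1))) =>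
    Glue ψ x.1.1 y.1.1 x.2 y.2)

/-- The quotient topology of the disjoint union topology. -/
instance : TopologicalSpace (BlowUp ψ) := instTopologicalSpaceQuot

/-- The map of `X_{R_r^∨}` to the blow-up. -/
def BlowUp.mk (r : MaxObj ψ) (x : ModelSpace (Dual (R.Mon r.1))) : BlowUp ψ :=
  Quot.mk _ ⟨r, x⟩

/-- The blow-down map, given on `X_{R_r^∨}` by the dual homomorphism `P → (R_r)^∨`. -/
def blowDown : BlowUp ψ → ModelSpace P :=
  Quot.lift (fun x => x.2.comap (dualEmb ψ x.1.1)) (by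
    rintro ⟨r, x⟩ ⟨s, y⟩ ⟨-, -, h⟩
    apply Subtype.ext
    funext p
    have h0 := h ((Nat.castAddMonoidHom ℤ).comp (AddMonoidHom.eval p)) (dualEmb ψ r.1 p) 0
      (dualEmb ψ s.1 p) 0 (fun _ _ => rfl) (fun _ _ => rfl)
      (fun t => by simp [dualEmb]) (fun t => by simp [dualEmb])
    change x.1 _ = y.1 _
    simpa [x.2.1, y.2.1] using h0)

/-- The atlas of the blow-up, whose charts are the model spaces `X_{R_r^∨}`. -/
abbrev blowUpAtlas : GCAtlas.{max v w, v, w} (BlowUp ψ) where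
  ι := MaxObj ψ
  Mon r := Dual (R.Mon r.1)
  dom _ := univ
  param r := BlowUp.mk ψ r

end BlowUp

end GCorners

end

open GCorners

universe u v w

/-!
# Blow-ups of model spaces along refinements

Let `D = P^∨`, and consider the monoids `R_i` of the refinement as submonoids of `D` by means of
`emb ψ`. Then every element of `D` is an interior point of precisely one `R_i`
(`IsSubdivision`), so that the `R_i` behave like the cones of a fan: they are saturated in `D`,
any two of them intersect in a common face, and by Farkas' lemma they are separated by a functional
which vanishes on them precisely on this face (`IsSubdivision.exists_separating`). This rests on
elementary duality of toric monoids: a toric monoid is cut out of its group completion by its dual,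
its faces are cut out by the elements of the dual that vanish on them, and sharp toric monoids are
reflexive. If there are finitely many `R_i`, then those of full dimension cover `D`, by
moving a given element slightly into a generic direction (`IsSubdivision.exists_full_of_finite`).

A point `x` of a chart `X_{R_r^∨}` extends to a homomorphism on the localization of `R_r^∨` at the
support of `x`, which is a submonoid of the lattice `Hom(D, ℤ)`. For `R_r` and `R_s` of full
dimension, two points are glued iff these extensions are equal, including their domains
(`IsSubdivision.glue_iff`), hence gluing is an equivalence relation already. The overlap of
two charts is the locus where the separating functional does not vanish. There, a coordinate of one
chart is a coordinate of the other, divided by a power of the separating functional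
(`IsSubdivision.exists_transition`). So transition functions are interior b-maps and charts are open
embeddings. The blow-up is a Hausdorff space since points outside of the overlap are zeros of the
separating functional, as a function on the one chart, and of its negative on the other chart, and
these two functions are inverse to each other on the overlap.

The boundary faces and normal monoids are computed for any atlas with transition functions of this
kind (`IsFanAtlas`), which also applies to the model space itself. A point `m` with coordinates `x`
in the chart of a monoid `N` has a cone: the face of `N^∨` which annihilates the support of `x`, as
a submonoid of `D`. All homomorphisms from the stalk of b-functions at `m` to `ℕ` are given by
taking the order along an element of the cone (`IsFanAtlas.exists_orderHom_eq`), the codimension is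
strictly monotone in the cone (`IsFanAtlas.codim_lt`), and the points with a given cone form a
connected set, also locally. Hence the interiors of the boundary faces are precisely the sets of
points with a given cone (`IsFanAtlas.isComponent_iff`), boundary faces are embedded
(`IsFanAtlas.facesEmbedded`), and the flat sections over a boundary face correspond to the elements
of its cone (`IsFanAtlas.flatEquiv`). So the monoidal complex is the complex of all the cones
(`IsFanAtlas.exists_complexIso`), which are the faces of `P^∨` for the model space, and the
`R_i` for the blow-up. The blow-down map takes a point with cone `R_i` to a point whose cone is the
smallest face of `P^∨` containing `R_i`, and its b-differential is the inclusion
(`IsSubdivision.orderHom_blowDown`). Finally, the interior of the blow-up is the preimage of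
the interior of `X_P`, and on these the blow-down map can be inverted because the groups generated
by `R_r`, of full dimension, and by `D` coincide.
-/

universe u' v' w'

namespace GCorners

/-! ### Farkas' lemma -/

/-- Farkas' lemma over `ℚ`, by induction on the number of functionals. If the last functional is
needed, then there is a point where `b` and this functional are negative and the others are not, and
one projects along this point. -/
theorem farkas {V : Type*} [AddCommGroup V] [Module ℚ V] {k : ℕ} (A : Fin k → V →ₗ[ℚ] ℚ)
    (b : V →ₗ[ℚ] ℚ) (h : ∀ x, (∀ i, 0 ≤ A i x) → 0 ≤ b x) :
    ∃ c : Fin k → ℚ, (∀ i, 0 ≤ c i) ∧ b = ∑ i, c i • A i := by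
  induction k generalizing b with
  | zero =>
    refine ⟨0, fun i => i.elim0, ?_⟩
    ext x
    have h1 := h x (fun i => i.elim0)
    have h2 := h (-x) (fun i => i.elim0)
    simp only [map_neg] at h2
    simp
    linarith
  | succ k ih =>
    by_cases H : ∀ x, (∀ i : Fin k, 0 ≤ A i.castSucc x) → 0 ≤ b x
    · obtain ⟨c, hc, rfl⟩ := ih (fun i => A i.castSucc) b H
      refine ⟨Fin.snoc c 0, fun i => ?_, ?_⟩
      · refine Fin.lastCases ?_ (fun j => ?_) i <;> simp [hc]
      · simp [Fin.sum_univ_castSucc]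
    · push Not at H
      obtain ⟨x₀, hx₀, hb⟩ := H
      have hl : A (Fin.last k) x₀ < 0 := by
        by_contra hcon
        refine absurd (h x₀ fun i => ?_) (not_le.mpr hb)
        exact Fin.lastCases (not_lt.mp hcon) (fun j => hx₀ j) i
      -- the projection along `x₀` to the kernel of the last functional
      set a := A (Fin.last k) with ha
      set x₁ := (-(a x₀))⁻¹ • x₀ with hx₁
      have ha1 : a x₁ = -1 := by
        rw [hx₁, map_smul, smul_eq_mul, inv_neg, neg_mul, inv_mul_cancel₀ hl.ne]
      have hpos : 0 ≤ (-(a x₀))⁻¹ := inv_nonneg.mpr (by linarith)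
      have hb1 : b x₁ ≤ 0 := by
        rw [hx₁, map_smul, smul_eq_mul]
        exact mul_nonpos_of_nonneg_of_nonpos hpos hb.le
      have hA1 : ∀ i : Fin k, 0 ≤ A i.castSucc x₁ := fun i => by
        rw [hx₁, map_smul, smul_eq_mul]
        exact mul_nonneg hpos (hx₀ i)
      obtain ⟨c, hc, hbc⟩ := ih (fun i => A i.castSucc + (A i.castSucc x₁) • a) (b + (b x₁) • a)
        (by
          intro x hx
          have := h (x + a x • x₁) (fun i => by
            refine Fin.lastCases ?_ (fun j => ?_) i
            · simp [← ha, ha1]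
            · have := hx j
              simp only [LinearMap.add_apply, LinearMap.smul_apply, smul_eq_mul] at this
              simp only [map_add, map_smul, smul_eq_mul]
              linarith)
          simp only [map_add, map_smul, smul_eq_mul] at this
          simp only [LinearMap.add_apply, LinearMap.smul_apply, smul_eq_mul]
          linarith)
      refine ⟨Fin.snoc c (∑ i, c i * A i.castSucc x₁ - b x₁), fun i => ?_, ?_⟩
      · refine Fin.lastCases ?_ (fun j => ?_) i
        · simp only [Fin.snoc_last]
          have : 0 ≤ ∑ i, c i * A i.castSucc x₁ :=
            Finset.sum_nonneg fun i _ => mul_nonneg (hc i) (hA1 i)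
          linarith
        · simp [hc]
      · ext x
        have := congrArg (fun f => f x) hbc
        simp only [LinearMap.add_apply, LinearMap.smul_apply, smul_eq_mul, LinearMap.coe_sum,
          Finset.sum_apply, mul_add, Finset.sum_add_distrib] at this
        simp only [Fin.sum_univ_castSucc, Fin.snoc_castSucc, Fin.snoc_last, LinearMap.add_apply,
          LinearMap.smul_apply, smul_eq_mul, LinearMap.coe_sum, Finset.sum_apply, ← ha, sub_mul,
          Finset.sum_mul]
        have e : ∀ i : Fin k, c i * (A i.castSucc x₁ * a x) = c i * A i.castSucc x₁ * a x :=
          fun i => by ring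
        simp only [e] at this
        linarith

/-- A common denominator. -/
theorem exists_pos_mul_eq_int {ι : Type*} [Fintype ι] (x : ι → ℚ) :
    ∃ m : ℕ, 0 < m ∧ ∃ y : ι → ℤ, ∀ i, (m : ℚ) * x i = y i := by
  classical
  refine ⟨∏ i, (x i).den, Finset.prod_pos fun i _ => (x i).den_pos,
    fun i => (∏ j ∈ Finset.univ.erase i, ((x j).den : ℤ)) * (x i).num, fun i => ?_⟩
  rw [← Finset.mul_prod_erase _ _ (Finset.mem_univ i)]
  push_cast
  have := Rat.mul_den_eq_num (x i)
  calc _ = (∏ j ∈ Finset.univ.erase i, ((x j).den : ℚ)) * (x i * (x i).den) := by ring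
    _ = _ := by rw [this]

/-- Farkas' lemma in a lattice: an element on which all functionals that are nonnegative on
a finitely generated submonoid are nonnegative has a positive multiple in this submonoid. -/
theorem exists_nsmul_mem_of_forall_nonneg {G : Type*} [AddCommGroup G] [Module.Finite ℤ G]
    [Module.IsTorsionFree ℤ G] (S : AddSubmonoid G) (hS : S.FG) (g : G)
    (h : ∀ l : G →+ ℤ, (∀ s ∈ S, 0 ≤ l s) → 0 ≤ l g) : ∃ m : ℕ, 0 < m ∧ m • g ∈ S := by
  obtain ⟨T, rfl⟩ := hS
  let B := Module.finBasis ℤ G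
  set n := Module.finrank ℤ G
  let F : G → (Fin n → ℚ) →ₗ[ℚ] ℚ := fun g => ∑ j, (B.repr g j : ℚ) • LinearMap.proj j
  have hF : ∀ g x, F g x = ∑ j, (B.repr g j : ℚ) * x j := fun g x => by simp [F]
  let s : Fin T.card → G := fun i => (T.equivFin.symm i : G)
  obtain ⟨c, hc, hbc⟩ := farkas (fun i => F (s i)) (F g) (by
    intro x hx
    obtain ⟨m, hm, y, hy⟩ := exists_pos_mul_eq_int x
    let l : G →+ ℤ := (∑ j, y j • B.coord j).toAddMonoidHom
    have hl : ∀ g, (l g : ℚ) = m * F g x := fun g => by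
      simp only [l, LinearMap.toAddMonoidHom_coe, LinearMap.coe_sum, Finset.sum_apply,
        LinearMap.smul_apply, Module.Basis.coord_apply, smul_eq_mul, hF, Finset.mul_sum]
      push_cast
      exact Finset.sum_congr rfl fun j _ => by rw [← hy]; ring
    have hm' : (0 : ℚ) < m := by exact_mod_cast hm
    have hT : (T : Set G) ⊆ {s | 0 ≤ l s} := fun t ht => by
      have := hx (T.equivFin ⟨t, ht⟩)
      simp only [s, Equiv.symm_apply_apply] at this
      have h2 : (0 : ℚ) ≤ l t := by rw [hl]; positivity
      exact_mod_cast h2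
    have hT' : ∀ t ∈ AddSubmonoid.closure (T : Set G), 0 ≤ l t := fun t ht =>
      AddSubmonoid.closure_induction (fun x hx => hT hx) (by simp)
        (fun x y _ _ h1 h2 => by simpa using add_nonneg h1 h2) ht
    have h1 : (0 : ℚ) ≤ l g := by exact_mod_cast h l hT'
    rw [hl] at h1
    exact (mul_nonneg_iff_of_pos_left hm').1 h1)
  obtain ⟨m, hm, y, hy⟩ := exists_pos_mul_eq_int c
  refine ⟨m, hm, ?_⟩
  have hm' : (0 : ℚ) < m := by exact_mod_cast hm
  have hy0 : ∀ i, 0 ≤ y i := fun i => by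
    have : (0 : ℚ) ≤ y i := by rw [← hy]; exact mul_nonneg hm'.le (hc i)
    exact_mod_cast this
  have key : m • g = ∑ i, (y i).toNat • s i := by
    apply B.repr.injective
    ext j
    have h1 := congrArg (fun f => f (Pi.single j 1)) hbc
    simp only [hF, LinearMap.coe_sum, Finset.sum_apply, LinearMap.smul_apply, smul_eq_mul,
      Pi.single_apply, mul_ite, mul_one, mul_zero, Finset.sum_ite_eq', Finset.mem_univ,
      if_true] at h1
    have h2 : ((m • B.repr g j : ℤ) : ℚ) = ((∑ i, (y i).toNat • B.repr (s i) j : ℤ) : ℚ) := by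
      simp only [nsmul_eq_mul]
      push_cast
      rw [h1, Finset.mul_sum]
      refine Finset.sum_congr rfl fun i _ => ?_
      rw [← mul_assoc, hy]
      congr 1
      exact_mod_cast (Int.toNat_of_nonneg (hy0 i)).symm
    have h3 := Int.cast_injective h2
    simpa using h3
  rw [key]
  exact sum_mem fun i _ => nsmul_mem (AddSubmonoid.subset_closure (T.equivFin.symm i).2) _

end GCorners

namespace GCorners

open Algebra

/-! ### Duality for toric monoids -/

section Toric

variable {N : Type*} [AddCommMonoid N]

theorem IsToric.isCancelAdd (h : IsToric N) : IsCancelAdd N :=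
  { add_left_cancel := fun a b c (e : a + b = a + c) =>
      h.integral b c a (by rwa [add_comm b, add_comm c])
    add_right_cancel := fun a b c e => h.integral _ _ _ e }

theorem IsToric.nsmul_inj (h : IsToric N) {n : ℕ} (hn : 0 < n) {a b : N} (e : n • a = n • b) :
    a = b := by
  obtain ⟨d, rfl⟩ := h.saturated n a b 0 hn (by simpa using e)
  have : n • d = 0 := h.integral _ _ (n • b) (by rw [nsmul_add] at e; rw [zero_add, add_comm, e])
  rw [h.torsionFree n d hn this, add_zero]

theorem exists_of_sub_of (g : GrothendieckAddGroup N) :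
    ∃ a b : N, g = GrothendieckAddGroup.of a - GrothendieckAddGroup.of b := by
  obtain ⟨x, hx⟩ := (AddLocalization.addMonoidOf (⊤ : AddSubmonoid N)).surj g
  exact ⟨x.1, x.2, eq_sub_of_add_eq hx⟩

theorem lift_of {G : Type*} [AddCommGroup G] (f : N →+ G) (c : N) :
    GrothendieckAddGroup.lift f (GrothendieckAddGroup.of c) = f c :=
  congrArg (fun f => f c) (GrothendieckAddGroup.lift.symm_apply_apply f)

theorem IsToric.of_injective (h : IsToric N) :
    Function.Injective (GrothendieckAddGroup.of (M := N)) :=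
  have := h.isCancelAdd
  GrothendieckAddGroup.of_injective

theorem IsToric.isAddTorsionFree (h : IsToric N) : IsAddTorsionFree (GrothendieckAddGroup N) where
  nsmul_right_injective n hn := by
    intro x y (e : n • x = n • y)
    obtain ⟨a, b, rfl⟩ := exists_of_sub_of x
    obtain ⟨c, d, rfl⟩ := exists_of_sub_of y
    have e1 : n • (a + d) = n • (c + b) := by
      apply h.of_injective
      simp only [map_nsmul, map_add, nsmul_sub, nsmul_add] at e ⊢
      rw [sub_eq_sub_iff_add_eq_add] at e
      exact e
    have := congrArg GrothendieckAddGroup.of (h.nsmul_inj (Nat.pos_of_ne_zero hn) e1)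
    rw [map_add, map_add] at this
    rwa [sub_eq_sub_iff_add_eq_add]

theorem finite_grothendieck (h : AddMonoid.FG N) : Module.Finite ℤ (GrothendieckAddGroup N) := by
  rw [Module.Finite.iff_addGroup_fg, AddGroup.fg_iff_addMonoid_fg]
  infer_instance

theorem exists_dual_of_nonneg (l : N →+ ℤ) (h : ∀ a, 0 ≤ l a) :
    ∃ α : Dual N, ∀ a, (α a : ℤ) = l a :=
  ⟨{ toFun := fun a => (l a).toNat
     map_zero' := by simp
     map_add' := fun a b => by rw [map_add, Int.toNat_add (h a) (h b)] },
   fun a => Int.toNat_of_nonneg (h a)⟩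

/-- A toric monoid is cut out of its group completion by the inequalities given by its dual. -/
theorem IsToric.exists_add_of_forall_le (h : IsToric N) {a b : N}
    (hab : ∀ α : Dual N, α b ≤ α a) : ∃ d, a = b + d := by
  have := finite_grothendieck h.fg
  have := h.isAddTorsionFree
  obtain ⟨m, hm, hS⟩ := exists_nsmul_mem_of_forall_nonneg
    (AddMonoidHom.mrange (GrothendieckAddGroup.of (M := N)))
    (by rw [AddMonoidHom.mrange_eq_map]; exact (AddMonoid.fg_def.1 h.fg).map _)
    (GrothendieckAddGroup.of a - GrothendieckAddGroup.of b) (by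
      intro l hl
      obtain ⟨α, hα⟩ := exists_dual_of_nonneg (l.comp GrothendieckAddGroup.of)
        fun c => hl _ ⟨c, rfl⟩
      have h1 : ((α b : ℕ) : ℤ) ≤ α a := by exact_mod_cast hab α
      rw [hα, hα] at h1
      rw [map_sub]
      exact sub_nonneg.2 h1)
  obtain ⟨c, hc⟩ := hS
  refine h.saturated m a b c hm (h.of_injective ?_)
  rw [map_add, hc, map_nsmul, map_nsmul, nsmul_sub]
  abel

theorem isSharp_dual : IsSharp (Dual N) := fun α β h => by
  ext a
  have := congrArg (fun f => f a) h
  simp only [AddMonoidHom.add_apply, AddMonoidHom.zero_apply] at this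
  simp only [AddMonoidHom.zero_apply]
  omega

/-- The dual of a finitely generated monoid is finitely generated: evaluation at generators embeds
it into some `ℕ^T`, as a submonoid closed under those differences that exist in `ℕ^T`. -/
theorem fg_dual (hN : AddMonoid.FG N) : AddMonoid.FG (Dual N) := by
  obtain ⟨T, hT⟩ := AddMonoid.fg_def.1 hN
  let e : Dual N →+ (T → ℕ) :=
    { toFun := fun α t => α t
      map_zero' := rfl
      map_add' := fun _ _ => rfl }
  have he : Function.Injective e := fun α β h => by
    refine AddMonoidHom.eq_of_eqOn_denseM hT fun t ht => congrFun h ⟨t, ht⟩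
  have hfg : (AddMonoidHom.mrange e).FG := by
    refine AddSubmonoid.fg_of_subtractive ?_
    rintro _ ⟨α, rfl⟩ y ⟨β, hβ⟩
    have hβ' : ∀ t : T, β t = α t + y t := fun t => congrFun hβ t
    have hle : ∀ a, α a ≤ β a := fun a => by
      have : a ∈ AddSubmonoid.closure (T : Set N) := hT ▸ AddSubmonoid.mem_top a
      refine AddSubmonoid.closure_induction (fun x hx => ?_) (by simp)
        (fun x y _ _ h1 h2 => by simpa using add_le_add h1 h2) this
      have := hβ' ⟨x, hx⟩
      simp only at this
      omega
    obtain ⟨γ, hγ⟩ := exists_dual_of_nonneg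
      ((Nat.castAddMonoidHom ℤ).comp β - (Nat.castAddMonoidHom ℤ).comp α)
      (fun a => by simpa using hle a)
    refine ⟨γ, funext fun t => ?_⟩
    have h1 := hγ t
    have h2 := hβ' t
    simp only [AddMonoidHom.sub_apply, AddMonoidHom.comp_apply, Nat.coe_castAddMonoidHom] at h1
    change γ t = y t
    omega
  rw [AddMonoidHom.mrange_eq_map] at hfg
  rw [AddMonoid.fg_def]
  exact AddSubmonoid.FG.map_injective e he hfg

theorem isToric_dual (hN : AddMonoid.FG N) : IsToric (Dual N) where
  fg := fg_dual hN
  integral a b c h := by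
    ext t
    have := congrArg (fun f => f t) h
    simp only [AddMonoidHom.add_apply] at this
    omega
  torsionFree n a hn h := by
    ext t
    have := congrArg (fun f => f t) h
    simp only [AddMonoidHom.nsmul_apply, AddMonoidHom.zero_apply, smul_eq_mul] at this
    simpa [hn.ne'] using this
  saturated n a b c hn h := by
    have hle : ∀ t, b t ≤ a t := fun t => by
      have := congrArg (fun f => f t) h
      simp only [AddMonoidHom.add_apply, AddMonoidHom.nsmul_apply, smul_eq_mul] at this
      exact Nat.le_of_mul_le_mul_left (this ▸ Nat.le_add_right _ _) hn
    obtain ⟨γ, hγ⟩ := exists_dual_of_nonneg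
      ((Nat.castAddMonoidHom ℤ).comp a - (Nat.castAddMonoidHom ℤ).comp b)
      (fun a => by simpa using hle a)
    refine ⟨γ, AddMonoidHom.ext fun t => ?_⟩
    have h1 := hγ t
    have h2 := hle t
    simp only [AddMonoidHom.sub_apply, AddMonoidHom.comp_apply, Nat.coe_castAddMonoidHom] at h1
    simp only [AddMonoidHom.add_apply]
    omega

/-! ### Faces -/

/-- The smallest face which contains `t`. -/
def faceOf (t : N) : AddSubmonoid N where
  carrier := {a | ∃ (k : ℕ) (d : N), k • t = a + d}
  zero_mem' := ⟨0, 0, by simp⟩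
  add_mem' := by
    rintro a b ⟨k, d, h⟩ ⟨l, e, h'⟩
    exact ⟨k + l, d + e, by rw [add_nsmul, h, h']; abel⟩

theorem self_mem_faceOf (t : N) : t ∈ faceOf t := ⟨1, 0, by simp⟩

theorem isFace_faceOf (t : N) : IsFace (faceOf t) := by
  rintro p q ⟨k, d, h⟩
  exact ⟨k, q + d, by rw [h, add_assoc]⟩

theorem IsFace.faceOf_le {S : AddSubmonoid N} (hS : IsFace S) {t : N} (ht : t ∈ S) :
    faceOf t ≤ S := by
  rintro a ⟨k, d, h⟩
  exact hS a d (h ▸ nsmul_mem ht k)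

theorem mem_monInterior {t : N} : t ∈ monInterior N ↔ ∀ a, a ∈ faceOf t := by
  constructor
  · intro h a
    by_contra hcon
    exact h (faceOf t) (isFace_faceOf t) (fun h => hcon (h ▸ AddSubmonoid.mem_top a))
      (self_mem_faceOf t)
  · intro h S hS hne ht
    exact hne (top_le_iff.1 fun a _ => hS.faceOf_le ht (h a))

/-- Every face of a finitely generated monoid is generated, as a face, by a single element. -/
theorem IsFace.exists_eq_faceOf (hN : AddMonoid.FG N) {S : AddSubmonoid N} (hS : IsFace S) :
    ∃ s ∈ S, S = faceOf s := by
  classical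
  obtain ⟨T, hT⟩ := AddMonoid.fg_def.1 hN
  have hs : ∑ t ∈ T with t ∈ S, t ∈ S := sum_mem fun t ht => (Finset.mem_filter.1 ht).2
  refine ⟨_, hs, le_antisymm (fun a ha => ?_) (hS.faceOf_le hs)⟩
  have hmem : a ∈ AddSubmonoid.closure (T : Set N) := hT ▸ AddSubmonoid.mem_top a
  induction hmem using AddSubmonoid.closure_induction with
  | mem x hx =>
    exact ⟨1, ∑ t ∈ (T.filter (· ∈ S)).erase x, t, by
      rw [one_nsmul, Finset.add_sum_erase _ (fun t => t) (Finset.mem_filter.2 ⟨hx, ha⟩)]⟩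
  | zero => exact zero_mem _
  | add x y _ _ h1 h2 => exact add_mem (h1 (hS x y ha)) (h2 (hS y x (add_comm x y ▸ ha)))

theorem exists_mem_monInterior (hN : AddMonoid.FG N) : ∃ t, t ∈ monInterior N := by
  obtain ⟨s, -, hs⟩ := IsFace.exists_eq_faceOf hN (S := ⊤) (fun _ _ _ => AddSubmonoid.mem_top _)
  exact ⟨s, mem_monInterior.2 fun a => hs ▸ AddSubmonoid.mem_top a⟩

theorem eq_zero_of_mem_faceOf {s a : N} (α : Dual N) (h : a ∈ faceOf s) (hs : α s = 0) :
    α a = 0 := by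
  obtain ⟨k, d, e⟩ := h
  have := congrArg α e
  simp only [map_nsmul, hs, smul_zero, map_add] at this
  omega

/-- The relative version of `IsToric.exists_add_of_forall_le`, for the localization at the face
generated by `s`. -/
theorem IsToric.exists_add_nsmul_of_forall_le (h : IsToric N) {a b s : N}
    (hab : ∀ α : Dual N, α s = 0 → α b ≤ α a) : ∃ (k : ℕ) (d : N), a + k • s = b + d := by
  obtain ⟨T, hT⟩ := AddMonoid.fg_def.1 (fg_dual h.fg)
  refine ⟨∑ α ∈ T, α b, h.exists_add_of_forall_le fun β => ?_⟩
  have hmem : β ∈ AddSubmonoid.closure (T : Set (Dual N)) := hT ▸ AddSubmonoid.mem_top β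
  induction hmem using AddSubmonoid.closure_induction with
  | mem α hα =>
    by_cases h0 : α s = 0
    · exact (hab α h0).trans (by simp)
    · rw [map_add, map_nsmul, smul_eq_mul]
      have h1 : α b ≤ ∑ α ∈ T, α b :=
        Finset.single_le_sum (f := fun α : Dual N => α b) (fun _ _ => Nat.zero_le _) hα
      have h2 : (∑ α ∈ T, α b) * 1 ≤ (∑ α ∈ T, α b) * α s :=
        Nat.mul_le_mul_left _ (Nat.one_le_iff_ne_zero.2 h0)
      omega
  | zero => simp
  | add x y _ _ h1 h2 => simpa using add_le_add h1 h2

/-- A face is cut out by the elements of the dual that vanish on it. -/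
theorem IsToric.mem_faceOf_of_forall (h : IsToric N) {a s : N}
    (ha : ∀ α : Dual N, α s = 0 → α a = 0) : a ∈ faceOf s := by
  obtain ⟨k, d, e⟩ := h.exists_add_nsmul_of_forall_le (a := 0) (b := a) (s := s)
    (fun α hα => by simp [ha α hα])
  exact ⟨k, d, by simpa using e⟩

/-- The dual of a sharp toric monoid separates its elements. -/
theorem IsToric.eq_of_forall_eq (h : IsToric N) (hs : IsSharp N) {a b : N}
    (hab : ∀ α : Dual N, α a = α b) : a = b := by
  have := h.isCancelAdd
  obtain ⟨d, rfl⟩ := h.exists_add_of_forall_le (a := a) (b := b) fun α => (hab α).ge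
  obtain ⟨e, he⟩ := h.exists_add_of_forall_le (a := b) (b := b + d) fun α => (hab α).le
  have : d + e = 0 := by
    apply add_left_cancel (a := b)
    rw [← add_assoc, ← he, add_zero]
  rw [hs d e this, add_zero]

/-- On a sharp toric monoid there is a functional which is positive except at `0`. -/
theorem IsToric.exists_pos (h : IsToric N) (hs : IsSharp N) :
    ∃ α : Dual N, ∀ a, α a = 0 → a = 0 := by
  obtain ⟨α, hα⟩ := exists_mem_monInterior (fg_dual h.fg)
  refine ⟨α, fun a ha => h.eq_of_forall_eq hs fun β => ?_⟩
  obtain ⟨k, d, e⟩ := mem_monInterior.1 hα β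
  have := congrArg (fun f => f a) e
  simp only [AddMonoidHom.nsmul_apply, ha, smul_zero, AddMonoidHom.add_apply] at this
  simp only [map_zero]
  omega

/-- If `l` is nonnegative where the functional `α` vanishes, then `l + k • α` is
nonnegative for large `k`. -/
theorem exists_dual_eq_add_nsmul (hN : AddMonoid.FG N) (l : N →+ ℤ) (α : Dual N)
    (h : ∀ a, α a = 0 → 0 ≤ l a) : ∃ (k : ℕ) (β : Dual N), ∀ a, (β a : ℤ) = l a + k * α a := by
  obtain ⟨T, hT⟩ := AddMonoid.fg_def.1 hN
  set k := ∑ t ∈ T, (l t).natAbs with hk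
  have hnn : ∀ a, 0 ≤ (l + k • (Nat.castAddMonoidHom ℤ).comp α) a := fun a => by
    have hmem : a ∈ AddSubmonoid.closure (T : Set N) := hT ▸ AddSubmonoid.mem_top a
    induction hmem using AddSubmonoid.closure_induction with
    | mem t ht =>
      simp only [AddMonoidHom.add_apply, AddMonoidHom.nsmul_apply, AddMonoidHom.comp_apply,
        Nat.coe_castAddMonoidHom, nsmul_eq_mul]
      by_cases h0 : α t = 0
      · simpa [h0] using h t h0
      · have h1 : (l t).natAbs ≤ k :=
          Finset.single_le_sum (f := fun t => (l t).natAbs) (fun _ _ => Nat.zero_le _) ht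
        have h2 : (k : ℤ) * 1 ≤ k * α t :=
          mul_le_mul_of_nonneg_left (by omega) (by omega)
        omega
    | zero => simp
    | add x y _ _ h1 h2 => rw [map_add]; exact add_nonneg h1 h2
  obtain ⟨β, hβ⟩ := exists_dual_of_nonneg _ hnn
  exact ⟨k, β, fun a => by simpa using hβ a⟩

/-- All integral functionals on a sharp toric monoid are differences of elements of the dual. -/
theorem IsToric.exists_eq_sub (h : IsToric N) (hs : IsSharp N) (l : N →+ ℤ) :
    ∃ α β : Dual N, ∀ a, l a = (α a : ℤ) - β a := by
  obtain ⟨α, hα⟩ := h.exists_pos hs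
  obtain ⟨k, β, hβ⟩ := exists_dual_eq_add_nsmul h.fg l α fun a ha => by simp [hα a ha]
  exact ⟨β, k • α, fun a => by simp [hβ a]⟩

/-- Sharp toric monoids are reflexive. -/
theorem IsToric.exists_eval_eq (h : IsToric N) (hs : IsSharp N) (φ : Dual (Dual N)) :
    ∃ a : N, ∀ α : Dual N, φ α = α a := by
  have := finite_grothendieck h.fg
  have := h.isAddTorsionFree
  have hD := isToric_dual h.fg
  let B := Module.finBasis ℤ (GrothendieckAddGroup N)
  choose α β hαβ using fun j =>
    h.exists_eq_sub hs ((B.coord j).toAddMonoidHom.comp GrothendieckAddGroup.of)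
  have hc : ∀ j a, B.repr (GrothendieckAddGroup.of a) j = (α j a : ℤ) - β j a := fun j a =>
    hαβ j a
  let Φ : GrothendieckAddGroup (Dual N) →+ ℤ :=
    GrothendieckAddGroup.lift ((Nat.castAddMonoidHom ℤ).comp φ)
  have hΦ : ∀ γ, Φ (GrothendieckAddGroup.of γ) = φ γ := fun γ =>
    lift_of ((Nat.castAddMonoidHom ℤ).comp φ) γ
  let E : GrothendieckAddGroup (Dual N) →+ (N →+ ℤ) :=
    GrothendieckAddGroup.lift
      { toFun := fun γ => (Nat.castAddMonoidHom ℤ).comp γ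
        map_zero' := by ext; simp
        map_add' := fun _ _ => by ext; simp }
  have hE : ∀ γ a, E (GrothendieckAddGroup.of γ) a = γ a := fun γ a =>
    congrArg (fun f => f a) (lift_of (_ : Dual N →+ (N →+ ℤ)) γ)
  have hEinj : Function.Injective E := by
    rw [injective_iff_map_eq_zero]
    intro x hx
    obtain ⟨γ, δ, rfl⟩ := exists_of_sub_of x
    rw [sub_eq_zero]
    congr 1
    ext a
    have := congrArg (fun f => f a) hx
    simp only [map_sub, AddMonoidHom.sub_apply, hE, AddMonoidHom.zero_apply] at this
    omega
  -- a functional is determined by its values on a basis of the group completion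
  have key : ∀ γ : Dual N, GrothendieckAddGroup.of γ = ∑ j,
      (GrothendieckAddGroup.lift ((Nat.castAddMonoidHom ℤ).comp γ) (B j)) •
        (GrothendieckAddGroup.of (α j) - GrothendieckAddGroup.of (β j)) := by
    intro γ
    apply hEinj
    ext a
    have e1 : (γ a : ℤ) = GrothendieckAddGroup.lift ((Nat.castAddMonoidHom ℤ).comp γ)
        (GrothendieckAddGroup.of a) :=
      (lift_of ((Nat.castAddMonoidHom ℤ).comp γ) a).symm
    rw [hE, e1]
    conv_lhs => rw [← B.sum_repr (GrothendieckAddGroup.of a)]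
    simp only [map_sum, map_zsmul, AddMonoidHom.finsetSum_apply, AddMonoidHom.zsmul_apply, map_sub,
      AddMonoidHom.sub_apply, hE, hc]
    exact Finset.sum_congr rfl fun j _ => by simp only [smul_eq_mul]; ring
  obtain ⟨a, b, hab⟩ := exists_of_sub_of (∑ j, ((φ (α j) : ℤ) - φ (β j)) • B j)
  have hφ : ∀ γ : Dual N, (φ γ : ℤ) = γ a - γ b := by
    intro γ
    have hl : ∀ c, GrothendieckAddGroup.lift ((Nat.castAddMonoidHom ℤ).comp γ)
        (GrothendieckAddGroup.of c) = γ c := fun c =>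
      lift_of ((Nat.castAddMonoidHom ℤ).comp γ) c
    rw [← hΦ, key γ, ← hl a, ← hl b, ← map_sub, ← hab]
    simp only [map_sum, map_zsmul, map_sub, hΦ]
    exact Finset.sum_congr rfl fun j _ => by simp only [smul_eq_mul]; ring
  obtain ⟨d, rfl⟩ := h.exists_add_of_forall_le (a := a) (b := b) fun γ => by
    have := hφ γ
    omega
  refine ⟨d, fun γ => ?_⟩
  have := hφ γ
  rw [map_add] at this
  omega

/-- The biduality isomorphism of a sharp toric monoid. -/
noncomputable def IsToric.bidual (h : IsToric N) (hs : IsSharp N) : N ≃+ Dual (Dual N) :=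
  AddEquiv.ofBijective (AddMonoidHom.eval : N →+ Dual (Dual N))
    ⟨fun _ _ hab => h.eq_of_forall_eq hs fun α => congrArg (fun f => f α) hab,
     fun φ => (h.exists_eval_eq hs φ).imp fun _ ha => AddMonoidHom.ext fun α => (ha α).symm⟩

/-- Real functionals on submonoids extend. -/
theorem exists_extension (h : IsToric N) (T : AddSubmonoid N) (φ : T →+ ℝ) :
    ∃ Φ : N →+ ℝ, ∀ t : T, Φ t = φ t := by
  have := h.isCancelAdd
  let f : GrothendieckAddGroup T →+ GrothendieckAddGroup N :=
    GrothendieckAddGroup.lift (GrothendieckAddGroup.of.comp T.subtype)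
  have hf : ∀ t, f (GrothendieckAddGroup.of t) = GrothendieckAddGroup.of (t : N) := fun t =>
    lift_of (GrothendieckAddGroup.of.comp T.subtype) t
  have hinj : Function.Injective f := by
    rw [injective_iff_map_eq_zero]
    intro x hx
    obtain ⟨a, b, rfl⟩ := exists_of_sub_of x
    rw [map_sub, hf, hf, sub_eq_zero] at hx
    rw [Subtype.ext (h.of_injective hx), sub_self]
  obtain ⟨Φ, hΦ⟩ := (Module.Baer.of_divisible ℝ).extension_property_addMonoidHom f hinj
    (GrothendieckAddGroup.lift φ)
  refine ⟨Φ.comp GrothendieckAddGroup.of, fun t => ?_⟩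
  have h1 := congrArg (fun f => f (GrothendieckAddGroup.of t)) hΦ
  simp only [AddMonoidHom.comp_apply, hf] at h1
  rw [AddMonoidHom.comp_apply, h1]
  exact lift_of φ t

/-! ### Dimensions -/

variable {M : Type*} [AddCommMonoid M]

/-- The homomorphism of group completions induced by a homomorphism of monoids. -/
noncomputable def gpMap (f : N →+ M) : GrothendieckAddGroup N →ₗ[ℤ] GrothendieckAddGroup M :=
  (GrothendieckAddGroup.lift (GrothendieckAddGroup.of.comp f)).toIntLinearMap

@[simp]
theorem gpMap_of (f : N →+ M) (a : N) :
    gpMap f (GrothendieckAddGroup.of a) = GrothendieckAddGroup.of (f a) :=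
  lift_of (GrothendieckAddGroup.of.comp f) a

theorem monDim_congr (e : N ≃+ M) : monDim N = monDim M := by
  refine LinearEquiv.finrank_eq (LinearEquiv.ofLinearMap (gpMap e.toAddMonoidHom)
    (gpMap e.symm.toAddMonoidHom) ?_ ?_)
  all_goals
    ext x
    obtain ⟨a, b, rfl⟩ := exists_of_sub_of x
    simp only [LinearMap.comp_apply, map_sub, gpMap_of, LinearMap.id_apply]
    simp

/-- A surjection strictly decreases the dimension if it identifies two elements that are separated
by a functional. -/
theorem monDim_lt_of_surjective (hN : AddMonoid.FG N) (g : N →+ M) (hg : Function.Surjective g)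
    {a b : N} (hab : g a = g b) (χ : Dual N) (hχ : χ a ≠ χ b) : monDim M < monDim N := by
  have := finite_grothendieck hN
  have hs : Function.Surjective (gpMap g) := fun x => by
    obtain ⟨a, b, rfl⟩ := exists_of_sub_of x
    obtain ⟨a, rfl⟩ := hg a
    obtain ⟨b, rfl⟩ := hg b
    exact ⟨GrothendieckAddGroup.of a - GrothendieckAddGroup.of b, by simp only [map_sub, gpMap_of]⟩
  have h1 := Submodule.finrank_quotient_add_finrank (LinearMap.ker (gpMap g))
  rw [((gpMap g).quotKerEquivOfSurjective hs).finrank_eq] at h1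
  have h2 : Module.finrank ℤ (LinearMap.ker (gpMap g)) ≠ 0 := by
    intro h0
    obtain ⟨n, hn, e⟩ := Module.finrank_eq_zero_iff.1 h0
      ⟨GrothendieckAddGroup.of a - GrothendieckAddGroup.of b, by
        rw [LinearMap.mem_ker, map_sub, gpMap_of, gpMap_of, hab, sub_self]⟩
    have e1 := congrArg (GrothendieckAddGroup.lift ((Nat.castAddMonoidHom ℤ).comp χ))
      (congrArg Subtype.val e)
    have hl : ∀ c, GrothendieckAddGroup.lift ((Nat.castAddMonoidHom ℤ).comp χ)
        (GrothendieckAddGroup.of c) = χ c := fun c =>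
      lift_of ((Nat.castAddMonoidHom ℤ).comp χ) c
    simp only [SetLike.val_smul, map_zsmul, map_sub, hl, smul_eq_mul, ZeroMemClass.coe_zero,
      map_zero, mul_eq_zero, hn, false_or] at e1
    omega
  unfold monDim
  omega

/-- A submonoid has full dimension iff every element has a multiple in the group it generates. -/
theorem monDim_eq_iff (hM : IsToric M) (f : N →+ M)
    (hf : Function.Injective f) : monDim N = monDim M ↔
      ∀ t, ∃ m : ℕ, 0 < m ∧ ∃ a b, m • t + f b = f a := by
  have := finite_grothendieck hM.fg
  have hinj : Function.Injective (gpMap f) := by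
    rw [injective_iff_map_eq_zero]
    intro x hx
    obtain ⟨a, b, rfl⟩ := exists_of_sub_of x
    rw [map_sub, gpMap_of, gpMap_of, sub_eq_zero] at hx
    rw [hf (hM.of_injective hx), sub_self]
  have h1 := Submodule.finrank_quotient_add_finrank (LinearMap.range (gpMap f))
  rw [LinearMap.finrank_range_of_inj hinj] at h1
  have h2 : monDim N = monDim M ↔
      Module.finrank ℤ (GrothendieckAddGroup M ⧸ LinearMap.range (gpMap f)) = 0 := by
    unfold monDim
    omega
  have h3 : ∀ (t : M) (n : ℤ), n • (Submodule.Quotient.mk (GrothendieckAddGroup.of t) :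
      GrothendieckAddGroup M ⧸ LinearMap.range (gpMap f)) = 0 ↔
      n • GrothendieckAddGroup.of t ∈ LinearMap.range (gpMap f) := fun t n => by
    rw [← Submodule.Quotient.mk_smul, Submodule.Quotient.mk_eq_zero]
  rw [h2, Module.finrank_eq_zero_iff]
  constructor
  · intro H t
    obtain ⟨n, hn, e⟩ := H (Submodule.Quotient.mk (GrothendieckAddGroup.of t))
    have e' : (n.natAbs : ℤ) • GrothendieckAddGroup.of t ∈ LinearMap.range (gpMap f) := by
      rw [h3] at e
      rcases Int.natAbs_eq n with h | h
      · rwa [← h]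
      · rw [h] at e
        simpa using e
    obtain ⟨x, hx⟩ := e'
    obtain ⟨a, b, rfl⟩ := exists_of_sub_of x
    refine ⟨n.natAbs, Int.natAbs_pos.2 hn, a, b, hM.of_injective ?_⟩
    simp only [map_sub, gpMap_of, natCast_zsmul] at hx
    rw [map_add, map_nsmul, ← hx]
    abel
  · intro H x
    have H' : ∀ t, ∃ m : ℕ, 0 < m ∧ (m : ℤ) • GrothendieckAddGroup.of t ∈
        LinearMap.range (gpMap f) := fun t => by
      obtain ⟨m, hm, a, b, e⟩ := H t
      refine ⟨m, hm, GrothendieckAddGroup.of a - GrothendieckAddGroup.of b, ?_⟩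
      have := congrArg GrothendieckAddGroup.of e
      rw [map_add, map_nsmul] at this
      simp only [map_sub, gpMap_of, natCast_zsmul]
      rw [← this]
      abel
    obtain ⟨y, rfl⟩ := Submodule.Quotient.mk_surjective _ x
    obtain ⟨s, t, rfl⟩ := exists_of_sub_of y
    obtain ⟨m, hm, hs⟩ := H' s
    obtain ⟨n, hn, ht⟩ := H' t
    refine ⟨(n : ℤ) * m, by positivity, ?_⟩
    rw [← Submodule.Quotient.mk_smul, Submodule.Quotient.mk_eq_zero, smul_sub]
    refine Submodule.sub_mem _ ?_ ?_
    · rw [mul_smul]; exact Submodule.smul_mem _ _ hs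
    · rw [mul_comm, mul_smul]; exact Submodule.smul_mem _ _ ht

end Toric

end GCorners

namespace GCorners

/-! ### Points of model spaces -/

section Points

variable {N : Type*} [AddCommMonoid N]

theorem ModelSpace.ext {x y : ModelSpace N} (h : ∀ p, x p = y p) : x = y :=
  Subtype.ext (funext h)

theorem ModelSpace.map_zero (x : ModelSpace N) : x 0 = 1 := x.2.1

theorem ModelSpace.map_add (x : ModelSpace N) (p q : N) : x (p + q) = x p * x q := x.2.2 p q

theorem ModelSpace.map_nsmul (x : ModelSpace N) (k : ℕ) (p : N) : x (k • p) = x p ^ k := by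
  induction k with
  | zero => simp [x.map_zero]
  | succ k ih => rw [succ_nsmul, x.map_add, ih, pow_succ]

theorem continuous_coord (p : N) : Continuous fun x : ModelSpace N => x p :=
  (continuous_apply p).comp continuous_subtype_val

theorem ModelSpace.tendsto_iff {ι : Type*} {l : Filter ι} {f : ι → ModelSpace N}
    {x : ModelSpace N} : Tendsto f l (𝓝 x) ↔ ∀ p, Tendsto (fun i => f i p) l (𝓝 (x p)) := by
  exact (tendsto_subtype_rng (p := fun x : N → ℝ≥0 => x 0 = 1 ∧ ∀ p q, x (p + q) = x p * x q)
    (f := f)).trans tendsto_pi_nhds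

theorem ModelSpace.continuousAt_iff {Y : Type*} [TopologicalSpace Y] {f : Y → ModelSpace N}
    {y : Y} : ContinuousAt f y ↔ ∀ p, ContinuousAt (fun z => f z p) y :=
  ModelSpace.tendsto_iff

theorem ModelSpace.continuous_iff {Y : Type*} [TopologicalSpace Y] {f : Y → ModelSpace N} :
    Continuous f ↔ ∀ p, Continuous fun y => f y p := by
  simp only [continuous_iff_continuousAt, ModelSpace.continuousAt_iff]
  exact ⟨fun h p y => h y p, fun h y p => h p y⟩

instance : T2Space (ModelSpace N) := inferInstanceAs (T2Space {_x : N → ℝ≥0 // _})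

theorem IsToric.countable (h : IsToric N) (hs : IsSharp N) : Countable N := by
  obtain ⟨T, hT⟩ := AddMonoid.fg_def.1 (fg_dual h.fg)
  have : Function.Injective fun (a : N) (t : T) => (t : Dual N) a := by
    intro a b hab
    refine h.eq_of_forall_eq hs fun α => ?_
    have := AddMonoidHom.eq_of_eqOn_denseM hT
      (f := AddMonoidHom.eval a) (g := AddMonoidHom.eval b) fun t ht => congrFun hab ⟨t, ht⟩
    exact congrArg (fun f => f α) this
  exact this.countable

theorem IsToric.secondCountable (h : IsToric N) (hs : IsSharp N) :
    SecondCountableTopology (ModelSpace N) := by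
  have := h.countable hs
  have : SecondCountableTopology {x : N → ℝ≥0 // x ∈ {x : N → ℝ≥0 | x 0 = 1 ∧
    ∀ p q, x (p + q) = x p * x q}} := inferInstance
  exact this

/-- The support of a point, which is a face. -/
def supp (x : ModelSpace N) : AddSubmonoid N where
  carrier := {p | x p ≠ 0}
  zero_mem' := by simp [x.map_zero]
  add_mem' := fun {p q} hp hq => by
    rw [Set.mem_ofPred_eq, x.map_add]
    exact mul_ne_zero hp hq

theorem mem_supp {x : ModelSpace N} {p : N} : p ∈ supp x ↔ x p ≠ 0 := Iff.rfl

theorem isFace_supp (x : ModelSpace N) : IsFace (supp x) := fun p q h => by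
  rw [mem_supp, x.map_add] at h
  exact left_ne_zero_of_mul h

/-- The cone of a point of `X_N`: the face of `N^∨` which is orthogonal to the support of the
point. It is the fibre at the point of the bundle of normal monoids to the boundary face of smallest
dimension which contains the point. -/
def cone (x : ModelSpace N) : AddSubmonoid (Dual N) where
  carrier := {α | ∀ q, x q ≠ 0 → α q = 0}
  zero_mem' := fun _ _ => rfl
  add_mem' := fun {α β} hα hβ q hq => by simp [hα q hq, hβ q hq]

theorem isFace_cone (x : ModelSpace N) : IsFace (cone x) := fun α β h q hq => by
  have := h q hq
  rw [AddMonoidHom.add_apply] at this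
  omega

theorem IsToric.exists_supp (h : IsToric N) (x : ModelSpace N) :
    ∃ s, x s ≠ 0 ∧ supp x = faceOf s :=
  (isFace_supp x).exists_eq_faceOf h.fg

theorem IsToric.ne_zero_iff (h : IsToric N) (x : ModelSpace N) (q : N) :
    x q ≠ 0 ↔ ∀ α ∈ cone x, α q = 0 := by
  refine ⟨fun hq α hα => hα q hq, fun H => ?_⟩
  obtain ⟨s, hs, he⟩ := h.exists_supp x
  rw [← mem_supp, he]
  refine h.mem_faceOf_of_forall fun α hα => H α fun p hp => ?_
  rw [← mem_supp, he] at hp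
  exact eq_zero_of_mem_faceOf α hp hα

theorem IsToric.cone_le_iff (h : IsToric N) {x y : ModelSpace N} :
    cone y ≤ cone x ↔ ∀ q, x q ≠ 0 → y q ≠ 0 := by
  constructor
  · intro H q hq
    rw [h.ne_zero_iff] at hq ⊢
    exact fun α hα => hq α (H hα)
  · intro H α hα q hq
    exact hα q (H q hq)

theorem IsToric.cone_eq_iff (h : IsToric N) {x y : ModelSpace N} :
    cone y = cone x ↔ ∀ q, y q ≠ 0 ↔ x q ≠ 0 := by
  rw [le_antisymm_iff, h.cone_le_iff, h.cone_le_iff]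
  exact ⟨fun H q => ⟨H.2 q, H.1 q⟩, fun H => ⟨fun q => (H q).2, fun q => (H q).1⟩⟩

/-- There is an element of the dual which is positive precisely where `x` vanishes. -/
theorem IsToric.exists_generic (h : IsToric N) (x : ModelSpace N) :
    ∃ α : Dual N, ∀ q, α q = 0 ↔ x q ≠ 0 := by
  obtain ⟨α, hα, he⟩ := (isFace_cone x).exists_eq_faceOf (fg_dual h.fg)
  refine ⟨α, fun q => ⟨fun hq => ?_, fun hq => hα q hq⟩⟩
  rw [h.ne_zero_iff]
  intro β hβ
  rw [he] at hβ
  obtain ⟨k, d, e⟩ := hβ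
  have := congrArg (fun f => f q) e
  simp only [AddMonoidHom.nsmul_apply, hq, smul_zero, AddMonoidHom.add_apply] at this
  omega

theorem IsToric.eventually_cone_le (h : IsToric N) (x : ModelSpace N) :
    ∀ᶠ y in 𝓝 x, cone y ≤ cone x := by
  obtain ⟨s, hs, he⟩ := h.exists_supp x
  filter_upwards [(continuous_coord s).continuousAt.eventually_ne hs] with y hy
  rw [h.cone_le_iff]
  intro q hq
  rw [← mem_supp, he] at hq
  exact (isFace_supp y).faceOf_le hy hq

/-- Every face of the dual is the cone of some point. -/
theorem exists_cone_eq (hN : AddMonoid.FG N) {F : AddSubmonoid (Dual N)} (hF : IsFace F) :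
    ∃ x : ModelSpace N, cone x = F := by
  classical
  have hD := isToric_dual hN
  obtain ⟨α, hα, rfl⟩ := hF.exists_eq_faceOf hD.fg
  refine ⟨⟨fun q => if α q = 0 then 1 else 0, by simp, fun p q => ?_⟩, le_antisymm ?_ ?_⟩
  · simp only [map_add]
    by_cases hp : α p = 0 <;> by_cases hq : α q = 0 <;> simp [hp, hq]
  · intro β hβ
    refine hD.mem_faceOf_of_forall fun φ hφ => ?_
    obtain ⟨k, γ, hγ⟩ := exists_dual_eq_add_nsmul hN (-(Nat.castAddMonoidHom ℤ).comp β) α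
      (fun a ha => by
        have := hβ a (by simp [ha])
        simp [this])
    have e : k • α = β + γ := by
      ext a
      have := hγ a
      simp only [AddMonoidHom.neg_apply, AddMonoidHom.comp_apply, Nat.coe_castAddMonoidHom] at this
      simp only [AddMonoidHom.nsmul_apply, smul_eq_mul, AddMonoidHom.add_apply]
      zify
      linarith
    exact eq_zero_of_mem_faceOf φ ⟨k, γ, e⟩ hφ
  · intro β hβ q hq
    have hq' : α q = 0 := by
      by_contra hcon
      exact hq (by simp [hcon])
    obtain ⟨k, d, e⟩ := hβ
    have := congrArg (fun f => f q) e
    simp only [AddMonoidHom.nsmul_apply, hq', smul_zero, AddMonoidHom.add_apply] at this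
    omega

/-! ### Deformations of points -/

/-- The action on `X_N` of the one-parameter monoid with weight `α`. -/
def flow (x : ModelSpace N) (α : Dual N) (t : ℝ≥0) : ModelSpace N :=
  ⟨fun q => x q * t ^ α q, by simp [x.map_zero], fun p q => by
    beta_reduce
    rw [x.map_add, map_add, pow_add]
    ring⟩

theorem flow_apply (x : ModelSpace N) (α : Dual N) (t : ℝ≥0) (q : N) :
    flow x α t q = x q * t ^ α q := rfl

theorem continuous_flow (x : ModelSpace N) (α : Dual N) : Continuous (flow x α) := by
  rw [ModelSpace.continuous_iff]
  intro p
  simp only [flow_apply]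
  fun_prop

theorem flow_one (x : ModelSpace N) (α : Dual N) : flow x α 1 = x :=
  ModelSpace.ext fun q => by simp [flow_apply]

theorem flow_zero {x y : ModelSpace N} {α : Dual N} (hα : ∀ q, α q = 0 ↔ x q ≠ 0)
    (hy : ∀ q, x q ≠ 0 → y q = x q) : flow y α 0 = x := by
  refine ModelSpace.ext fun q => ?_
  rw [flow_apply]
  by_cases hq : x q = 0
  · have : α q ≠ 0 := fun h => (hα q).1 h hq
    simp [this, hq]
  · rw [(hα q).2 hq, hy q hq, pow_zero, mul_one]

theorem tendsto_flow {x y : ModelSpace N} {α : Dual N} (hα : ∀ q, α q = 0 ↔ x q ≠ 0)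
    (hy : ∀ q, x q ≠ 0 → y q = x q) : Tendsto (flow y α) (𝓝[>] 0) (𝓝 x) := by
  have := (continuous_flow y α).tendsto 0
  rw [flow_zero hα hy] at this
  exact this.mono_left nhdsWithin_le_nhds

/-- A point can be extended from its support to any larger support, by extending logarithms as
real functionals. -/
theorem IsToric.exists_extend (h : IsToric N) {x y : ModelSpace N}
    (hxy : ∀ q, x q ≠ 0 → y q ≠ 0) :
    ∃ z : ModelSpace N, (∀ q, z q ≠ 0 ↔ y q ≠ 0) ∧ ∀ q, x q ≠ 0 → z q = x q := by
  let φ : supp x →+ ℝ :=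
    { toFun := fun q => Real.log (x q / y q)
      map_zero' := by simp [x.map_zero, y.map_zero]
      map_add' := fun p q => by
        have h1 : (x p : ℝ) / y p ≠ 0 := by
          simpa using ⟨p.2, hxy _ p.2⟩
        have h2 : (x q : ℝ) / y q ≠ 0 := by
          simpa using ⟨q.2, hxy _ q.2⟩
        rw [← Real.log_mul h1 h2, AddSubmonoid.coe_add, x.map_add, y.map_add, NNReal.coe_mul,
          NNReal.coe_mul, mul_div_mul_comm] }
  obtain ⟨Φ, hΦ⟩ := exists_extension h (supp x) φ
  refine ⟨⟨fun q => y q * (Real.exp (Φ q)).toNNReal, by simp [y.map_zero], fun p q => ?_⟩,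
    fun q => ?_, fun q hq => ?_⟩
  · beta_reduce
    rw [y.map_add, map_add, Real.exp_add, Real.toNNReal_mul (Real.exp_pos _).le]
    ring
  · simp [Real.exp_pos]
  · have h1 : Φ q = Real.log (x q / y q) := hΦ ⟨q, hq⟩
    have h2 : (0 : ℝ) < x q / y q := by
      have := hxy q hq
      have h3 : 0 < x q := pos_iff_ne_zero.2 hq
      have h4 : 0 < y q := pos_iff_ne_zero.2 this
      positivity
    change y q * (Real.exp (Φ q)).toNNReal = x q
    rw [h1, Real.exp_log h2, ← NNReal.coe_div, Real.toNNReal_coe, mul_div_cancel₀ _ (hxy q hq)]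

/-- The trivial homomorphism as a point. -/
def onePoint : ModelSpace N := ⟨fun _ => 1, rfl, fun _ _ => by simp⟩

theorem IsToric.mem_closure_of_cone_le (h : IsToric N) {x y : ModelSpace N}
    (hxy : cone y ≤ cone x) : x ∈ closure {z | cone z = cone y} := by
  obtain ⟨z, hz, hzx⟩ := h.exists_extend (h.cone_le_iff.1 hxy)
  obtain ⟨α, hα⟩ := h.exists_generic x
  refine mem_closure_of_tendsto (tendsto_flow hα hzx) ?_
  filter_upwards [self_mem_nhdsWithin] with t ht
  have ht0 : t ≠ 0 := ne_of_gt ht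
  refine h.cone_eq_iff.2 fun q => ?_
  rw [flow_apply, ← hz]
  simp [ht0]

theorem eq_of_tendsto_mul_pow {u v : ℝ≥0 → ℝ} {u₀ v₀ : ℝ} (hu : Tendsto u (𝓝[>] 0) (𝓝 u₀))
    (hv : Tendsto v (𝓝[>] 0) (𝓝 v₀)) (hu₀ : 0 < u₀) (hv₀ : 0 < v₀) {a b : ℕ}
    (h : ∀ᶠ t in 𝓝[>] 0, u t * (t : ℝ) ^ a = v t * (t : ℝ) ^ b) : a = b := by
  wlog hab : a ≤ b generalizing u v u₀ v₀ a b
  · exact (this hv hu hv₀ hu₀ (h.mono fun _ ht => ht.symm) (not_le.1 hab).le).symm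
  obtain ⟨c, rfl⟩ := Nat.exists_eq_add_of_le hab
  have hne : (𝓝[>] (0 : ℝ≥0)).NeBot := inferInstance
  rcases Nat.eq_zero_or_pos c with rfl | hc
  · simp
  exfalso
  have h1 : ∀ᶠ t in 𝓝[>] (0 : ℝ≥0), u t = v t * (t : ℝ) ^ c := by
    filter_upwards [h, self_mem_nhdsWithin] with t ht ht0
    have h0 : (0 : ℝ) < t := ht0
    have h2 : (t : ℝ) ^ a ≠ 0 := by positivity
    rw [pow_add, ← mul_assoc, mul_right_comm] at ht
    exact mul_right_cancel₀ h2 ht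
  have h2 : Tendsto (fun t : ℝ≥0 => v t * (t : ℝ) ^ c) (𝓝[>] 0) (𝓝 (v₀ * 0)) := by
    refine hv.mul ?_
    have : Tendsto (fun t : ℝ≥0 => (t : ℝ) ^ c) (𝓝 0) (𝓝 (((0 : ℝ≥0) : ℝ) ^ c)) :=
      (by fun_prop : Continuous fun t : ℝ≥0 => (t : ℝ) ^ c).tendsto 0
    rw [NNReal.coe_zero, zero_pow hc.ne'] at this
    exact this.mono_left nhdsWithin_le_nhds
  have := tendsto_nhds_unique (hu.congr' h1) h2
  simp at this
  exact hu₀.ne' this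

/-- The exponent of a b-function at a point is unique on the cone of the point: for generic elements
of the cone, it is a rate of decay along the flow, and every element of the cone is the difference
of two generic ones. -/
theorem IsToric.exponent_unique (hN : IsToric N) {x : ModelSpace N} {h h' : ModelSpace N → ℝ}
    {p p' : N} (hc : ContinuousAt h x) (hc' : ContinuousAt h' x) (h0 : 0 < h x) (h0' : 0 < h' x)
    (he : ∀ᶠ y in 𝓝 x, h y * (y p : ℝ) = h' y * (y p' : ℝ)) {α : Dual N} (hα : α ∈ cone x) :
    α p = α p' := by
  obtain ⟨z, hz, hzx⟩ := hN.exists_extend (x := x) (y := onePoint) fun _ _ => one_ne_zero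
  have hz0 : ∀ q, z q ≠ 0 := fun q => (hz q).2 one_ne_zero
  have key : ∀ β : Dual N, (∀ q, β q = 0 ↔ x q ≠ 0) → β p = β p' := by
    intro β hβ
    have ht := tendsto_flow hβ hzx
    have hp : ∀ q, (0 : ℝ) < z q := fun q => by
      have := pos_iff_ne_zero.2 (hz0 q)
      exact_mod_cast this
    refine eq_of_tendsto_mul_pow (u := fun t => h (flow z β t) * z p)
      (v := fun t => h' (flow z β t) * z p') ((hc.tendsto.comp ht).mul_const _)
      ((hc'.tendsto.comp ht).mul_const _) (mul_pos h0 (hp _)) (mul_pos h0' (hp _)) ?_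
    filter_upwards [ht.eventually he] with t ht
    simp only [flow_apply, NNReal.coe_mul, NNReal.coe_pow] at ht
    linarith
  obtain ⟨β, hβ⟩ := hN.exists_generic x
  have h1 := key β hβ
  have h2 := key (β + α) fun q => by
    rw [AddMonoidHom.add_apply, Nat.add_eq_zero_iff, ← hβ q]
    exact ⟨fun h => h.1, fun h => ⟨h, hα q ((hβ q).1 h)⟩⟩
  simp only [AddMonoidHom.add_apply] at h2
  omega

/-! ### Connectedness -/

/-- The path between two points with the same support which is a straight line in logarithmic
coordinates. -/
noncomputable def logPath (x y : ModelSpace N) (t : ℝ) : ModelSpace N :=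
  ⟨fun q => x q ^ (1 - t) * y q ^ t, by simp [x.map_zero, y.map_zero], fun p q => by
    beta_reduce
    rw [x.map_add, y.map_add, NNReal.mul_rpow, NNReal.mul_rpow]
    ring⟩

theorem logPath_apply (x y : ModelSpace N) (t : ℝ) (q : N) :
    logPath x y t q = x q ^ (1 - t) * y q ^ t := rfl

theorem rpow_mul_rpow_mem_uIcc {a b : ℝ≥0} (hab : a ≠ 0 ↔ b ≠ 0) {t : ℝ} (h0 : 0 ≤ t)
    (h1 : t ≤ 1) : a ^ (1 - t) * b ^ t ∈ Set.uIcc a b := by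
  by_cases ha : a = 0
  · have hb : b = 0 := by by_contra h; exact hab.2 h ha
    subst ha hb
    rcases eq_or_ne t 0 with rfl | ht
    · simp
    · simp [NNReal.zero_rpow ht]
  have hb := hab.1 ha
  have e : ∀ c : ℝ≥0, c ≠ 0 → c ^ (1 - t) * c ^ t = c := fun c hc => by
    rw [← NNReal.rpow_add hc]; simp
  rcases le_total a b with h | h
  · rw [Set.uIcc_of_le h]
    constructor
    · conv_lhs => rw [← e a ha]
      gcongr
    · conv_rhs => rw [← e b hb]
      have : a ^ (1 - t) ≤ b ^ (1 - t) := NNReal.rpow_le_rpow h (by linarith)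
      gcongr
  · rw [Set.uIcc_of_ge h]
    constructor
    · conv_lhs => rw [← e b hb]
      have : b ^ (1 - t) ≤ a ^ (1 - t) := NNReal.rpow_le_rpow h (by linarith)
      gcongr
    · conv_rhs => rw [← e a ha]
      gcongr

theorem logPath_ne_zero_iff {x y : ModelSpace N} (h : ∀ q, x q ≠ 0 ↔ y q ≠ 0) {t : ℝ}
    (h0 : 0 ≤ t) (h1 : t ≤ 1) (q : N) : logPath x y t q ≠ 0 ↔ x q ≠ 0 := by
  constructor
  · intro H hx
    have hy : y q = 0 := by by_contra hy; exact (h q).2 hy hx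
    have := rpow_mul_rpow_mem_uIcc (h q) h0 h1
    rw [hx, hy, Set.uIcc_self, Set.mem_singleton_iff] at this
    rw [logPath_apply, hx, hy] at H
    exact H this
  · intro hx
    rw [logPath_apply]
    exact mul_ne_zero (by simp [NNReal.rpow_eq_zero_iff, hx])
      (by simp [NNReal.rpow_eq_zero_iff, (h q).1 hx])

theorem continuousOn_logPath {x y : ModelSpace N} (h : ∀ q, x q ≠ 0 ↔ y q ≠ 0) :
    ContinuousOn (logPath x y) (Icc 0 1) := by
  intro t ht
  refine ModelSpace.tendsto_iff.2 fun q => ?_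
  by_cases hx : x q = 0
  · have H : ∀ s ∈ Icc (0 : ℝ) 1, logPath x y s q = 0 := fun s hs => by
      by_contra hcon
      exact (logPath_ne_zero_iff h hs.1 hs.2 q).1 hcon hx
    rw [H t ht]
    refine tendsto_const_nhds.congr' ?_
    filter_upwards [self_mem_nhdsWithin] with s hs
    rw [H s hs]
  · have hy := (h q).1 hx
    refine Tendsto.mono_left ?_ nhdsWithin_le_nhds
    change ContinuousAt (fun t : ℝ => x q ^ (1 - t) * y q ^ t) t
    have h1 : ∀ c : ℝ≥0, c ≠ 0 → Continuous fun t : ℝ => c ^ t := fun c hc =>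
      continuous_iff_continuousAt.2 fun t =>
        (NNReal.continuousAt_rpow (Or.inl hc)).comp (f := fun t : ℝ => (c, t)) (by fun_prop)
    exact (((h1 _ hx).comp (by fun_prop : Continuous fun t : ℝ => 1 - t)).mul
      (h1 _ hy)).continuousAt

/-- There is a basis of neighbourhoods which meet all strata of `X_N` in connected sets. -/
theorem IsToric.exists_connected_nhds (hN : IsToric N) {x : ModelSpace N}
    {U : Set (ModelSpace N)} (hU : U ∈ 𝓝 x) : ∃ V ⊆ U, IsOpen V ∧ x ∈ V ∧
      ∀ C : AddSubmonoid (Dual N), IsPreconnected (V ∩ {y | cone y = C}) := by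
  obtain ⟨s, hs, hsU⟩ := (mem_nhds_induced (fun y : ModelSpace N => (y : N → ℝ≥0)) x U).1 hU
  rw [nhds_pi, Filter.mem_pi] at hs
  obtain ⟨I, hI, t, ht, hts⟩ := hs
  choose ε hε0 hε using fun p => Metric.mem_nhds_iff.1 (ht p)
  refine ⟨{y | ∀ p ∈ I, y p ∈ Metric.ball (x p) (ε p)}, fun y hy => ?_, ?_, ?_, fun C => ?_⟩
  · exact hsU (hts fun p hp => hε p (hy p hp))
  · have : {y : ModelSpace N | ∀ p ∈ I, y p ∈ Metric.ball (x p) (ε p)} =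
        ⋂ p ∈ I, (fun y : ModelSpace N => y p) ⁻¹' Metric.ball (x p) (ε p) := by
      ext y; simp
    rw [this]
    exact hI.isOpen_biInter fun p _ => Metric.isOpen_ball.preimage (continuous_coord p)
  · exact fun p _ => Metric.mem_ball_self (hε0 p)
  · refine isPreconnected_of_forall_pair fun y hy z hz => ?_
    have hyz : ∀ q, y q ≠ 0 ↔ z q ≠ 0 := hN.cone_eq_iff.1 (hy.2.trans hz.2.symm)
    refine ⟨logPath y z '' Icc 0 1, ?_, ⟨0, by simp, ?_⟩, ⟨1, by simp, ?_⟩,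
      isPreconnected_Icc.image _ (continuousOn_logPath hyz)⟩
    · rintro _ ⟨t, ht, rfl⟩
      refine ⟨fun p hp => ?_, ?_⟩
      · have hord : (Metric.ball (x p) (ε p)).OrdConnected := by
          have : Metric.ball (x p) (ε p) =
              (fun a : ℝ≥0 => (a : ℝ)) ⁻¹' Metric.ball (x p : ℝ) (ε p) := rfl
          rw [this, Real.ball_eq_Ioo]
          exact Set.OrdConnected.preimage_mono ordConnected_Ioo (fun a b h => h)
        exact hord.uIcc_subset (hy.1 p hp) (hz.1 p hp)
          (rpow_mul_rpow_mem_uIcc (hyz p) ht.1 ht.2)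
      · exact (hN.cone_eq_iff.2 (logPath_ne_zero_iff hyz ht.1 ht.2)).trans hy.2
    · exact ModelSpace.ext fun q => by simp [logPath_apply]
    · exact ModelSpace.ext fun q => by simp [logPath_apply]

theorem IsToric.isPreconnected_stratum (hN : IsToric N) (C : AddSubmonoid (Dual N)) :
    IsPreconnected {y : ModelSpace N | cone y = C} := by
  refine isPreconnected_of_forall_pair fun y hy z hz => ?_
  have hyz : ∀ q, y q ≠ 0 ↔ z q ≠ 0 := hN.cone_eq_iff.1 (hy.trans hz.symm)
  refine ⟨logPath y z '' Icc 0 1, ?_, ⟨0, by simp, ?_⟩, ⟨1, by simp, ?_⟩,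
    isPreconnected_Icc.image _ (continuousOn_logPath hyz)⟩
  · rintro _ ⟨t, ht, rfl⟩
    exact (hN.cone_eq_iff.2 (logPath_ne_zero_iff hyz ht.1 ht.2)).trans hy
  · exact ModelSpace.ext fun q => by simp [logPath_apply]
  · exact ModelSpace.ext fun q => by simp [logPath_apply]

/-- All points flow into the same point (the vertex), along a functional that is positive except at
`0`. -/
theorem IsToric.isPreconnected_univ (hN : IsToric N) (hs : IsSharp N) :
    IsPreconnected (univ : Set (ModelSpace N)) := by
  obtain ⟨α, hα⟩ := hN.exists_pos hs
  refine isPreconnected_of_forall (flow onePoint α 0) fun y _ =>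
    ⟨range (flow y α), subset_univ _, ⟨0, ?_⟩, ⟨1, flow_one y α⟩,
      isPreconnected_range (continuous_flow y α)⟩
  refine ModelSpace.ext fun q => ?_
  rw [flow_apply, flow_apply]
  by_cases hq : α q = 0
  · rw [hα q hq, y.map_zero, onePoint.map_zero]
  · simp [hq]

end Points

end GCorners

namespace GCorners

/-! ### Smooth functions and b-functions on model spaces -/

section Smooth

variable {N : Type*} [AddCommMonoid N] {N' : Type*} [AddCommMonoid N']

theorem smoothAt_of_fintype {ι : Type*} [Fintype ι] (p : ι → N) {g : (ι → ℝ) → ℝ}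
    (hg : ContDiff ℝ ∞ g) {f : ModelSpace N → ℝ} {x : ModelSpace N}
    (h : ∀ᶠ y in 𝓝 x, f y = g (fun i => (y (p i) : ℝ))) : SmoothAt f x := by
  let e := Fintype.equivFin ι
  refine ⟨Fintype.card ι, p ∘ e.symm, fun z => g fun i => z (e i), hg.comp (by fun_prop), ?_⟩
  filter_upwards [h] with y hy
  simp [hy]

theorem SmoothAt.congr {f g : ModelSpace N → ℝ} {x : ModelSpace N} (hf : SmoothAt f x)
    (h : f =ᶠ[𝓝 x] g) : SmoothAt g x := by
  obtain ⟨n, p, F, hF, hf⟩ := hf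
  refine ⟨n, p, F, hF, ?_⟩
  filter_upwards [hf, h] with y h1 h2
  rw [← h2, h1]

theorem SmoothAt.eventually {f : ModelSpace N → ℝ} {x : ModelSpace N} (hf : SmoothAt f x) :
    ∀ᶠ y in 𝓝 x, SmoothAt f y := by
  obtain ⟨n, p, F, hF, hf⟩ := hf
  filter_upwards [hf.eventually_nhds] with y hy
  exact ⟨n, p, F, hF, hy⟩

theorem SmoothAt.continuousAt {f : ModelSpace N → ℝ} {x : ModelSpace N} (hf : SmoothAt f x) :
    ContinuousAt f x := by
  obtain ⟨n, p, F, hF, hf⟩ := hf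
  refine ContinuousAt.congr ?_ (hf.mono fun _ h => h.symm)
  refine (hF.continuous.comp (continuous_pi fun i => ?_)).continuousAt
  exact NNReal.continuous_coe.comp (continuous_coord _)

theorem smoothAt_coord (p : N) (x : ModelSpace N) : SmoothAt (fun y => (y p : ℝ)) x :=
  smoothAt_of_fintype (fun _ : Unit => p) (g := fun z => z ()) (by fun_prop) (by simp)

theorem smoothAt_const (c : ℝ) (x : ModelSpace N) : SmoothAt (fun _ => c) x :=
  smoothAt_of_fintype (fun i : Empty => i.elim) (g := fun _ => c) contDiff_const (by simp)

theorem SmoothAt.comp_contDiff {n : ℕ} {f : Fin n → ModelSpace N → ℝ} {x : ModelSpace N}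
    (hf : ∀ i, SmoothAt (f i) x) {G : (Fin n → ℝ) → ℝ} (hG : ContDiff ℝ ∞ G) :
    SmoothAt (fun y => G fun i => f i y) x := by
  choose m p F hF hf using hf
  refine smoothAt_of_fintype (ι := Σ i, Fin (m i)) (fun a => p a.1 a.2)
    (g := fun z => G fun i => F i fun j => z ⟨i, j⟩) ?_ ?_
  · refine hG.comp (contDiff_pi.2 fun i => (hF i).comp (by fun_prop))
  · filter_upwards [eventually_all.2 hf] with y hy
    simp only [hy]

/-- The inverse function has to be cut off, as smooth functions on model spaces are given by functions
that are smooth on all of `ℝ^n`. -/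
theorem exists_contDiff_eq_inv {u₀ : ℝ} (h : 0 < u₀) :
    ∃ G : ℝ → ℝ, ContDiff ℝ ∞ G ∧ ∀ᶠ u in 𝓝 u₀, G u = u⁻¹ := by
  let b : ContDiffBump u₀ := ⟨u₀ / 4, u₀ / 2, by positivity, by linarith⟩
  refine ⟨fun u => b u * u⁻¹, contDiff_iff_contDiffAt.2 fun u => ?_, ?_⟩
  · by_cases hu : u = 0
    · subst hu
      have : ∀ᶠ v in 𝓝 (0 : ℝ), v < u₀ / 2 := eventually_lt_nhds (by positivity)
      refine (contDiffAt_const (c := (0 : ℝ))).congr_of_eventuallyEq ?_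
      filter_upwards [this] with v hv
      rw [b.zero_of_le_dist, zero_mul]
      rw [Real.dist_eq, abs_of_nonpos (by linarith)]
      change u₀ / 2 ≤ _
      linarith
    · exact b.contDiffAt.mul (contDiffAt_id.inv hu)
  · filter_upwards [b.eventuallyEq_one] with u hu
    simp [hu]

theorem SmoothAt.inv {f : ModelSpace N → ℝ} {x : ModelSpace N} (hf : SmoothAt f x)
    (h : 0 < f x) : SmoothAt (fun y => (f y)⁻¹) x := by
  obtain ⟨G, hG, hG'⟩ := exists_contDiff_eq_inv h
  have := SmoothAt.comp_contDiff (f := fun _ : Fin 1 => f) (x := x) (fun _ => hf)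
    (G := fun z => G (z 0)) (hG.comp (by fun_prop))
  exact this.congr (hf.continuousAt.eventually hG')

theorem ModelSpace.continuousAt_of_smoothAt {g : ModelSpace N → ModelSpace N'}
    {x : ModelSpace N} (hg : ∀ q, SmoothAt (fun y => (g y q : ℝ)) x) : ContinuousAt g x :=
  ModelSpace.continuousAt_iff.2 fun q =>
    NNReal.isEmbedding_coe.continuousAt_iff.2 (hg q).continuousAt

theorem SmoothAt.comp {g : ModelSpace N → ModelSpace N'} {x : ModelSpace N}
    (hg : ∀ q, SmoothAt (fun y => (g y q : ℝ)) x) {f : ModelSpace N' → ℝ}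
    (hf : SmoothAt f (g x)) : SmoothAt (fun y => f (g y)) x := by
  obtain ⟨n, p, F, hF, hf⟩ := hf
  exact (SmoothAt.comp_contDiff (fun i => hg (p i)) hF).congr
    (((ModelSpace.continuousAt_of_smoothAt hg).eventually hf).mono fun _ h => h.symm)

/-- `f` is, near `x`, the product of a positive smooth function and the algebraic function of `p`.
-/
def HasExponent (f : ModelSpace N → ℝ≥0) (x : ModelSpace N) (p : N) : Prop :=
  ∃ h : ModelSpace N → ℝ, SmoothAt h x ∧ 0 < h x ∧ ∀ᶠ y in 𝓝 x, (f y : ℝ) = h y * (y p : ℝ)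

theorem hasExponent_coord (p : N) (x : ModelSpace N) : HasExponent (fun y => y p) x p :=
  ⟨fun _ => 1, smoothAt_const 1 x, one_pos, by simp⟩

theorem HasExponent.congr {f g : ModelSpace N → ℝ≥0} {x : ModelSpace N} {p : N}
    (hf : HasExponent f x p) (h : f =ᶠ[𝓝 x] g) : HasExponent g x p := by
  obtain ⟨k, hk, k0, e⟩ := hf
  refine ⟨k, hk, k0, ?_⟩
  filter_upwards [e, h] with y h1 h2
  rw [← h2, h1]

theorem HasExponent.eventually {f : ModelSpace N → ℝ≥0} {x : ModelSpace N} {p : N}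
    (hf : HasExponent f x p) : ∀ᶠ y in 𝓝 x, HasExponent f y p := by
  obtain ⟨k, hk, k0, e⟩ := hf
  filter_upwards [hk.eventually, hk.continuousAt.eventually (lt_mem_nhds k0),
    e.eventually_nhds] with y h1 h2 h3
  exact ⟨k, h1, h2, h3⟩

theorem HasExponent.mul {f g : ModelSpace N → ℝ≥0} {x : ModelSpace N} {p q : N}
    (hf : HasExponent f x p) (hg : HasExponent g x q) :
    HasExponent (fun y => f y * g y) x (p + q) := by
  obtain ⟨h, hs, h0, hf⟩ := hf
  obtain ⟨k, ks, k0, hg⟩ := hg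
  refine ⟨fun y => h y * k y, hs.mul ks, mul_pos h0 k0, ?_⟩
  filter_upwards [hf, hg] with y h1 h2
  rw [NNReal.coe_mul, h1, h2, y.map_add, NNReal.coe_mul]
  ring

theorem IsToric.hasExponent_unique (hN : IsToric N) {f : ModelSpace N → ℝ≥0} {x : ModelSpace N}
    {p p' : N} (h : HasExponent f x p) (h' : HasExponent f x p') {α : Dual N}
    (hα : α ∈ cone x) : α p = α p' := by
  obtain ⟨k, hk, k0, e⟩ := h
  obtain ⟨k', hk', k0', e'⟩ := h'
  refine hN.exponent_unique hk.continuousAt hk'.continuousAt k0 k0' ?_ hα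
  filter_upwards [e, e'] with y h1 h2
  rw [← h1, h2]

/-- Exponents that agree on the cone of the point are interchangeable, as they differ by an element
of the localization at the support of the point, which gives a positive smooth function. -/
theorem IsToric.hasExponent_of_eq (hN : IsToric N) {f : ModelSpace N → ℝ≥0} {x : ModelSpace N}
    {p p' : N} (h : HasExponent f x p) (hp : ∀ α ∈ cone x, α p = α p') :
    HasExponent f x p' := by
  obtain ⟨k, hk, k0, e⟩ := h
  obtain ⟨s, hs, hse⟩ := hN.exists_supp x
  have hcone : ∀ α : Dual N, α s = 0 → α ∈ cone x := fun α hα q hq => by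
    rw [← mem_supp, hse] at hq
    exact eq_zero_of_mem_faceOf α hq hα
  obtain ⟨m, d, hd⟩ := hN.exists_add_nsmul_of_forall_le (a := p) (b := p') (s := s)
    fun α hα => (hp α (hcone α hα)).ge
  have hd0 : x d ≠ 0 := by
    rw [hN.ne_zero_iff]
    intro α hα
    have h1 := congrArg α hd
    rw [_root_.map_add, _root_.map_add, _root_.map_nsmul, hα s hs, hp α hα] at h1
    simp at h1
    omega
  have pos : ∀ {y : ModelSpace N} {q : N}, y q ≠ 0 → (0 : ℝ) < y q := fun hq => by
    exact_mod_cast pos_iff_ne_zero.2 hq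
  have hsm : (0 : ℝ) < x (m • s) := by
    refine pos ?_
    rw [x.map_nsmul]
    exact pow_ne_zero _ hs
  refine ⟨fun y => k y * ((y d : ℝ) * (y (m • s) : ℝ)⁻¹),
    hk.mul ((smoothAt_coord d x).mul ((smoothAt_coord (m • s) x).inv hsm)),
    mul_pos k0 (mul_pos (pos hd0) (inv_pos.2 hsm)), ?_⟩
  filter_upwards [e, (continuous_coord s).continuousAt.eventually_ne hs] with y hy hys
  have h1 := congrArg (fun q => (y q : ℝ)) hd
  have h2 : (y (m • s) : ℝ) ≠ 0 := by
    rw [y.map_nsmul]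
    exact_mod_cast pow_ne_zero _ hys
  simp only [y.map_add, NNReal.coe_mul] at h1
  rw [hy]
  field_simp
  linear_combination k y * h1

theorem HasExponent.smoothAt {f : ModelSpace N → ℝ≥0} {x : ModelSpace N} {p : N}
    (h : HasExponent f x p) : SmoothAt (fun y => (f y : ℝ)) x := by
  obtain ⟨k, hk, k0, e⟩ := h
  exact (hk.mul (smoothAt_coord p x)).congr (e.mono fun y hy => hy.symm)

theorem HasExponent.comp {g : ModelSpace N → ModelSpace N'} {x : ModelSpace N}
    (hg : ∀ q, ∃ p, HasExponent (fun y => g y q) x p) {f : ModelSpace N' → ℝ≥0} {q : N'}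
    (hf : HasExponent f (g x) q) {p : N} (hp : HasExponent (fun y => g y q) x p) :
    HasExponent (fun y => f (g y)) x p := by
  have hs : ∀ q, SmoothAt (fun y => (g y q : ℝ)) x := fun q => (hg q).choose_spec.smoothAt
  obtain ⟨k, hk, k0, e⟩ := hf
  obtain ⟨l, hl, l0, e'⟩ := hp
  refine ⟨fun y => k (g y) * l y, (SmoothAt.comp hs hk).mul hl, mul_pos k0 l0, ?_⟩
  filter_upwards [(ModelSpace.continuousAt_of_smoothAt hs).eventually e, e'] with y h1 h2
  rw [h1, h2, mul_assoc]

theorem HasExponent.eventually_ne_zero_iff {f : ModelSpace N → ℝ≥0} {x : ModelSpace N} {p : N}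
    (h : HasExponent f x p) : ∀ᶠ y in 𝓝 x, (f y = 0 ↔ y p = 0) := by
  obtain ⟨k, hk, k0, e⟩ := h
  filter_upwards [hk.continuousAt.eventually (lt_mem_nhds k0), e] with y h1 h2
  rw [← NNReal.coe_eq_zero, h2, mul_eq_zero, NNReal.coe_eq_zero, or_iff_right h1.ne']

end Smooth

end GCorners

namespace GCorners

/-! ### Atlases modelled on the cones of a fan -/

section Germs

variable {M : Type*} [TopologicalSpace M] (A : GCAtlas M)

theorem exists_germ_eq {m : M} (b : Additive (A.stalk m)) :
    ∃ (f : M → ℝ≥0) (hf : A.BFunAt f m), A.germ f hf = b := by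
  obtain ⟨g, f, hf, rfl⟩ := b
  exact ⟨f, hf, rfl⟩

theorem germ_eq_iff {m : M} {f g : M → ℝ≥0} (hf : A.BFunAt f m) (hg : A.BFunAt g m) :
    A.germ f hf = A.germ g hg ↔ f =ᶠ[𝓝 m] g := by
  rw [← Germ.coe_eq]
  exact (Additive.ofMul.injective.eq_iff).trans Subtype.ext_iff

theorem BFunAt.mul {m : M} {f g : M → ℝ≥0} (hf : A.BFunAt f m) (hg : A.BFunAt g m) :
    A.BFunAt (fun y => f y * g y) m :=
  fun i y hy h => (hf i y hy h).mul (hg i y hy h)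

theorem germ_mul {m : M} {f g : M → ℝ≥0} (hf : A.BFunAt f m) (hg : A.BFunAt g m) :
    A.germ (fun y => f y * g y) (BFunAt.mul A hf hg) = A.germ f hf + A.germ g hg := rfl

theorem bFunAt_one (m : M) : A.BFunAt (fun _ => 1) m := fun _ y _ _ => ModelBFunAt.one y

theorem germ_eq_zero {m : M} {f : M → ℝ≥0} (hf : A.BFunAt f m) (h : ∀ᶠ y in 𝓝 m, f y = 1) :
    A.germ f hf = 0 :=
  (germ_eq_iff A hf (bFunAt_one A m)).2 h

theorem isNormal_germ {F : Set M} {m : M} {f : M → ℝ≥0} (hf : A.BFunAt f m) :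
    A.IsNormal F (A.germ f hf) ↔ ∀ᶠ y in 𝓝[F] m, f y = 0 := by
  constructor
  · rintro ⟨g, hg, h⟩
    have hg' : g =ᶠ[𝓝 m] f := Germ.coe_eq.1 hg
    filter_upwards [h, hg'.filter_mono nhdsWithin_le_nhds] with y h1 h2
    rw [← h2, h1]
  · exact fun h => ⟨f, rfl, h⟩

end Germs

instance {N : Type*} [AddCommMonoid N] : Nonempty (ModelSpace N) := ⟨onePoint⟩

variable {M : Type u} [TopologicalSpace M] {A : GCAtlas.{u, v, w} M}
variable {D : Type*} [AddCommMonoid D]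

variable (A) in
/-- The coordinates in the `i`-th chart, with arbitrary values outside of the domain of the
chart. -/
noncomputable def chartInv (i : A.ι) : M → ModelSpace (A.Mon i) := Function.invFun (A.param i)

variable (A) in
/-- An atlas whose charts are entire model spaces and whose transition functions come from
a monoid `D`, in which the duals of all the monoids of the atlas are embedded:
if `q` pulls back to a positive multiple of `p` under a transition function, then `p` and `q` agree
on the cone of the point at hand. The cone of a point, as a submonoid of `D`, does not
depend on the chart, and decides which charts contain the point. -/
structure IsFanAtlas (ι : ∀ i, Dual (A.Mon i) →+ D) : Prop where
  dom_eq : ∀ i, A.dom i = univ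
  toric : ∀ i, IsToric (A.Mon i)
  injective : ∀ i, Function.Injective (ι i)
  isOpenEmbedding : ∀ i, IsOpenEmbedding (A.param i)
  cover : ∀ m, ∃ i x, A.param i x = m
  transition : ∀ i k x y, A.param i x = A.param k y → ∀ q : A.Mon k, ∃ p : A.Mon i,
    HasExponent (fun x' => chartInv A k (A.param i x') q) x p ∧
      ∀ α ∈ cone x, ∃ β ∈ cone y, ι k β = ι i α ∧ β q = α p
  range : ∀ i k x, (∀ α ∈ cone x, ∃ β, ι k β = ι i α) → ∃ y, A.param k y = A.param i x

namespace IsFanAtlas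

variable {ι : ∀ i, Dual (A.Mon i) →+ D} (F : IsFanAtlas A ι)

include F

theorem param_injective (i : A.ι) : Function.Injective (A.param i) :=
  (F.isOpenEmbedding i).injective

theorem chartInv_param (i : A.ι) (x : ModelSpace (A.Mon i)) : chartInv A i (A.param i x) = x :=
  Function.leftInverse_invFun (F.param_injective i) x

omit F in
theorem param_chartInv {i : A.ι} {m : M} (h : m ∈ Set.range (A.param i)) :
    A.param i (chartInv A i m) = m :=
  Function.invFun_eq h

theorem map_nhds (i : A.ι) (x : ModelSpace (A.Mon i)) :
    map (A.param i) (𝓝 x) = 𝓝 (A.param i x) :=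
  (F.isOpenEmbedding i).map_nhds_eq x

theorem eventually_param {i : A.ι} {x : ModelSpace (A.Mon i)} {p : M → Prop} :
    (∀ᶠ m in 𝓝 (A.param i x), p m) ↔ ∀ᶠ y in 𝓝 x, p (A.param i y) := by
  rw [← F.map_nhds, eventually_map]

theorem map_cone_le {i k : A.ι} {x : ModelSpace (A.Mon i)} {y : ModelSpace (A.Mon k)}
    (h : A.param i x = A.param k y) : (cone x).map (ι i) ≤ (cone y).map (ι k) := by
  rintro _ ⟨α, hα, rfl⟩
  obtain ⟨p, -, hp⟩ := F.transition i k x y h 0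
  obtain ⟨β, hβ, e, -⟩ := hp α hα
  exact ⟨β, hβ, e⟩

omit F in
variable (ι) in
/-- The cone of a point, as a submonoid of `D`. All charts at the point give the same submonoid; taking
the intersection over all charts avoids a choice. -/
def mcone (m : M) : AddSubmonoid D where
  carrier := {d | ∀ i x, A.param i x = m → d ∈ (cone x).map (ι i)}
  zero_mem' := fun _ _ _ => zero_mem _
  add_mem' := fun ha hb i x h => add_mem (ha i x h) (hb i x h)

theorem mcone_param (i : A.ι) (x : ModelSpace (A.Mon i)) :
    mcone ι (A.param i x) = (cone x).map (ι i) :=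
  le_antisymm (fun _ hd => hd i x rfl)
    fun _ hd _ _ h => F.map_cone_le h.symm hd

theorem mem_mcone_param {i : A.ι} {x : ModelSpace (A.Mon i)} {α : Dual (A.Mon i)} :
    ι i α ∈ mcone ι (A.param i x) ↔ α ∈ cone x := by
  rw [F.mcone_param]
  exact AddSubmonoid.mem_map_iff_mem (F.injective i)

theorem exists_of_mem_mcone {i : A.ι} {x : ModelSpace (A.Mon i)} {d : D}
    (h : d ∈ mcone ι (A.param i x)) : ∃ α ∈ cone x, ι i α = d := by
  rw [F.mcone_param] at h
  exact h

theorem mcone_param_eq_iff {i : A.ι} {x y : ModelSpace (A.Mon i)} :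
    mcone ι (A.param i x) = mcone ι (A.param i y) ↔ cone x = cone y := by
  rw [F.mcone_param, F.mcone_param]
  exact (AddSubmonoid.map_injective_of_injective (F.injective i)).eq_iff

theorem mcone_param_le_iff {i : A.ι} {x y : ModelSpace (A.Mon i)} :
    mcone ι (A.param i x) ≤ mcone ι (A.param i y) ↔ cone x ≤ cone y := by
  rw [F.mcone_param, F.mcone_param]
  exact AddSubmonoid.map_le_map_iff_of_injective (F.injective i)

theorem exists_param_eq_of_le {i : A.ι} {x : ModelSpace (A.Mon i)} {m : M}
    (h : mcone ι m ≤ mcone ι (A.param i x)) : ∃ y, A.param i y = m := by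
  obtain ⟨k, z, rfl⟩ := F.cover m
  refine F.range k i z fun α hα => ?_
  obtain ⟨β, -, e⟩ := F.exists_of_mem_mcone (h (F.mem_mcone_param.2 hα))
  exact ⟨β, e⟩

/-! ### The stalk of b-functions and its homomorphisms to `ℕ` -/

theorem bFunAt_param_iff {f : M → ℝ≥0} {i : A.ι} {x : ModelSpace (A.Mon i)} :
    A.BFunAt f (A.param i x) ↔ ∃ p, HasExponent (f ∘ A.param i) x p := by
  refine ⟨fun h => h i x (by simp [F.dom_eq]) rfl, ?_⟩
  rintro ⟨p, hp⟩ k y - hy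
  have hy0 : chartInv A i (A.param k y) = x := by rw [hy, F.chartInv_param]
  have hg : ∀ q, ∃ p, HasExponent (fun y' => chartInv A i (A.param k y') q) y p := fun q =>
    (F.transition k i y x hy q).imp fun p h => h.1
  obtain ⟨p', hp'⟩ := hg p
  refine ⟨p', HasExponent.congr (HasExponent.comp hg (hy0.symm ▸ hp) hp') ?_⟩
  have : ∀ᶠ y' in 𝓝 y, A.param k y' ∈ Set.range (A.param i) :=
    F.eventually_param.1 ((F.isOpenEmbedding i).isOpen_range.mem_nhds ⟨x, hy.symm⟩)
  filter_upwards [this] with y' h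
  simp [param_chartInv h]

/-- In the chart `i`, compare exponents at the same point in two charts. -/
theorem exponent_eq {f : M → ℝ≥0} {i k : A.ι} {x : ModelSpace (A.Mon i)}
    {y : ModelSpace (A.Mon k)} (h : A.param i x = A.param k y) {p : A.Mon i} {q : A.Mon k}
    (hp : HasExponent (f ∘ A.param i) x p) (hq : HasExponent (f ∘ A.param k) y q)
    {α : Dual (A.Mon i)} {β : Dual (A.Mon k)} (hα : α ∈ cone x)
    (hαβ : ι i α = ι k β) : α p = β q := by
  have hg : ∀ q, ∃ p, HasExponent (fun x' => chartInv A k (A.param i x') q) x p := fun q =>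
    (F.transition i k x y h q).imp fun p h => h.1
  have hx0 : chartInv A k (A.param i x) = y := by rw [h, F.chartInv_param]
  obtain ⟨p', hp', H⟩ := F.transition i k x y h q
  obtain ⟨β', -, e, e'⟩ := H α hα
  obtain rfl : β' = β := F.injective k (e.trans hαβ)
  rw [e']
  refine (F.toric i).hasExponent_unique hp ?_ hα
  refine HasExponent.congr (HasExponent.comp hg (hx0.symm ▸ hq) hp') ?_
  have : ∀ᶠ x' in 𝓝 x, A.param i x' ∈ Set.range (A.param k) :=
    F.eventually_param.1 ((F.isOpenEmbedding k).isOpen_range.mem_nhds ⟨y, h.symm⟩)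
  filter_upwards [this] with x' h
  simp [param_chartInv h]

omit F in
variable (ι) in
/-- The b-function `f` has order `n` at `m` along `d`: in some chart at `m`, it has an exponent
whose value at `d` is `n`. -/
def HasOrder (f : M → ℝ≥0) (m : M) (d : D) (n : ℕ) : Prop :=
  ∃ i x p, ∃ α ∈ cone x, A.param i x = m ∧ HasExponent (f ∘ A.param i) x p ∧ ι i α = d ∧ α p = n

omit F in
theorem hasOrder_param {f : M → ℝ≥0} {i : A.ι} {x : ModelSpace (A.Mon i)} {p : A.Mon i}
    {α : Dual (A.Mon i)} (hα : α ∈ cone x) (hp : HasExponent (f ∘ A.param i) x p) :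
    HasOrder ι f (A.param i x) (ι i α) (α p) :=
  ⟨i, x, p, α, hα, rfl, hp, rfl, rfl⟩

theorem HasOrder.unique {f g : M → ℝ≥0} {m : M} {d : D} {n n' : ℕ} (h : HasOrder ι f m d n)
    (h' : HasOrder ι g m d n') (hfg : f =ᶠ[𝓝 m] g) : n = n' := by
  obtain ⟨i, x, p, α, hα, rfl, hp, rfl, rfl⟩ := h
  obtain ⟨k, y, q, β, hβ, e, hq, e', rfl⟩ := h'
  exact F.exponent_eq e.symm (hp.congr (F.eventually_param.1 hfg)) hq hα e'.symm

theorem exists_hasOrder {f : M → ℝ≥0} {m : M} (hf : A.BFunAt f m) {d : D}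
    (hd : d ∈ mcone ι m) : ∃ n, HasOrder ι f m d n := by
  obtain ⟨i, x, rfl⟩ := F.cover m
  obtain ⟨p, hp⟩ := F.bFunAt_param_iff.1 hf
  obtain ⟨α, hα, rfl⟩ := F.exists_of_mem_mcone hd
  exact ⟨_, hasOrder_param hα hp⟩

theorem HasOrder.mul {f g : M → ℝ≥0} {m : M} {d : D} {n n' : ℕ} (h : HasOrder ι f m d n)
    (h' : HasOrder ι g m d n') : HasOrder ι (fun y => f y * g y) m d (n + n') := by
  obtain ⟨i, x, p, α, hα, rfl, hp, rfl, rfl⟩ := h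
  obtain ⟨q, hq⟩ : ∃ q, HasExponent (g ∘ A.param i) x q := by
    obtain ⟨k, y, q, β, hβ, e, hq, e', rfl⟩ := h'
    rw [← F.bFunAt_param_iff, ← e, F.bFunAt_param_iff]
    exact ⟨q, hq⟩
  rw [HasOrder.unique F h' (hasOrder_param hα hq) .rfl, ← map_add]
  exact hasOrder_param hα (hp.mul hq)

theorem existsUnique_order {m : M} {d : D} (hd : d ∈ mcone ι m) (b : Additive (A.stalk m)) :
    ∃! n, ∃ (f : M → ℝ≥0) (hf : A.BFunAt f m), A.germ f hf = b ∧ HasOrder ι f m d n := by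
  obtain ⟨f, hf, rfl⟩ := exists_germ_eq A b
  obtain ⟨n, hn⟩ := F.exists_hasOrder hf hd
  refine ⟨n, ⟨f, hf, rfl, hn⟩, ?_⟩
  rintro n' ⟨g, hg, e, hn'⟩
  exact HasOrder.unique F hn' hn ((germ_eq_iff A hg hf).1 e)

theorem order_add {m : M} {d : D} (hd : d ∈ mcone ι m) (b c : Additive (A.stalk m)) :
    (F.existsUnique_order hd (b + c)).choose =
      (F.existsUnique_order hd b).choose + (F.existsUnique_order hd c).choose := by
  obtain ⟨f, hf, rfl, h⟩ := (F.existsUnique_order hd b).choose_spec.1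
  obtain ⟨g, hg, rfl, h'⟩ := (F.existsUnique_order hd c).choose_spec.1
  exact ((F.existsUnique_order hd _).choose_spec.2 _ ⟨_, _, germ_mul A hf hg, HasOrder.mul F h h'⟩).symm

/-- The homomorphism from the stalk of b-functions to `ℕ` which is given by the order along an
element of the cone. -/
noncomputable def orderHom {m : M} {d : D} (hd : d ∈ mcone ι m) : Additive (A.stalk m) →+ ℕ where
  toFun b := (F.existsUnique_order hd b).choose
  map_zero' := by
    have := F.order_add hd 0 0
    rw [add_zero] at this
    omega
  map_add' := F.order_add hd

theorem orderHom_germ {m : M} {d : D} (hd : d ∈ mcone ι m) {f : M → ℝ≥0} (hf : A.BFunAt f m)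
    {n : ℕ} (h : HasOrder ι f m d n) : F.orderHom hd (A.germ f hf) = n :=
  ((F.existsUnique_order hd _).choose_spec.2 _ ⟨f, hf, rfl, h⟩).symm

theorem orderHom_param {i : A.ι} {x : ModelSpace (A.Mon i)} {f : M → ℝ≥0}
    (hf : A.BFunAt f (A.param i x)) {p : A.Mon i} (hp : HasExponent (f ∘ A.param i) x p)
    {α : Dual (A.Mon i)} (hα : α ∈ cone x) (hd : ι i α ∈ mcone ι (A.param i x)) :
    F.orderHom hd (A.germ f hf) = α p :=
  F.orderHom_germ hd hf (hasOrder_param hα hp)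

omit F in
variable (A) in
/-- The algebraic function of `q` in the `i`-th chart; its values outside of the domain of the chart
are irrelevant. -/
noncomputable def coordFun (i : A.ι) (q : A.Mon i) (m : M) : ℝ≥0 := chartInv A i m q

theorem coordFun_param {i : A.ι} (q : A.Mon i) (x : ModelSpace (A.Mon i)) :
    coordFun A i q (A.param i x) = x q := by
  rw [coordFun, F.chartInv_param]

theorem coordFun_comp {i : A.ι} (q : A.Mon i) : coordFun A i q ∘ A.param i = fun x => x q :=
  funext fun x => F.coordFun_param q x

theorem hasExponent_coordFun {i : A.ι} (q : A.Mon i) (x : ModelSpace (A.Mon i)) :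
    HasExponent (coordFun A i q ∘ A.param i) x q := by
  rw [F.coordFun_comp]
  exact hasExponent_coord q x

theorem bFunAt_coordFun {i : A.ι} (q : A.Mon i) (x : ModelSpace (A.Mon i)) :
    A.BFunAt (coordFun A i q) (A.param i x) :=
  F.bFunAt_param_iff.2 ⟨q, F.hasExponent_coordFun q x⟩

theorem germ_coordFun_add {i : A.ι} (p q : A.Mon i) (x : ModelSpace (A.Mon i)) :
    A.germ (coordFun A i (p + q)) (F.bFunAt_coordFun (p + q) x) =
      A.germ (coordFun A i p) (F.bFunAt_coordFun p x) +
        A.germ (coordFun A i q) (F.bFunAt_coordFun q x) := by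
  rw [← germ_mul]
  refine (germ_eq_iff A _ _).2 (.of_eq ?_)
  exact funext fun m => (chartInv A i m).map_add p q

theorem orderHom_coordFun {i : A.ι} {x : ModelSpace (A.Mon i)} (q : A.Mon i)
    {α : Dual (A.Mon i)} (hα : α ∈ cone x) (hd : ι i α ∈ mcone ι (A.param i x)) :
    F.orderHom hd (A.germ _ (F.bFunAt_coordFun q x)) = α q :=
  F.orderHom_param _ (F.hasExponent_coordFun q x) hα hd

theorem orderHom_injective {m : M} {d d' : D} (hd : d ∈ mcone ι m) (hd' : d' ∈ mcone ι m)
    (h : F.orderHom hd = F.orderHom hd') : d = d' := by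
  obtain ⟨i, x, rfl⟩ := F.cover m
  obtain ⟨α, hα, rfl⟩ := F.exists_of_mem_mcone hd
  obtain ⟨β, hβ, rfl⟩ := F.exists_of_mem_mcone hd'
  congr 1
  ext q
  rw [← F.orderHom_coordFun q hα hd, ← F.orderHom_coordFun q hβ hd', h]

/-- Germs of b-functions with the same exponent differ by a unit. -/
theorem exists_germ_eq_add {i : A.ι} {x : ModelSpace (A.Mon i)} {f g : M → ℝ≥0}
    (hf : A.BFunAt f (A.param i x)) (hg : A.BFunAt g (A.param i x)) {p : A.Mon i}
    (hp : HasExponent (f ∘ A.param i) x p) (hp' : HasExponent (g ∘ A.param i) x p) :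
    ∃ u v : Additive (A.stalk (A.param i x)), u + v = 0 ∧ A.germ f hf = A.germ g hg + u := by
  obtain ⟨h, hs, h0, e⟩ := hp
  obtain ⟨k, ks, k0, e'⟩ := hp'
  let l : ModelSpace (A.Mon i) → ℝ := fun y => h y * (k y)⁻¹
  have ls : SmoothAt l x := hs.mul (ks.inv k0)
  have l0 : 0 < l x := mul_pos h0 (inv_pos.2 k0)
  let U : M → ℝ≥0 := fun m => (l (chartInv A i m)).toNNReal
  have hU : ∀ᶠ y in 𝓝 x, ((U (A.param i y) : ℝ≥0) : ℝ) = l y := by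
    filter_upwards [ls.continuousAt.eventually (lt_mem_nhds l0)] with y hy
    simp only [U, F.chartInv_param]
    exact Real.coe_toNNReal _ hy.le
  have bU : A.BFunAt U (A.param i x) := F.bFunAt_param_iff.2 ⟨0, l, ls, l0, by
    filter_upwards [hU] with y hy
    rw [Function.comp_apply, hy, y.map_zero, NNReal.coe_one, mul_one]⟩
  have bV : A.BFunAt (fun m => (U m)⁻¹) (A.param i x) :=
    F.bFunAt_param_iff.2 ⟨0, fun y => (l y)⁻¹, ls.inv l0, inv_pos.2 l0, by
      filter_upwards [hU] with y hy
      rw [Function.comp_apply, NNReal.coe_inv, hy, y.map_zero, NNReal.coe_one, mul_one]⟩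
  refine ⟨A.germ U bU, A.germ _ bV, ?_, ?_⟩
  · rw [← germ_mul]
    refine germ_eq_zero A _ (F.eventually_param.2 ?_)
    filter_upwards [hU, ls.continuousAt.eventually (lt_mem_nhds l0)] with y hy hy0
    refine mul_inv_cancel₀ fun h => ?_
    rw [← hy, h] at hy0
    simp at hy0
  · rw [← germ_mul]
    refine (germ_eq_iff A _ _).2 (F.eventually_param.2 ?_)
    filter_upwards [e, e', hU, ks.continuousAt.eventually (lt_mem_nhds k0)] with y h1 h2 h3 h4
    rw [← NNReal.coe_inj, NNReal.coe_mul, h3]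
    simp only [Function.comp_apply] at h1 h2
    rw [h1, h2]
    simp only [l]
    field_simp

/-- Every homomorphism from the stalk to `ℕ` is the order along some element of the cone. -/
theorem exists_orderHom_eq {m : M} (n : Additive (A.stalk m) →+ ℕ) :
    ∃ (d : D) (hd : d ∈ mcone ι m), n = F.orderHom hd := by
  obtain ⟨i, x, rfl⟩ := F.cover m
  have hunit : ∀ u v : Additive (A.stalk (A.param i x)), u + v = 0 → n u = 0 := fun u v h => by
    have := congrArg n h
    rw [map_add, map_zero] at this
    omega
  have h1 : A.germ _ (F.bFunAt_coordFun (0 : A.Mon i) x) = 0 :=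
    germ_eq_zero A _ (.of_forall fun m => (chartInv A i m).map_zero)
  let α : Dual (A.Mon i) :=
    { toFun := fun q => n (A.germ _ (F.bFunAt_coordFun q x))
      map_zero' := by rw [h1, map_zero]
      map_add' := fun p q => by rw [F.germ_coordFun_add, map_add] }
  have hα : α ∈ cone x := by
    intro q hq
    have he : HasExponent (coordFun A i q ∘ A.param i) x 0 :=
      (F.toric i).hasExponent_of_eq (F.hasExponent_coordFun q x) fun β hβ => by
        rw [hβ q hq, map_zero]
    obtain ⟨u, v, huv, e⟩ := F.exists_germ_eq_add (F.bFunAt_coordFun q x)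
      (F.bFunAt_coordFun 0 x) he (F.hasExponent_coordFun 0 x)
    change n _ = 0
    rw [e, h1, zero_add]
    exact hunit u v huv
  refine ⟨ι i α, F.mem_mcone_param.2 hα, AddMonoidHom.ext fun b => ?_⟩
  obtain ⟨f, hf, rfl⟩ := exists_germ_eq A b
  obtain ⟨p, hp⟩ := F.bFunAt_param_iff.1 hf
  obtain ⟨u, v, huv, e⟩ := F.exists_germ_eq_add hf (F.bFunAt_coordFun p x) hp
    (F.hasExponent_coordFun p x)
  rw [F.orderHom_param hf hp hα, e, map_add, hunit u v huv, add_zero]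
  rfl

theorem orderHom_add {m : M} {d d' : D} (hd : d ∈ mcone ι m) (hd' : d' ∈ mcone ι m) :
    F.orderHom (add_mem hd hd') = F.orderHom hd + F.orderHom hd' := by
  obtain ⟨i, x, rfl⟩ := F.cover m
  obtain ⟨α, hα, rfl⟩ := F.exists_of_mem_mcone hd
  obtain ⟨β, hβ, rfl⟩ := F.exists_of_mem_mcone hd'
  refine AddMonoidHom.ext fun b => ?_
  obtain ⟨f, hf, rfl⟩ := exists_germ_eq A b
  obtain ⟨p, hp⟩ := F.bFunAt_param_iff.1 hf
  rw [AddMonoidHom.add_apply, F.orderHom_param hf hp hα, F.orderHom_param hf hp hβ,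
    ← AddMonoidHom.add_apply]
  refine F.orderHom_germ _ hf ?_
  rw [← map_add]
  exact hasOrder_param (add_mem hα hβ) hp

/-! ### The codimension -/

omit F in
/-- Restriction of functionals to a submonoid of the dual. -/
def evalOn {N : Type*} [AddCommMonoid N] (C : AddSubmonoid (Dual N)) : N →+ Dual C where
  toFun p := (AddMonoidHom.eval p).comp C.subtype
  map_zero' := by ext; simp
  map_add' _ _ := by ext; simp

omit F in
theorem evalOn_apply {N : Type*} [AddCommMonoid N] (C : AddSubmonoid (Dual N)) (p : N) (α : C) :
    evalOn C p α = (α : Dual N) p := rfl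

omit F in
theorem nonempty_addEquiv_of_surjective {N B E : Type*} [AddCommMonoid N] [AddCommMonoid B]
    [AddCommMonoid E] (f : N →+ B) (hf : Function.Surjective f) (g : N →+ E)
    (h : ∀ a b, f a = f b ↔ g a = g b) : Nonempty (B ≃+ AddMonoidHom.mrange g) := by
  have hfg : AddCon.ker f = AddCon.ker g := AddCon.ext fun a b => h a b
  have e := AddCon.quotientKerEquivRange g
  rw [← hfg] at e
  exact ⟨(AddCon.quotientKerEquivOfSurjective f hf).symm.trans e⟩

/-- In a chart, the sharpening of the stalk is the quotient of the monoid of the chart by the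
relation of having the same values on the cone of the point. -/
theorem codim_param (i : A.ι) (x : ModelSpace (A.Mon i)) :
    A.codim (A.param i x) = monDim (AddMonoidHom.mrange (evalOn (cone x))) := by
  let G : A.Mon i → Additive (A.stalk (A.param i x)) := fun q => A.germ _ (F.bFunAt_coordFun q x)
  let f : A.Mon i →+ Additive (Associates (A.stalk (A.param i x))) :=
    { toFun := fun q => Additive.ofMul (Associates.mk (G q).toMul)
      map_zero' := by
        have : G 0 = 0 := germ_eq_zero A _ (.of_forall fun m => (chartInv A i m).map_zero)
        rw [this]
        rfl
      map_add' := fun p q => by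
        have : G (p + q) = G p + G q := F.germ_coordFun_add p q x
        rw [this]
        rfl }
  have hf : ∀ p q, f p = f q ↔ ∃ u v : Additive (A.stalk (A.param i x)),
      u + v = 0 ∧ G p = G q + u := by
    intro p q
    refine (Additive.ofMul.injective.eq_iff).trans (Associates.mk_eq_mk_iff_associated.trans ?_)
    constructor
    · rintro ⟨u, hu⟩
      refine ⟨Additive.ofMul (u⁻¹ : (A.stalk (A.param i x))ˣ), Additive.ofMul (u : A.stalk _),
        u.inv_mul, ?_⟩
      have := congrArg Additive.ofMul hu
      rw [ofMul_mul, ofMul_toMul, ofMul_toMul] at this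
      rw [← this, add_assoc]
      exact (add_zero (G p)).symm.trans (congrArg (G p + ·) u.mul_inv.symm)
    · rintro ⟨u, v, huv, e⟩
      refine ⟨⟨v.toMul, u.toMul, (add_comm v u).trans huv, huv⟩, ?_⟩
      have : G p + v = G q := by rw [e, add_assoc, huv, add_zero]
      exact congrArg Additive.toMul this
  have hsurj : Function.Surjective f := by
    intro b
    obtain ⟨b, hb⟩ := Associates.mk_surjective b.toMul
    obtain ⟨g, hg, e⟩ := exists_germ_eq A (Additive.ofMul b)
    obtain ⟨p, hp⟩ := F.bFunAt_param_iff.1 hg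
    obtain ⟨u, v, huv, e'⟩ := F.exists_germ_eq_add (F.bFunAt_coordFun p x) hg
      (F.hasExponent_coordFun p x) hp
    refine ⟨p, ?_⟩
    apply Additive.toMul.injective
    rw [← hb]
    refine Associates.mk_eq_mk_iff_associated.2
      ⟨⟨v.toMul, u.toMul, (add_comm v u).trans huv, huv⟩, ?_⟩
    have : G p + v = Additive.ofMul b := by rw [← e, ← add_zero (A.germ g hg), ← huv, ← add_assoc,
      ← e']
    exact congrArg Additive.toMul this
  obtain ⟨E⟩ := nonempty_addEquiv_of_surjective f hsurj (evalOn (cone x)) fun p q => by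
    rw [hf]
    constructor
    · rintro ⟨u, v, huv, e⟩
      ext ⟨α, hα⟩
      have := congrArg (F.orderHom (F.mem_mcone_param.2 hα)) e
      have h0 := congrArg (F.orderHom (F.mem_mcone_param.2 hα)) huv
      rw [map_add, map_zero] at h0
      rw [map_add, F.orderHom_coordFun p hα, F.orderHom_coordFun q hα] at this
      rw [evalOn_apply, evalOn_apply]
      change α p = α q
      omega
    · intro h
      exact F.exists_germ_eq_add _ _ (F.hasExponent_coordFun p x)
        ((F.toric i).hasExponent_of_eq (F.hasExponent_coordFun q x) fun α hα =>
          (congrArg (fun f => f ⟨α, hα⟩) h).symm)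
  exact monDim_congr E

/-- The codimension strictly increases with the cone, so that the points near `m` of the same
codimension as `m` are those with the same cone. -/
theorem codim_lt {i : A.ι} {x y : ModelSpace (A.Mon i)} (h : cone x < cone y) :
    A.codim (A.param i x) < A.codim (A.param i y) := by
  rw [F.codim_param, F.codim_param]
  obtain ⟨q, hq, hq'⟩ : ∃ q, x q ≠ 0 ∧ y q = 0 := by
    by_contra! hcon
    exact h.not_ge ((F.toric i).cone_le_iff.2 hcon)
  obtain ⟨α, hα, hαq⟩ : ∃ α ∈ cone y, α q ≠ 0 := by
    by_contra! hcon
    exact ((F.toric i).ne_zero_iff y q).2 hcon hq'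
  let r : Dual (cone y) →+ Dual (cone x) :=
    { toFun := fun φ => φ.comp (AddSubmonoid.inclusion h.le)
      map_zero' := rfl
      map_add' := fun _ _ => rfl }
  have hr : ∀ p, r (evalOn (cone y) p) = evalOn (cone x) p := fun p => rfl
  let g : AddMonoidHom.mrange (evalOn (cone y)) →+ AddMonoidHom.mrange (evalOn (cone x)) :=
    (r.comp (AddSubmonoid.subtype _)).codRestrict _ (by
      rintro ⟨_, p, rfl⟩
      exact ⟨p, (hr p).symm⟩)
  refine monDim_lt_of_surjective ?_ g ?_ (a := ⟨evalOn (cone y) q, q, rfl⟩) (b := 0) ?_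
    ((AddMonoidHom.eval (⟨α, hα⟩ : cone y)).comp (AddSubmonoid.subtype _)) ?_
  · have := (F.toric i).fg
    exact AddMonoid.fg_range _
  · rintro ⟨_, p, rfl⟩
    exact ⟨⟨_, p, rfl⟩, Subtype.ext (hr p)⟩
  · rw [map_zero]
    refine Subtype.ext ?_
    change evalOn (cone x) q = 0
    ext β
    exact β.2 q hq
  · rw [map_zero]
    exact hαq

theorem codim_eq_zero_iff (m : M) : A.codim m = 0 ↔ mcone ι m = ⊥ := by
  obtain ⟨i, x, rfl⟩ := F.cover m
  have h1 : mcone ι (A.param i x) = ⊥ ↔ cone x = ⊥ := by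
    rw [F.mcone_param]
    constructor
    · intro h
      rw [eq_bot_iff]
      intro α hα
      have : ι i α ∈ (⊥ : AddSubmonoid D) := h ▸ AddSubmonoid.mem_map_of_mem _ hα
      rw [AddSubmonoid.mem_bot] at this
      exact F.injective i (this.trans (map_zero _).symm)
    · rintro h
      rw [h, AddSubmonoid.map_bot]
  have h2 : cone (onePoint : ModelSpace (A.Mon i)) = ⊥ := by
    rw [eq_bot_iff]
    exact fun α hα => AddMonoidHom.ext fun q => hα q one_ne_zero
  rw [h1]
  constructor
  · intro h
    by_contra hcon
    have := F.codim_lt (i := i) (x := onePoint) (y := x) (h2 ▸ bot_lt_iff_ne_bot.2 hcon)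
    omega
  · intro h
    rw [F.codim_param, h]
    have : Subsingleton (AddMonoidHom.mrange (evalOn (⊥ : AddSubmonoid (Dual (A.Mon i))))) := by
      refine ⟨fun a b => Subtype.ext (AddMonoidHom.ext fun c => ?_)⟩
      rw [show c = 0 from Subtype.ext (AddSubmonoid.mem_bot.1 c.2), map_zero, map_zero]
    have : Subsingleton (Algebra.GrothendieckAddGroup
        (AddMonoidHom.mrange (evalOn (⊥ : AddSubmonoid (Dual (A.Mon i)))))) := by
      refine ⟨fun a b => ?_⟩
      obtain ⟨a, a', rfl⟩ := exists_of_sub_of a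
      obtain ⟨b, b', rfl⟩ := exists_of_sub_of b
      rw [Subsingleton.elim a b, Subsingleton.elim a' b']
    exact Module.finrank_zero_of_subsingleton

theorem codim_eq_of_mcone_eq {m m' : M} (h : mcone ι m = mcone ι m') :
    A.codim m = A.codim m' := by
  obtain ⟨i, x, rfl⟩ := F.cover m
  obtain ⟨y, rfl⟩ := F.exists_param_eq_of_le h.ge
  rw [F.codim_param, F.codim_param, F.mcone_param_eq_iff.1 h]

theorem eventually_mcone_le (m : M) : ∀ᶠ m' in 𝓝 m, mcone ι m' ≤ mcone ι m := by
  obtain ⟨i, x, rfl⟩ := F.cover m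
  rw [F.eventually_param]
  filter_upwards [(F.toric i).eventually_cone_le x] with y hy
  exact F.mcone_param_le_iff.2 hy

theorem mcone_eq_of_le_of_codim_eq {m m' : M} (h : mcone ι m' ≤ mcone ι m)
    (h' : A.codim m' = A.codim m) : mcone ι m' = mcone ι m := by
  obtain ⟨i, x, rfl⟩ := F.cover m
  obtain ⟨y, rfl⟩ := F.exists_param_eq_of_le h
  rw [F.mcone_param_eq_iff]
  by_contra hne
  exact (F.codim_lt (lt_of_le_of_ne (F.mcone_param_le_iff.1 h) hne)).ne h'

end IsFanAtlas

end GCorners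

namespace GCorners

/-! ### Boundary faces -/

section Components

variable {M : Type*} [TopologicalSpace M]

/-- A locally constant function on a preconnected set is constant. -/
theorem IsPreconnected.eq_of_eventually_eq {κ : Type*} {S : Set M} (hS : IsPreconnected S)
    {c : M → κ} (h : ∀ m ∈ S, ∀ᶠ m' in 𝓝 m, m' ∈ S → c m' = c m) {x y : M} (hx : x ∈ S)
    (hy : y ∈ S) : c x = c y := by
  let _ : TopologicalSpace κ := ⊥
  have : DiscreteTopology κ := ⟨rfl⟩
  refine hS.constant (f := c) (fun m hm => ?_) hx hy
  refine tendsto_nhds_of_eventually_eq ?_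
  filter_upwards [nhdsWithin_le_nhds (h m hm), self_mem_nhdsWithin] with m' h1 h2 using h1 h2

/-- If the locally constant function `c` on `S` has preconnected fibres, then these are the
connected components. -/
theorem connectedComponentIn_eq_inter {κ : Type*} {S : Set M} {c : M → κ}
    (h : ∀ m ∈ S, ∀ᶠ m' in 𝓝 m, m' ∈ S → c m' = c m) {m : M} (hm : m ∈ S)
    (hc : IsPreconnected (S ∩ {m' | c m' = c m})) :
    connectedComponentIn S m = S ∩ {m' | c m' = c m} := by
  refine Subset.antisymm (fun m' hm' => ⟨connectedComponentIn_subset S m hm', ?_⟩)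
    (hc.subset_connectedComponentIn ⟨hm, rfl⟩ inter_subset_left)
  refine IsPreconnected.eq_of_eventually_eq isPreconnected_connectedComponentIn (c := c)
    (fun m₁ h₁ => ?_) hm' (mem_connectedComponentIn hm)
  filter_upwards [h m₁ (connectedComponentIn_subset S m h₁)] with m₂ h₂ h₃
  exact h₂ (connectedComponentIn_subset S m h₃)

end Components

variable {M : Type u} [TopologicalSpace M] {A : GCAtlas.{u, v, w} M}
variable {D : Type*} [AddCommMonoid D]

namespace IsFanAtlas

variable {ι : ∀ i, Dual (A.Mon i) →+ D} (F : IsFanAtlas A ι)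

include F

theorem eventually_mcone_eq {l : ℕ} {m : M} (hm : m ∈ A.stratum l) :
    ∀ᶠ m' in 𝓝 m, m' ∈ A.stratum l → mcone ι m' = mcone ι m := by
  filter_upwards [F.eventually_mcone_le m] with m' h h'
  exact F.mcone_eq_of_le_of_codim_eq h (h'.trans hm.symm)

theorem setOf_mcone_eq (i : A.ι) (x : ModelSpace (A.Mon i)) :
    {m | mcone ι m = mcone ι (A.param i x)} = A.param i '' {y | cone y = cone x} := by
  ext m
  constructor
  · intro h
    obtain ⟨y, rfl⟩ := F.exists_param_eq_of_le (le_of_eq h)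
    exact ⟨y, F.mcone_param_eq_iff.1 h, rfl⟩
  · rintro ⟨y, hy, rfl⟩
    exact F.mcone_param_eq_iff.2 hy

theorem isPreconnected_mcone_eq (m : M) : IsPreconnected {m' | mcone ι m' = mcone ι m} := by
  obtain ⟨i, x, rfl⟩ := F.cover m
  rw [F.setOf_mcone_eq]
  exact ((F.toric i).isPreconnected_stratum _).image _ (F.isOpenEmbedding i).continuous.continuousOn

/-- The interiors of the boundary faces are the sets of points with the same cone. -/
theorem connectedComponentIn_stratum (m : M) :
    connectedComponentIn (A.stratum (A.codim m)) m = {m' | mcone ι m' = mcone ι m} := by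
  have hsub : A.stratum (A.codim m) ∩ {m' | mcone ι m' = mcone ι m} =
      {m' | mcone ι m' = mcone ι m} :=
    inter_eq_right.2 fun m' h => F.codim_eq_of_mcone_eq h
  rw [connectedComponentIn_eq_inter (c := mcone ι) (fun m' h => F.eventually_mcone_eq h) rfl, hsub]
  rw [hsub]
  exact F.isPreconnected_mcone_eq m

theorem isComponent_iff {l : ℕ} {C : Set M} :
    IsComponent (A.stratum l) C ↔ ∃ m, A.codim m = l ∧ C = {m' | mcone ι m' = mcone ι m} := by
  constructor
  · rintro ⟨m, rfl, rfl⟩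
    exact ⟨m, rfl, F.connectedComponentIn_stratum m⟩
  · rintro ⟨m, rfl, rfl⟩
    exact ⟨m, rfl, (F.connectedComponentIn_stratum m).symm⟩

/-- Local boundary faces are determined by the cone of their points, as there are arbitrarily small
neighbourhoods that meet the set of points with a given cone in a connected set. -/
theorem facesEmbedded : A.FacesEmbedded := by
  intro l m γ γ' hγ hγ' he U hU hm
  obtain ⟨i, x, rfl⟩ := F.cover m
  have hU' : A.param i ⁻¹' U ∈ 𝓝 x :=
    (hU.preimage (F.isOpenEmbedding i).continuous).mem_nhds hm
  obtain ⟨V, hVU, hVo, hxV, hV⟩ := (F.toric i).exists_connected_nhds hU'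
  set W := A.param i '' V with hW
  have hWo : IsOpen W := (F.isOpenEmbedding i).isOpenMap _ hVo
  have hmW : A.param i x ∈ W := mem_image_of_mem _ hxV
  have hWU : W ⊆ U := by
    rintro _ ⟨y, hy, rfl⟩
    exact hVU hy
  have hloc : ∀ z ∈ A.stratum l ∩ W, ∀ᶠ m' in 𝓝 z, m' ∈ A.stratum l ∩ W →
      mcone ι m' = mcone ι z := fun z hz =>
    (F.eventually_mcone_eq hz.1).mono fun m' h h' => h h'.1
  have hcomp : ∀ z ∈ A.stratum l ∩ W, connectedComponentIn (A.stratum l ∩ W) z =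
      A.stratum l ∩ W ∩ {m' | mcone ι m' = mcone ι z} := by
    intro z hz
    refine connectedComponentIn_eq_inter hloc hz ?_
    obtain ⟨y, hy, rfl⟩ := hz.2
    have : A.stratum l ∩ W ∩ {m' | mcone ι m' = mcone ι (A.param i y)} =
        A.param i '' (V ∩ {y' | cone y' = cone y}) := by
      rw [image_inter (F.param_injective i), ← F.setOf_mcone_eq, ← hW, inter_assoc]
      exact inter_eq_right.2 fun m' h => (F.codim_eq_of_mcone_eq h.2).trans hz.1
    rw [this]
    exact (hV _).image _ (F.isOpenEmbedding i).continuous.continuousOn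
  obtain ⟨z, hz, hγW⟩ := hγ.1 W hWo hmW
  obtain ⟨z', hz', hγW'⟩ := hγ'.1 W hWo hmW
  have h1 : z ∈ γ univ := hγ.2 W univ hWo isOpen_univ hmW (subset_univ _)
    (hγW ▸ mem_connectedComponentIn hz)
  have h2 : z' ∈ γ univ := he ▸ hγ'.2 W univ hWo isOpen_univ hmW (subset_univ _)
    (hγW' ▸ mem_connectedComponentIn hz')
  obtain ⟨y, hy, hγu⟩ := hγ.1 univ isOpen_univ (mem_univ _)
  rw [inter_univ] at hγu
  obtain ⟨z₀, -, h0⟩ := F.isComponent_iff.1 ⟨y, by simpa using hy, hγu⟩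
  rw [h0] at h1 h2
  have hzz' : mcone ι z = mcone ι z' := h1.trans h2.symm
  have hW' : γ W = γ' W := by rw [hγW, hγW', hcomp z hz, hcomp z' hz', hzz']
  obtain ⟨a, ha, hγa⟩ := hγ.1 U hU hm
  obtain ⟨b, hb, hγb⟩ := hγ'.1 U hU hm
  have hza : z ∈ connectedComponentIn (A.stratum l ∩ U) a := hγa ▸ hγ.2 W U hWo hU hmW hWU
    (hγW ▸ mem_connectedComponentIn hz)
  have hzb : z ∈ connectedComponentIn (A.stratum l ∩ U) b := hγb ▸ hγ'.2 W U hWo hU hmW hWU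
    (hW' ▸ hγW ▸ mem_connectedComponentIn hz)
  rw [hγa, hγb, connectedComponentIn_eq hza, connectedComponentIn_eq hzb]

/-- The boundary face with cone `c` consists of the points whose cone contains `c`. -/
theorem closure_mcone_eq (m : M) :
    closure {m' | mcone ι m' = mcone ι m} = {m' | mcone ι m ≤ mcone ι m'} := by
  ext m'
  constructor
  · intro h
    obtain ⟨m₁, h₁, h₂⟩ := mem_closure_iff_frequently.1 h |>.and_eventually
      (F.eventually_mcone_le m') |>.exists
    exact (le_of_eq (Eq.symm h₁)).trans h₂
  · intro h
    obtain ⟨i, x, rfl⟩ := F.cover m'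
    obtain ⟨y, rfl⟩ := F.exists_param_eq_of_le h
    rw [F.setOf_mcone_eq]
    exact image_closure_subset_closure_image (F.isOpenEmbedding i).continuous
      ⟨x, (F.toric i).mem_closure_of_cone_le (F.mcone_param_le_iff.1 h), rfl⟩

/-! ### Normal monoids and flat sections -/

/-- A germ of b-functions vanishes on the boundary face with cone `c` iff its order along some
element of `c` is positive. -/
theorem isNormal_iff {m m₀ : M} (hm : mcone ι m₀ ≤ mcone ι m) (b : Additive (A.stalk m)) :
    A.IsNormal (closure {m' | mcone ι m' = mcone ι m₀}) b ↔
      ∃ d, ∃ hd : d ∈ mcone ι m₀, F.orderHom (hm hd) b ≠ 0 := by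
  obtain ⟨f, hf, rfl⟩ := exists_germ_eq A b
  rw [isNormal_germ]
  obtain ⟨i, x, rfl⟩ := F.cover m
  obtain ⟨y, rfl⟩ := F.exists_param_eq_of_le hm
  obtain ⟨p, hp⟩ := F.bFunAt_param_iff.1 hf
  have hev : ∀ᶠ m' in 𝓝 (A.param i x), ∃ x', A.param i x' = m' ∧ (f m' = 0 ↔ x' p = 0) :=
    F.eventually_param.2 (hp.eventually_ne_zero_iff.mono fun x' h => ⟨x', rfl, h⟩)
  have hord : ∀ α (hα : α ∈ cone y), F.orderHom (hm (F.mem_mcone_param.2 hα)) (A.germ f hf) =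
      α p := fun α hα =>
    F.orderHom_param hf hp (F.mcone_param_le_iff.1 hm hα) _
  have key : (∃ d, ∃ hd : d ∈ mcone ι (A.param i y), F.orderHom (hm hd) (A.germ f hf) ≠ 0) ↔
      y p = 0 := by
    rw [← not_iff_not, ← ne_eq, (F.toric i).ne_zero_iff]
    push Not
    constructor
    · intro h α hα
      rw [← hord α hα]
      exact h _ (F.mem_mcone_param.2 hα)
    · intro h d hd
      obtain ⟨α, hα, rfl⟩ := F.exists_of_mem_mcone hd
      rw [hord α hα]
      exact h α hα
  rw [key]
  have hcl := F.closure_mcone_eq (A.param i y)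
  constructor
  · intro h
    have hx : A.param i x ∈ closure {m' | mcone ι m' = mcone ι (A.param i y)} := by
      rw [hcl]
      exact hm
    obtain ⟨m', h₁, h₂, x', rfl, h₃⟩ := (mem_closure_iff_frequently.1 hx).and_eventually
      ((eventually_nhdsWithin_iff.1 h).and hev) |>.exists
    have h4 := h₃.1 (h₂ (subset_closure h₁))
    by_contra hy
    exact ((F.toric i).cone_eq_iff.1 (F.mcone_param_eq_iff.1 h₁) p).2 hy h4
  · intro hy
    rw [eventually_nhdsWithin_iff]
    filter_upwards [hev]
    rintro _ ⟨x', rfl, h⟩ h'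
    rw [hcl] at h'
    rw [h]
    by_contra hx'
    exact (F.toric i).cone_le_iff.1 (F.mcone_param_le_iff.1 h') p hx' hy

theorem mem_normalMonoid_iff {m m₀ : M} (hm : mcone ι m₀ ≤ mcone ι m)
    (n : Additive (A.stalk m) →+ ℕ) :
    n ∈ A.normalMonoid (closure {m' | mcone ι m' = mcone ι m₀}) m ↔
      ∃ d, ∃ hd : d ∈ mcone ι m₀, n = F.orderHom (hm hd) := by
  constructor
  · intro hn
    obtain ⟨d, hd, rfl⟩ := F.exists_orderHom_eq n
    obtain ⟨i, x, rfl⟩ := F.cover m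
    obtain ⟨y, rfl⟩ := F.exists_param_eq_of_le hm
    obtain ⟨α, hα, rfl⟩ := F.exists_of_mem_mcone hd
    refine ⟨ι i α, F.mem_mcone_param.2 fun q hq => ?_, rfl⟩
    rw [← F.orderHom_coordFun q hα hd]
    refine hn _ fun hcon => ?_
    obtain ⟨d, hd', h⟩ := (F.isNormal_iff hm _).1 hcon
    obtain ⟨β, hβ, rfl⟩ := F.exists_of_mem_mcone hd'
    rw [F.orderHom_coordFun q (F.mcone_param_le_iff.1 hm hβ)] at h
    exact h (hβ q hq)
  · rintro ⟨d, hd, rfl⟩ b hb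
    by_contra hcon
    exact hb ((F.isNormal_iff hm b).2 ⟨d, hd, hcon⟩)

theorem mem_mcone_of_closure {m₀ : M} (x : closure {m' | mcone ι m' = mcone ι m₀}) {d : D}
    (hd : d ∈ mcone ι m₀) : d ∈ mcone ι (x : M) :=
  (F.closure_mcone_eq m₀).le x.2 hd

/-- The flat section of the bundle of normal monoids which is given by an element of the cone. -/
noncomputable def flatSection {m₀ : M} (d : mcone ι m₀) :
    A.flatSections (closure {m' | mcone ι m' = mcone ι m₀}) :=
  ⟨fun x => F.orderHom (F.mem_mcone_of_closure x d.2),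
    fun x => (F.mem_normalMonoid_iff ((F.closure_mcone_eq m₀).le x.2) _).2 ⟨d, d.2, rfl⟩, by
    rintro f ⟨m, hm⟩ hf
    have hle : mcone ι m₀ ≤ mcone ι m := (F.closure_mcone_eq m₀).le hm
    obtain ⟨i, x, rfl⟩ := F.cover m
    obtain ⟨p, hp⟩ := F.bFunAt_param_iff.1 hf
    obtain ⟨d, hd⟩ := d
    obtain ⟨α, hα, rfl⟩ := F.exists_of_mem_mcone (hle hd)
    have : ∀ᶠ m' in 𝓝 (A.param i x), ∃ x', A.param i x' = m' ∧
        HasExponent (f ∘ A.param i) x' p :=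
      F.eventually_param.2 (hp.eventually.mono fun x' h => ⟨x', rfl, h⟩)
    filter_upwards [continuousAt_subtype_val.eventually this]
    rintro ⟨_, hm'⟩ ⟨x', rfl, h⟩ hf'
    have hle' : mcone ι m₀ ≤ mcone ι (A.param i x') := (F.closure_mcone_eq m₀).le hm'
    exact (F.orderHom_param hf' h (F.mem_mcone_param.1 (hle' hd)) _).trans
      (F.orderHom_param hf hp hα _).symm⟩

theorem flatSection_injective {m₀ : M}
    (x : closure {m' | mcone ι m' = mcone ι m₀}) {d d' : mcone ι m₀}
    (h : (F.flatSection d).1 x = (F.flatSection d').1 x) : d = d' :=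
  Subtype.ext (F.orderHom_injective ((F.closure_mcone_eq m₀).le x.2 d.2)
    ((F.closure_mcone_eq m₀).le x.2 d'.2) h)

/-- Locally, a flat section is determined by its values on the coordinate functions of a chart, hence
the element of `D` it is given by is locally constant on the (connected) boundary face. -/
theorem flatSection_surjective {m₀ : M}
    (s : A.flatSections (closure {m' | mcone ι m' = mcone ι m₀})) :
    ∃ d, F.flatSection d = s := by
  have hle : ∀ x : closure {m' | mcone ι m' = mcone ι m₀}, mcone ι m₀ ≤ mcone ι (x : M) :=
    fun x => (F.closure_mcone_eq m₀).le x.2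
  choose d hd hsd using fun x : closure {m' | mcone ι m' = mcone ι m₀} =>
    (F.mem_normalMonoid_iff (hle x) _).1 (s.2.1 x)
  have : PreconnectedSpace (closure {m' | mcone ι m' = mcone ι m₀}) :=
    Subtype.preconnectedSpace (F.isPreconnected_mcone_eq m₀).closure
  have hconst : ∀ x y, d x = d y := fun x y => by
    refine IsPreconnected.eq_of_eventually_eq isPreconnected_univ (fun x _ => ?_) (mem_univ x)
      (mem_univ y)
    obtain ⟨m, hm⟩ := x
    obtain ⟨i, x, rfl⟩ := F.cover m
    obtain ⟨T, hT⟩ := AddMonoid.fg_def.1 (F.toric i).fg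
    obtain ⟨α, hα, hαd⟩ := F.exists_of_mem_mcone (hle ⟨A.param i x, hm⟩ (hd _))
    have h1 : ∀ᶠ y : closure {m' | mcone ι m' = mcone ι m₀} in 𝓝 ⟨A.param i x, hm⟩,
        ∀ q ∈ T, ∀ hy : A.BFunAt (coordFun A i q) y,
        s.1 y (A.germ _ hy) = s.1 ⟨A.param i x, hm⟩ (A.germ _ (F.bFunAt_coordFun q x)) :=
      (Filter.eventually_all_finset T).2 fun q _ => s.2.2 _ ⟨A.param i x, hm⟩ _
    have h2 : ∀ᶠ y : closure {m' | mcone ι m' = mcone ι m₀} in 𝓝 ⟨A.param i x, hm⟩,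
        (y : M) ∈ Set.range (A.param i) :=
      continuousAt_subtype_val.eventually
        ((F.isOpenEmbedding i).isOpen_range.mem_nhds ⟨x, rfl⟩)
    filter_upwards [h1, h2]
    rintro ⟨_, hm'⟩ h1 ⟨x', rfl⟩ -
    obtain ⟨β, hβ, hβd⟩ := F.exists_of_mem_mcone (hle ⟨A.param i x', hm'⟩ (hd _))
    rw [← hαd, ← hβd]
    congr 1
    refine AddMonoidHom.eq_of_eqOn_denseM hT fun q hq => ?_
    have e := h1 q hq (F.bFunAt_coordFun q x')
    rw [hsd, hsd] at e
    have e1 : ∀ (z : ModelSpace (A.Mon i)) (δ : Dual (A.Mon i)), δ ∈ cone z → ∀ (d : D)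
        (hd : d ∈ mcone ι (A.param i z)), ι i δ = d →
        F.orderHom hd (A.germ _ (F.bFunAt_coordFun q z)) = δ q := by
      rintro z δ hδ _ hd rfl
      exact F.orderHom_coordFun q hδ hd
    rw [e1 x' β hβ _ _ hβd, e1 x α hα _ _ hαd] at e
    exact e
  have hm₀ : m₀ ∈ closure {m' | mcone ι m' = mcone ι m₀} := subset_closure rfl
  refine ⟨⟨d ⟨m₀, hm₀⟩, hd _⟩, Subtype.ext (funext fun x => ?_)⟩
  rw [hsd x]
  have : ∀ (d d' : D) (hd : d ∈ mcone ι (x : M)) (hd' : d' ∈ mcone ι (x : M)), d = d' →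
      F.orderHom hd = F.orderHom hd' := by
    rintro d _ hd hd' rfl
    rfl
  exact this _ _ (F.mem_mcone_of_closure x (hd _)) _ (hconst _ _)

theorem orderHom_zero {m : M} (hd : (0 : D) ∈ mcone ι m) : F.orderHom hd = 0 := by
  obtain ⟨i, x, rfl⟩ := F.cover m
  refine AddMonoidHom.ext fun b => ?_
  obtain ⟨f, hf, rfl⟩ := exists_germ_eq A b
  obtain ⟨p, hp⟩ := F.bFunAt_param_iff.1 hf
  refine F.orderHom_germ _ hf ?_
  have := hasOrder_param (ι := ι) (zero_mem (cone x)) hp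
  rwa [map_zero] at this

/-- The elements of a cone are the same as the flat sections of the bundle of normal monoids to the
corresponding boundary face. -/
noncomputable def flatEquiv (m₀ : M) :
    mcone ι m₀ ≃+ A.flatSections (closure {m' | mcone ι m' = mcone ι m₀}) :=
  AddEquiv.ofBijective
    ({ toFun := F.flatSection
       map_zero' := Subtype.ext (funext fun x =>
         F.orderHom_zero (F.mem_mcone_of_closure x (zero_mem _)))
       map_add' := fun d d' => Subtype.ext (funext fun x =>
         F.orderHom_add (F.mem_mcone_of_closure x d.2) (F.mem_mcone_of_closure x d'.2)) } :
      mcone ι m₀ →+ A.flatSections (closure {m' | mcone ι m' = mcone ι m₀}))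
    ⟨fun d d' h => F.flatSection_injective (d := d) (d' := d')
      ⟨m₀, subset_closure (s := {m' | mcone ι m' = mcone ι m₀}) rfl⟩
      (congrFun (congrArg Subtype.val h) _), F.flatSection_surjective⟩

theorem flatEquiv_apply {m₀ : M} (d : mcone ι m₀)
    (x : closure {m' | mcone ι m' = mcone ι m₀}) (hd : (d : D) ∈ mcone ι (x : M)) :
    (F.flatEquiv m₀ d).1 x = F.orderHom hd := rfl

theorem normalTrivial (G : A.BoundaryFace) : A.NormalTrivial G.carrier := by
  obtain ⟨m₀, -, h⟩ := F.isComponent_iff.1 G.isComponent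
  rw [GCAtlas.BoundaryFace.carrier, h]
  intro x
  have hx : mcone ι m₀ ≤ mcone ι (x : M) := (F.closure_mcone_eq m₀).le x.2
  refine ⟨fun s hs => hs.1 x, fun s hs t ht hst => ?_, fun n hn => ?_⟩
  · obtain ⟨d, hd⟩ := F.flatSection_surjective ⟨s, hs⟩
    obtain ⟨d', hd'⟩ := F.flatSection_surjective ⟨t, ht⟩
    have : d = d' := F.flatSection_injective x (by rw [hd, hd']; exact hst)
    exact (congrArg Subtype.val hd).symm.trans (this ▸ congrArg Subtype.val hd')
  · obtain ⟨d, hd, rfl⟩ := (F.mem_normalMonoid_iff hx n).1 hn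
    exact ⟨_, (F.flatSection ⟨d, hd⟩).2, rfl⟩

/-- The boundary face whose interior consists of the points with the same cone as `m`. -/
noncomputable def face (m : M) : A.BoundaryFace :=
  ⟨A.codim m, {m' | mcone ι m' = mcone ι m}, F.isComponent_iff.2 ⟨m, rfl, rfl⟩⟩

omit F in
theorem boundaryFace_ext {G H : A.BoundaryFace} (h : G.int = H.int) : G = H := by
  obtain ⟨l, S, x, hx, hS⟩ := G
  obtain ⟨k, T, y, hy, hT⟩ := H
  obtain rfl : S = T := h
  have h1 : A.codim x = l := hx
  have h2 : x ∈ A.stratum k := connectedComponentIn_subset _ y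
    ((hS.symm.trans hT).le (mem_connectedComponentIn hx))
  obtain rfl : l = k := h1.symm.trans (show A.codim x = k from h2)
  rfl

/-- The monoid of flat sections over a boundary face `G`, for any description of its cone as the
image of an injective homomorphism. -/
theorem exists_addEquiv_flatSections {N : Type*} [AddCommMonoid N] {e : N →+ D}
    (he : Function.Injective e) {G : A.BoundaryFace} {m₀ : M}
    (hG : G.int = {m | mcone ι m = mcone ι m₀}) (hm₀ : mcone ι m₀ = AddMonoidHom.mrange e) :
    ∃ φ : N ≃+ A.flatSections G.carrier, ∀ (a : N) (x : G.carrier) (hd : e a ∈ mcone ι (x : M)),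
      (φ a).1 x = F.orderHom hd := by
  obtain ⟨l, S, hS⟩ := G
  obtain rfl : S = _ := hG
  have hmem : ∀ a, e a ∈ mcone ι m₀ := fun a => hm₀ ▸ ⟨a, rfl⟩
  let toCone : N ≃+ mcone ι m₀ := AddEquiv.ofBijective (e.codRestrict (mcone ι m₀) hmem)
    ⟨fun a b h => he (congrArg Subtype.val h), fun d => by
      obtain ⟨a, ha⟩ : (d : D) ∈ AddMonoidHom.mrange e := hm₀ ▸ d.2
      exact ⟨a, Subtype.ext ha⟩⟩
  exact ⟨toCone.trans (F.flatEquiv m₀), fun a x hd => F.flatEquiv_apply (toCone a) x hd⟩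

/-- Homomorphisms that are compatible with the embeddings into `D` correspond to the arrows of the
monoidal complex. -/
theorem mem_arrows_iff {N₁ N₂ : Type*} [AddCommMonoid N₁] [AddCommMonoid N₂] {e₁ : N₁ →+ D}
    {e₂ : N₂ →+ D} {G₁ G₂ : A.BoundaryFace}
    (h₁ : G₁.carrier = {m | AddMonoidHom.mrange e₁ ≤ mcone ι m})
    (h₂ : G₂.carrier = {m | AddMonoidHom.mrange e₂ ≤ mcone ι m}) (hne : G₂.carrier.Nonempty)
    (φ₁ : N₁ ≃+ A.flatSections G₁.carrier) (φ₂ : N₂ ≃+ A.flatSections G₂.carrier)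
    (hφ₁ : ∀ (a : N₁) (x : G₁.carrier) (hd : e₁ a ∈ mcone ι (x : M)),
      (φ₁ a).1 x = F.orderHom hd)
    (hφ₂ : ∀ (a : N₂) (x : G₂.carrier) (hd : e₂ a ∈ mcone ι (x : M)),
      (φ₂ a).1 x = F.orderHom hd) (f : N₁ →+ N₂) :
    (∀ a, e₂ (f a) = e₁ a) ↔
      (φ₂.toAddMonoidHom.comp f).comp φ₁.symm.toAddMonoidHom ∈ A.complex.arrows G₁ G₂ := by
  have key : ∀ a x (hG : x ∈ G₂.carrier) (hF : x ∈ G₁.carrier) (h1 : e₁ a ∈ mcone ι x)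
      (h2 : e₂ (f a) ∈ mcone ι x),
      (((φ₂.toAddMonoidHom.comp f).comp φ₁.symm.toAddMonoidHom (φ₁ a)).1 ⟨x, hG⟩ =
        (φ₁ a).1 ⟨x, hF⟩ ↔ e₂ (f a) = e₁ a) := by
    intro a x hG hF h1 h2
    have e1 : (φ₂.toAddMonoidHom.comp f).comp φ₁.symm.toAddMonoidHom (φ₁ a) = φ₂ (f a) :=
      congrArg (fun z => φ₂ (f z)) (φ₁.symm_apply_apply a)
    rw [e1, hφ₁ a ⟨x, hF⟩ h1, hφ₂ (f a) ⟨x, hG⟩ h2]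
    refine ⟨fun h => F.orderHom_injective h2 h1 h, fun h => ?_⟩
    have : ∀ (d d' : D) (hd : d ∈ mcone ι x) (hd' : d' ∈ mcone ι x), d = d' →
        F.orderHom hd = F.orderHom hd' := by
      rintro d _ hd hd' rfl
      rfl
    exact this _ _ h2 h1 h
  have k1 : ∀ {x}, x ∈ G₁.carrier → ∀ a, e₁ a ∈ mcone ι x := fun hx a => h₁.le hx ⟨a, rfl⟩
  have k2 : ∀ {x}, x ∈ G₂.carrier → ∀ a, e₂ a ∈ mcone ι x := fun hx a => h₂.le hx ⟨a, rfl⟩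
  constructor
  · intro h
    refine ⟨?_, fun s x hG hF => ?_⟩
    · rw [h₁, h₂]
      have : AddMonoidHom.mrange e₁ ≤ AddMonoidHom.mrange e₂ := by
        rintro _ ⟨a, rfl⟩
        exact ⟨f a, h a⟩
      exact fun m hm => this.trans hm
    · obtain ⟨a, rfl⟩ := φ₁.surjective s
      exact (key a x hG hF (k1 hF a) (k2 hG _)).2 (h a)
  · rintro ⟨hle, h⟩ a
    obtain ⟨x, hG⟩ := hne
    have hF := hle hG
    exact (key a x hG hF (k1 hF a) (k2 hG _)).1 (h _ x hG hF)

/-- A complex of submonoids of `D` which are precisely the cones of the points of `M` is isomorphic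
to the monoidal complex of `M`. -/
theorem exists_complexIso (K : MonoidalData) (e : ∀ j, K.Mon j →+ D)
    (he : ∀ j, Function.Injective (e j))
    (harr : ∀ i j (f : K.Mon i →+ K.Mon j), f ∈ K.arrows i j ↔ ∀ a, e j (f a) = e i a)
    (hinj : ∀ i j, AddMonoidHom.mrange (e i) = AddMonoidHom.mrange (e j) → i = j)
    (hpt : ∀ j, ∃ m, mcone ι m = AddMonoidHom.mrange (e j))
    (hobj : ∀ m, ∃ j, mcone ι m = AddMonoidHom.mrange (e j)) :
    ∃ Φ : K.Iso A.complex, ∀ j,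
      GCAtlas.BoundaryFace.int (Φ.obj j) = {m | mcone ι m = AddMonoidHom.mrange (e j)} ∧
      ∀ (a : K.Mon j) (x : GCAtlas.BoundaryFace.carrier (Φ.obj j))
        (hd : e j a ∈ mcone ι (x : M)),
        Subtype.val (p := (· ∈ A.flatSections _)) (Φ.map j a) x = F.orderHom hd := by
  choose pt hpt using hpt
  obtain ⟨obj, hint⟩ : ∃ obj : K.Obj ≃ A.BoundaryFace,
      ∀ j, (obj j).int = {m | mcone ι m = mcone ι (pt j)} := by
    refine ⟨Equiv.ofBijective (fun j => F.face (pt j)) ⟨fun i j hij => ?_, fun G => ?_⟩,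
      fun j => rfl⟩
    · apply hinj
      have h1 : {m' | mcone ι m' = mcone ι (pt i)} = {m' | mcone ι m' = mcone ι (pt j)} :=
        congrArg GCAtlas.BoundaryFace.int hij
      have h2 : mcone ι (pt i) = mcone ι (pt j) := h1.le rfl
      rw [← hpt, ← hpt, h2]
    · obtain ⟨m, -, hm⟩ := F.isComponent_iff.1 G.isComponent
      obtain ⟨j, hj⟩ := hobj m
      refine ⟨j, boundaryFace_ext ?_⟩
      rw [hm, hj, ← hpt]
      rfl
  choose map hmap using fun j => F.exists_addEquiv_flatSections (he j) (hint j) (hpt j)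
  have hcl : ∀ j, (obj j).carrier = {m | AddMonoidHom.mrange (e j) ≤ mcone ι m} := fun j => by
    rw [← hpt, ← F.closure_mcone_eq, ← hint]
    rfl
  refine ⟨MonoidalData.Iso.mk obj map fun i j f => ?_, fun j => ⟨?_, hmap j⟩⟩
  · rw [harr]
    exact F.mem_arrows_iff (hcl i) (hcl j) ⟨pt j, (hcl j).ge (hpt j).ge⟩ (map i) (map j) (hmap i)
      (hmap j) f
  · rw [← hpt]
    exact hint j

end IsFanAtlas

end GCorners

namespace GCorners

/-! ### Subdivisions of a toric monoid -/

open Algebra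

variable {D : Type*} [AddCommMonoid D] {R : MonoidalData.{v, w}} {e : ∀ i, R.Mon i →+ D}

/-- A monoidal complex of submonoids of `D`, given by compatible embeddings `e i`, such that every
element of `D` lies in the interior of precisely one of them. -/
structure IsSubdivision (e : ∀ i, R.Mon i →+ D) : Prop where
  complex : R.IsComplex
  injective : ∀ i, Function.Injective (e i)
  comp_arrow : ∀ i j, ∀ f ∈ R.arrows i j, ∀ a, e j (f a) = e i a
  partition : ∀ t : D, ∃! i, ∃ a ∈ monInterior (R.Mon i), e i a = t

/-- `t` has a positive multiple in the group generated by the image of `f`. -/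
def InSpan {N : Type*} [AddCommMonoid N] (f : N →+ D) (t : D) : Prop :=
  ∃ m : ℕ, 0 < m ∧ ∃ a b, m • t + f b = f a

/-- A submonoid (given by an embedding) is of full dimension if every element of `D` has a positive
multiple in the group it generates. -/
def IsFull {N : Type*} [AddCommMonoid N] (f : N →+ D) : Prop := ∀ t, InSpan f t

theorem nsmul_mem_monInterior {N : Type*} [AddCommMonoid N] {a : N} (ha : a ∈ monInterior N)
    {m : ℕ} (hm : 0 < m) : m • a ∈ monInterior N := by
  intro S hS hne h
  refine ha S hS hne (hS a ((m - 1) • a) ?_)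
  rwa [← succ_nsmul', Nat.sub_add_cancel hm]

namespace IsSubdivision

variable (S : IsSubdivision e)

include S

/-- Every element of a monoid lies in the interior of a face. -/
theorem exists_arrow_interior {j : R.Obj} (t : R.Mon j) :
    ∃ i, ∃ f ∈ R.arrows i j, ∃ a ∈ monInterior (R.Mon i), f a = t := by
  obtain ⟨⟨i, f⟩, ⟨hf, hr⟩, -⟩ := S.complex.existsUnique j (faceOf t) (isFace_faceOf t)
  dsimp only at hf hr
  obtain ⟨a, ha⟩ : t ∈ AddMonoidHom.mrange f := hr ▸ self_mem_faceOf t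
  refine ⟨i, f, hf, a, mem_monInterior.2 fun b => ?_, ha⟩
  obtain ⟨k, d, h⟩ : f b ∈ faceOf t := hr ▸ ⟨b, rfl⟩
  have hd : d ∈ AddMonoidHom.mrange f := by
    refine S.complex.isFace i j f hf d (f b) ?_
    rw [add_comm, ← h, ← ha, ← map_nsmul]
    exact ⟨_, rfl⟩
  obtain ⟨d, rfl⟩ := hd
  exact ⟨k, d, S.complex.injective i j f hf (by rw [map_nsmul, ha, h, map_add])⟩

/-- A monoid which contains an interior point of another one contains it as a face. -/
theorem exists_arrow_of_interior {i j : R.Obj} {a : R.Mon i} (ha : a ∈ monInterior (R.Mon i))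
    {b : R.Mon j} (h : e j b = e i a) : ∃ f ∈ R.arrows i j, f a = b := by
  obtain ⟨k, f, hf, c, hc, rfl⟩ := S.exists_arrow_interior b
  obtain rfl : k = i := (S.partition (e i a)).unique
    ⟨c, hc, by rw [← S.comp_arrow _ _ f hf, h]⟩ ⟨a, ha, rfl⟩
  rw [S.comp_arrow _ _ f hf] at h
  exact ⟨f, hf, by rw [S.injective _ h]⟩

theorem mem_arrows_iff {i j : R.Obj} {f : R.Mon i →+ R.Mon j} :
    f ∈ R.arrows i j ↔ ∀ a, e j (f a) = e i a := by
  refine ⟨S.comp_arrow i j f, fun h => ?_⟩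
  obtain ⟨a, ha⟩ := exists_mem_monInterior (S.complex.toric i).fg
  obtain ⟨g, hg, -⟩ := S.exists_arrow_of_interior ha (h a)
  have : f = g := AddMonoidHom.ext fun b => S.injective j (by rw [h, S.comp_arrow i j g hg])
  rwa [this]

theorem eq_of_mrange_eq {i j : R.Obj}
    (h : AddMonoidHom.mrange (e i) = AddMonoidHom.mrange (e j)) : i = j := by
  obtain ⟨a, ha⟩ := exists_mem_monInterior (S.complex.toric i).fg
  obtain ⟨b, hb⟩ : e i a ∈ AddMonoidHom.mrange (e j) := h ▸ ⟨a, rfl⟩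
  obtain ⟨f, hf, -⟩ := S.exists_arrow_of_interior ha hb
  have hs : AddMonoidHom.mrange f = ⊤ := by
    refine eq_top_iff.2 fun c _ => ?_
    obtain ⟨d, hd⟩ : e j c ∈ AddMonoidHom.mrange (e i) := h ▸ ⟨c, rfl⟩
    exact ⟨d, S.injective j (by rw [S.comp_arrow i j f hf, hd])⟩
  have := (S.complex.existsUnique j ⊤ fun _ _ _ => AddSubmonoid.mem_top _).unique
    (y₁ := ⟨i, f⟩) (y₂ := ⟨j, AddMonoidHom.id _⟩) ⟨hf, hs⟩
    ⟨S.complex.id_mem j, AddMonoidHom.mrange_eq_top.2 Function.surjective_id⟩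
  exact congrArg Sigma.fst this

theorem exists_interior (t : D) : ∃ i, ∃ a ∈ monInterior (R.Mon i), e i a = t :=
  (S.partition t).exists

/-- The submonoids are saturated in `D`. -/
theorem mem_of_nsmul_mem {r : R.Obj} {m : ℕ} (hm : 0 < m) {t : D}
    (ht : m • t ∈ AddMonoidHom.mrange (e r)) : t ∈ AddMonoidHom.mrange (e r) := by
  obtain ⟨i, a, ha, rfl⟩ := S.exists_interior t
  obtain ⟨b, hb⟩ := ht
  rw [← map_nsmul] at hb
  obtain ⟨f, hf, -⟩ := S.exists_arrow_of_interior (nsmul_mem_monInterior ha hm) hb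
  exact ⟨f a, S.comp_arrow _ _ f hf a⟩

/-- A submonoid of full dimension generates the group completion of `D`. -/
theorem exists_add_eq {r : R.Obj} (hr : IsFull (e r)) (t : D) : ∃ a b, t + e r b = e r a := by
  obtain ⟨m, hm, a, b, h⟩ := hr t
  obtain ⟨c, hc⟩ := S.mem_of_nsmul_mem (r := r) hm (t := t + e r b) ⟨a + (m - 1) • b, by
    obtain ⟨m, rfl⟩ := Nat.exists_eq_add_of_le' hm
    rw [nsmul_add, map_add, ← h, map_nsmul, Nat.add_sub_cancel, succ_nsmul (e r b)]
    abel⟩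
  exact ⟨c, b, hc.symm⟩

/-- The intersection with another monoid of the subdivision is a face. -/
theorem isFace_inter (r s : R.Obj) {a b : R.Mon r}
    (h : e r (a + b) ∈ AddMonoidHom.mrange (e s)) : e r a ∈ AddMonoidHom.mrange (e s) := by
  obtain ⟨i, f, hf, c, hc, hcab⟩ := S.exists_arrow_interior (a + b)
  obtain ⟨d, hd⟩ := h
  rw [← hcab, S.comp_arrow _ _ f hf] at hd
  obtain ⟨g, hg, -⟩ := S.exists_arrow_of_interior hc hd
  obtain ⟨a', rfl⟩ := S.complex.isFace _ _ f hf a b (hcab ▸ ⟨c, rfl⟩)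
  exact ⟨g a', by rw [S.comp_arrow _ _ g hg, S.comp_arrow _ _ f hf]⟩

theorem exists_nonneg_of_notMem (hD : IsToric D) (r s : R.Obj) {c : R.Mon r}
    (hc : e r c ∉ AddMonoidHom.mrange (e s)) :
    ∃ l : D →+ ℤ, (∀ a, 0 ≤ l (e r a)) ∧ (∀ b, l (e s b) ≤ 0) ∧ 0 < l (e r c) := by
  have := finite_grothendieck hD.fg
  have := hD.isAddTorsionFree
  by_contra! hcon
  let f : R.Mon r →+ GrothendieckAddGroup D := GrothendieckAddGroup.of.comp (e r)
  let g : R.Mon s →+ GrothendieckAddGroup D := -GrothendieckAddGroup.of.comp (e s)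
  have hfg : (AddMonoidHom.mrange f ⊔ AddMonoidHom.mrange g).FG := by
    refine AddSubmonoid.FG.sup ?_ ?_
    · rw [AddMonoidHom.mrange_eq_map]
      exact ((AddMonoid.fg_def.1 (S.complex.toric r).fg)).map f
    · rw [AddMonoidHom.mrange_eq_map]
      exact ((AddMonoid.fg_def.1 (S.complex.toric s).fg)).map g
  obtain ⟨m, hm, h⟩ := exists_nsmul_mem_of_forall_nonneg _ hfg
    (-GrothendieckAddGroup.of (e r c)) fun l hl => by
      have := hcon (l.comp GrothendieckAddGroup.of)
        (fun a => hl _ (AddSubmonoid.mem_sup_left ⟨a, rfl⟩))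
        (fun b => by
          have := hl _ (AddSubmonoid.mem_sup_right ⟨b, rfl⟩)
          simpa [g] using this)
      rw [map_neg]
      exact neg_nonneg.2 this
  obtain ⟨_, ⟨a, rfl⟩, _, ⟨b, rfl⟩, h⟩ := AddSubmonoid.mem_sup.1 h
  have h1 : e r (m • c + a) = e s b := hD.of_injective (by
    simp only [f, g, AddMonoidHom.comp_apply, AddMonoidHom.neg_apply, smul_neg] at h
    rw [map_add, map_nsmul, map_add, map_nsmul, ← sub_eq_zero]
    rw [← sub_eq_zero] at h
    rw [← h]
    abel)
  have h2 : e r (m • c) ∈ AddMonoidHom.mrange (e s) := S.isFace_inter r s (b := a) (h1 ▸ ⟨b, rfl⟩)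
  obtain ⟨m, rfl⟩ := Nat.exists_eq_add_of_le' hm
  rw [succ_nsmul'] at h2
  exact hc (S.isFace_inter r s h2)

theorem exists_nonneg (hD : IsToric D) (r s : R.Obj) :
    ∃ l : D →+ ℤ, (∀ a, 0 ≤ l (e r a)) ∧ (∀ b, l (e s b) ≤ 0) ∧
      ∀ a, l (e r a) = 0 → e r a ∈ AddMonoidHom.mrange (e s) := by
  have : ∀ c : R.Mon r, ∃ l : D →+ ℤ, (∀ a, 0 ≤ l (e r a)) ∧ (∀ b, l (e s b) ≤ 0) ∧
      (l (e r c) = 0 → e r c ∈ AddMonoidHom.mrange (e s)) := fun c => by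
    by_cases hc : e r c ∈ AddMonoidHom.mrange (e s)
    · exact ⟨0, by simp, by simp, fun _ => hc⟩
    · obtain ⟨l, h1, h2, h3⟩ := S.exists_nonneg_of_notMem hD r s hc
      exact ⟨l, h1, h2, fun h => absurd h h3.ne'⟩
  choose l h1 h2 h3 using this
  obtain ⟨T, hT⟩ := AddMonoid.fg_def.1 (S.complex.toric r).fg
  have hnn : ∀ a, 0 ≤ (∑ c ∈ T, l c) (e r a) := fun a => by
    rw [AddMonoidHom.finsetSum_apply]
    exact Finset.sum_nonneg fun c _ => h1 c a
  refine ⟨∑ c ∈ T, l c, hnn, fun b => ?_, fun a => ?_⟩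
  · rw [AddMonoidHom.finsetSum_apply]
    exact Finset.sum_nonpos fun c _ => h2 c b
  · have ha : a ∈ AddSubmonoid.closure (T : Set (R.Mon r)) := hT ▸ AddSubmonoid.mem_top a
    induction ha using AddSubmonoid.closure_induction with
    | mem c hc =>
      intro h
      rw [AddMonoidHom.finsetSum_apply, Finset.sum_eq_zero_iff_of_nonneg fun c _ => h1 c _] at h
      exact h3 c (h c hc)
    | zero => exact fun _ => by rw [map_zero]; exact zero_mem _
    | add x y _ _ hx hy =>
      intro h
      rw [map_add, map_add] at h
      have := hnn x
      have := hnn y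
      rw [map_add]
      exact add_mem (hx (by omega)) (hy (by omega))

/-- Two monoids of a subdivision are separated by a functional which vanishes on them precisely on
their intersection. -/
theorem exists_separating (hD : IsToric D) (r s : R.Obj) :
    ∃ (l : D →+ ℤ) (u : Dual (R.Mon r)) (v : Dual (R.Mon s)),
      (∀ a, l (e r a) = u a) ∧ (∀ b, l (e s b) = -v b) ∧
      (∀ a, u a = 0 ↔ e r a ∈ AddMonoidHom.mrange (e s)) ∧
      (∀ b, v b = 0 ↔ e s b ∈ AddMonoidHom.mrange (e r)) := by
  obtain ⟨l, h1, h2, h3⟩ := S.exists_nonneg hD r s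
  obtain ⟨m, h4, h5, h6⟩ := S.exists_nonneg hD s r
  obtain ⟨u, hu⟩ := exists_dual_of_nonneg ((l - m).comp (e r)) fun a => by
    simpa using (h5 a).trans (h1 a)
  obtain ⟨v, hv⟩ := exists_dual_of_nonneg ((m - l).comp (e s)) fun a => by
    simpa using (h2 a).trans (h4 a)
  simp only [AddMonoidHom.comp_apply, AddMonoidHom.sub_apply] at hu hv
  refine ⟨l - m, u, v, fun a => by rw [hu, AddMonoidHom.sub_apply], fun b => by
    rw [hv, AddMonoidHom.sub_apply]; ring, fun a => ⟨fun h => h3 a ?_, ?_⟩,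
    fun b => ⟨fun h => h6 b ?_, ?_⟩⟩
  · have := hu a; have := h1 a; have := h5 a; omega
  · rintro ⟨b, hb⟩
    have := hu a; have := h1 a; have := h5 a; have := h2 b; have := h4 b
    rw [hb] at *
    omega
  · have := hv b; have := h4 b; have := h2 b; omega
  · rintro ⟨a, ha⟩
    have := hv b; have := h1 a; have := h5 a; have := h2 b; have := h4 b
    rw [ha] at *
    omega

/-- An integral functional on a monoid of full dimension extends to `D`. -/
theorem exists_extend (hD : IsToric D) {r : R.Obj} (hr : IsFull (e r)) (l : R.Mon r →+ ℤ) :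
    ∃ l' : D →+ ℤ, ∀ a, l' (e r a) = l a := by
  have := hD.isCancelAdd
  choose a b h using S.exists_add_eq hr
  have key : ∀ t c d, t + e r d = e r c → l (a t) - l (b t) = l c - l d := by
    intro t c d h'
    have : a t + d = c + b t := S.injective r (by
      rw [map_add, map_add, ← h, ← h']
      abel)
    have := congrArg l this
    rw [map_add, map_add] at this
    omega
  refine ⟨⟨⟨fun t => l (a t) - l (b t), ?_⟩, fun s t => ?_⟩, fun c => ?_⟩
  · simpa using key 0 0 0 (by simp)
  · dsimp only
    rw [key (s + t) (a s + a t) (b s + b t), map_add, map_add]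
    · ring
    · rw [map_add, map_add, ← h, ← h]
      abel
  · simpa using key (e r c) c 0 (by simp)

end IsSubdivision

/-! ### Finite subdivisions -/

section Full

variable {N : Type*} [AddCommMonoid N] {f : N →+ D}

theorem InSpan.of_nsmul {t : D} {n : ℕ} (hn : 0 < n) (h : InSpan f (n • t)) : InSpan f t := by
  obtain ⟨m, hm, a, b, h⟩ := h
  exact ⟨n * m, Nat.mul_pos hn hm, a, b, by rwa [mul_nsmul]⟩

theorem InSpan.of_add {s t : D} (hs : InSpan f s) (ht : InSpan f (s + t)) : InSpan f t := by
  obtain ⟨m, hm, a, b, h⟩ := hs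
  obtain ⟨n, hn, c, d, h'⟩ := ht
  refine ⟨m * n, Nat.mul_pos hm hn, m • c + n • b, m • d + n • a, ?_⟩
  simp only [map_add, map_nsmul, ← h, ← h', nsmul_add]
  rw [← mul_nsmul s m n, ← mul_nsmul s n m, ← mul_nsmul t n m, mul_comm n m]
  abel

theorem InSpan.nsmul {t : D} (n : ℕ) (h : InSpan f t) : InSpan f (n • t) := by
  obtain ⟨m, hm, a, b, h⟩ := h
  refine ⟨m, hm, n • a, n • b, ?_⟩
  rw [map_nsmul, map_nsmul, ← h, nsmul_add, ← mul_nsmul, ← mul_nsmul, mul_comm]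

theorem InSpan.of_two {t w : D} {k k' : ℕ} (hk : k < k') (h : InSpan f (k • t + w))
    (h' : InSpan f (k' • t + w)) : InSpan f t ∧ InSpan f w := by
  obtain ⟨d, rfl⟩ := Nat.exists_eq_add_of_le hk.le
  have h1 : InSpan f (d • t) := h.of_add (by
    rwa [show k • t + w + d • t = (k + d) • t + w by rw [add_nsmul]; abel])
  have h2 := h1.of_nsmul (by omega)
  exact ⟨h2, (h2.nsmul k).of_add h⟩

end Full

/-- Finitely many submonoids of smaller dimension do not cover `D`, not even if they are replaced by
the (saturated) groups they generate. -/
theorem exists_forall_not_inSpan (e : ∀ i, R.Mon i →+ D) (T : Finset R.Obj)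
    (hT : ∀ i ∈ T, ¬ IsFull (e i)) : ∃ w, ∀ i ∈ T, ¬ InSpan (e i) w := by
  classical
  induction T using Finset.induction_on with
  | empty => exact ⟨0, by simp⟩
  | insert i T hi ih =>
    obtain ⟨w, hw⟩ := ih fun j hj => hT j (Finset.mem_insert_of_mem hj)
    obtain ⟨u, hu⟩ : ∃ u, ¬ InSpan (e i) u := by
      have := hT i (Finset.mem_insert_self i T)
      unfold IsFull at this
      push Not at this
      exact this
    by_cases hiw : InSpan (e i) w
    · have hfin : (⋃ j ∈ T, {k : ℕ | InSpan (e j) (k • w + u)}).Finite := by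
        refine T.finite_toSet.biUnion fun j hj => Set.Subsingleton.finite fun k hk k' hk' => ?_
        by_contra hne
        rcases lt_or_gt_of_ne hne with h | h
        · exact hw j hj (hk.of_two h hk').1
        · exact hw j hj (hk'.of_two h hk).1
      obtain ⟨k, hk⟩ := hfin.infinite_compl.nonempty
      simp only [mem_compl_iff, mem_iUnion, not_exists] at hk
      refine ⟨k • w + u, fun j hj => ?_⟩
      rcases Finset.mem_insert.1 hj with rfl | hj
      · exact fun h => hu ((hiw.nsmul k).of_add h)
      · exact hk j hj
    · exact ⟨w, fun j hj => by
        rcases Finset.mem_insert.1 hj with rfl | hj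
        exacts [hiw, hw j hj]⟩

/-- In a finite subdivision, the submonoids of full dimension cover `D`. For an element `t`, the
argument moves `t` slightly into a generic direction `w`, in the form of `k • t + w` for
infinitely many `k`. -/
theorem IsSubdivision.exists_full_of_finite (S : IsSubdivision e) (hD : IsToric D)
    [Finite R.Obj] (t : D) : ∃ r, IsFull (e r) ∧ ∃ a, e r a = t := by
  have := Fintype.ofFinite R.Obj
  classical
  have := hD.isCancelAdd
  obtain ⟨w, hw⟩ := exists_forall_not_inSpan e (Finset.univ.filter fun i => ¬ IsFull (e i))
    fun i hi => (Finset.mem_filter.1 hi).2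
  choose c a _ ha using fun k : ℕ => S.exists_interior (k • t + w)
  obtain ⟨r, hr⟩ := Finite.exists_infinite_fiber c
  have hinf : (c ⁻¹' {r}).Infinite := Set.infinite_coe_iff.1 hr
  have hmem : ∀ k ∈ c ⁻¹' {r}, ∃ a, e r a = k • t + w := by
    rintro k rfl
    exact ⟨_, ha k⟩
  have hspan : ∀ k ∈ c ⁻¹' {r}, InSpan (e r) (k • t + w) := fun k hk => by
    obtain ⟨a, h⟩ := hmem k hk
    exact ⟨1, one_pos, a, 0, by rw [map_zero, add_zero, one_nsmul, h]⟩
  obtain ⟨k, hk⟩ := hinf.nonempty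
  obtain ⟨k', hk', hlt⟩ := hinf.exists_gt k
  have hfull : IsFull (e r) := by
    by_contra hcon
    exact hw r (Finset.mem_filter.2 ⟨Finset.mem_univ _, hcon⟩)
      ((hspan k hk).of_two hlt (hspan k' hk')).2
  refine ⟨r, hfull, ?_⟩
  obtain ⟨a, b, hab⟩ := S.exists_add_eq hfull t
  obtain ⟨a', b', hab'⟩ := S.exists_add_eq hfull w
  obtain ⟨d, rfl⟩ := (S.complex.toric r).exists_add_of_forall_le (a := a) (b := b) fun α => by
    by_contra! hlt
    obtain ⟨k, hk, hgt⟩ := hinf.exists_gt (α a')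
    obtain ⟨y, hy⟩ := hmem k hk
    have h1 : k • a + a' = y + (k • b + b') := S.injective r (by
      simp only [map_add, map_nsmul, ← hab, ← hab', hy, nsmul_add]
      abel)
    have h2 := congrArg α h1
    simp only [map_add, map_nsmul, smul_eq_mul] at h2
    nlinarith
  refine ⟨d, add_right_cancel (b := e r b) ?_⟩
  rw [hab, map_add, add_comm]

end GCorners

namespace GCorners

/-! ### Gluing of the charts of the blow-up -/

section Extends

variable {D : Type*} [AddCommMonoid D] {N : Type*} [AddCommMonoid N]

/-- The extension of `x` to the localization of `Dual N` at the elements on which `x` does not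
vanish, considered inside of the group of functionals `l` on `D`, takes the value `c` at `l`. -/
def ExtendsTo (f : N →+ D) (x : ModelSpace (Dual N)) (l : D →+ ℤ) (c : ℝ≥0) : Prop :=
  ∃ a b : Dual N, (∀ t, l (f t) = (a t : ℤ) - b t) ∧ x b ≠ 0 ∧ c = x a / x b

theorem ExtendsTo.unique {f : N →+ D} {x : ModelSpace (Dual N)} {l : D →+ ℤ} {c c' : ℝ≥0}
    (h : ExtendsTo f x l c) (h' : ExtendsTo f x l c') : c = c' := by
  obtain ⟨a, b, e, hb, rfl⟩ := h
  obtain ⟨a', b', e', hb', rfl⟩ := h'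
  have : a + b' = a' + b := by
    ext t
    have h1 := e t
    rw [e' t] at h1
    simp only [AddMonoidHom.add_apply]
    omega
  rw [div_eq_div_iff hb hb', ← x.map_add, ← x.map_add, this]

end Extends

theorem IsFace.eq_faceOf {D : Type*} [AddCommMonoid D] {J : AddSubmonoid D} (hJ : IsFace J)
    {x : J} (hx : x ∈ monInterior J) : J = faceOf (x : D) := by
  refine le_antisymm (fun y hy => ?_) (hJ.faceOf_le x.2)
  obtain ⟨k, d, h⟩ := mem_monInterior.1 hx ⟨y, hy⟩
  exact ⟨k, d, congrArg Subtype.val h⟩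

section Glue

variable {P : Type u} [AddCommMonoid P] {R : MonoidalData.{v, w}}
  {ψ : R.Hom (faceComplex (Dual P))}

theorem isSubdivision_emb (hR : R.IsComplex) (hψ : ψ.IsRefinement) : IsSubdivision (emb ψ) where
  complex := hR
  injective i a b h := hψ.injective i (Subtype.ext h)
  comp_arrow i j f hf a := by
    obtain ⟨g, hg, h⟩ := ψ.comm i j f hf
    have h1 : ψ.map j (f a) = g (ψ.map i a) := congrArg (fun k => k a) h
    exact (congrArg Subtype.val h1).trans (hg _)
  partition t := by
    have key : ∀ (J : {S : AddSubmonoid (Dual P) // IsFace S}) (x : J.1),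
        x ∈ monInterior J.1 → (x : Dual P) = t →
        (⟨J, x⟩ : Σ j, (faceComplex (Dual P)).Mon j) =
          ⟨⟨faceOf t, isFace_faceOf t⟩, ⟨t, self_mem_faceOf t⟩⟩ := by
      rintro ⟨J, hJ⟩ ⟨x, hx⟩ hint rfl
      obtain rfl : J = faceOf x := hJ.eq_faceOf hint
      rfl
    have hint : (⟨t, self_mem_faceOf t⟩ : faceOf t) ∈ monInterior (faceOf t) := by
      refine mem_monInterior.2 ?_
      rintro ⟨a, k, d, h⟩
      refine ⟨k, ⟨d, isFace_faceOf t d a ?_⟩, Subtype.ext h⟩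
      rw [add_comm, ← h]
      exact nsmul_mem (self_mem_faceOf t) k
    obtain ⟨i, ⟨a, ha, hi⟩, hu⟩ := hψ.partition ⟨faceOf t, isFace_faceOf t⟩ _ hint
    refine ⟨i, ⟨a, ha, congrArg (fun z => (z.2 : Dual P)) hi⟩, ?_⟩
    rintro k ⟨b, hb, hbt⟩
    exact hu k ⟨b, hb, key _ _ (ψ.interior k b hb) hbt⟩

theorem Glue.symm {r s : R.Obj} {x : ModelSpace (Dual (R.Mon r))}
    {y : ModelSpace (Dual (R.Mon s))} (h : Glue ψ r s x y) : Glue ψ s r y x :=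
  ⟨h.2.1, h.1, fun l a b c d hb hd e e' => (h.2.2 l c d a b hd hb e' e).symm⟩

namespace IsSubdivision

variable (S : IsSubdivision (emb ψ))

include S

theorem mem_locSpace_iff {r s : R.Obj} {u : Dual (R.Mon r)}
    (hu : ∀ a, u a = 0 ↔ emb ψ r a ∈ AddMonoidHom.mrange (emb ψ s))
    {x : ModelSpace (Dual (R.Mon r))} : x ∈ locSpace (interPerp ψ r s) ↔ x u ≠ 0 := by
  refine ⟨fun h => h u fun a ha => (hu a).2 ha, fun h b hb => ?_⟩
  obtain ⟨k, β, hβ⟩ := exists_dual_eq_add_nsmul (S.complex.toric r).fg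
    (-(Nat.castAddMonoidHom ℤ).comp b) u fun a ha => by simp [hb a ((hu a).1 ha)]
  have : k • u = b + β := by
    ext a
    have := hβ a
    simp only [AddMonoidHom.neg_apply, AddMonoidHom.comp_apply, Nat.coe_castAddMonoidHom] at this
    simp only [AddMonoidHom.add_apply, AddMonoidHom.nsmul_apply, smul_eq_mul]
    zify
    linarith
  have h' : x (k • u) ≠ 0 := by
    rw [x.map_nsmul]
    exact pow_ne_zero _ h
  rw [this, x.map_add] at h'
  exact left_ne_zero_of_mul h'

theorem ext_of_full {r : R.Obj} (hr : IsFull (emb ψ r))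
    {l l' : Dual P →+ ℤ} (h : ∀ a, l (emb ψ r a) = l' (emb ψ r a)) (t : Dual P) : l t = l' t := by
  obtain ⟨a, b, e⟩ := S.exists_add_eq hr t
  have h1 := congrArg l e
  have h2 := congrArg l' e
  rw [map_add, h, h] at h1
  rw [map_add] at h2
  omega

/-- An element `q` of `Dual (R.Mon s)`, extended to a functional on `D`, is a difference `A - n • u`
on `R.Mon r`, where `u` cuts out the intersection of both monoids. -/
theorem exists_pullback (hD : IsToric (Dual P)) {r s : R.Obj} (hs : IsFull (emb ψ s))
    {u : Dual (R.Mon r)} (hu : ∀ a, u a = 0 ↔ emb ψ r a ∈ AddMonoidHom.mrange (emb ψ s))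
    (q : Dual (R.Mon s)) : ∃ (l : Dual P →+ ℤ) (n : ℕ) (A : Dual (R.Mon r)),
      (∀ b, l (emb ψ s b) = q b) ∧ ∀ a, (A a : ℤ) = l (emb ψ r a) + n * u a := by
  obtain ⟨l, hl⟩ := S.exists_extend hD hs ((Nat.castAddMonoidHom ℤ).comp q)
  obtain ⟨n, A, hA⟩ := exists_dual_eq_add_nsmul (S.complex.toric r).fg (l.comp (emb ψ r)) u
    fun a ha => by
      obtain ⟨b, hb⟩ := (hu a).1 ha
      rw [AddMonoidHom.comp_apply, ← hb, hl]
      exact Int.natCast_nonneg _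
  exact ⟨l, n, A, hl, hA⟩

theorem extendsTo_of_glue (hD : IsToric (Dual P)) {r s : R.Obj} (hr : IsFull (emb ψ r))
    {x : ModelSpace (Dual (R.Mon r))} {y : ModelSpace (Dual (R.Mon s))} (h : Glue ψ r s x y)
    {l : Dual P →+ ℤ} {c : ℝ≥0} (hc : ExtendsTo (emb ψ r) x l c) : ExtendsTo (emb ψ s) y l c := by
  obtain ⟨-, u, v, -, -, hu, hv⟩ := S.exists_separating hD r s
  have hyv := (S.mem_locSpace_iff hv).1 h.2.1
  obtain ⟨a, b, e, hb, rfl⟩ := hc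
  have key : ∀ q : Dual (R.Mon r), ∃ (l : Dual P →+ ℤ) (n : ℕ) (A : Dual (R.Mon s)),
      (∀ b, l (emb ψ r b) = q b) ∧ (∀ a, (A a : ℤ) = l (emb ψ s a) + n * v a) ∧
      x q = y A / y v ^ n := by
    intro q
    obtain ⟨l, n, A, hl, hA⟩ := S.exists_pullback hD hr hv q
    refine ⟨l, n, A, hl, hA, ?_⟩
    have := h.2.2 l q 0 A (n • v) (fun _ _ => rfl) (fun a ha => by simp [(hv a).2 ha])
      (fun t => by simp [hl]) (fun t => by simp [hA])
    rwa [x.map_zero, div_one, y.map_nsmul] at this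
  obtain ⟨la, n, A, hla, hA, ha'⟩ := key a
  obtain ⟨lb, m, B, hlb, hB, hb'⟩ := key b
  have hl : ∀ t, l t = (la - lb) t := S.ext_of_full hr fun t => by
    rw [AddMonoidHom.sub_apply, hla, hlb, e]
  have hyB : y B ≠ 0 := fun h0 => hb (by rw [hb', h0, zero_div])
  refine ⟨A + m • v, B + n • v, fun t => ?_, ?_, ?_⟩
  · have := hA t
    have := hB t
    rw [hl, AddMonoidHom.sub_apply]
    simp only [AddMonoidHom.add_apply, AddMonoidHom.nsmul_apply, smul_eq_mul]
    push_cast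
    linarith
  · rw [y.map_add, y.map_nsmul]
    exact mul_ne_zero hyB (pow_ne_zero _ hyv)
  · rw [ha', hb', y.map_add, y.map_add, y.map_nsmul, y.map_nsmul]
    field_simp

theorem glue_of_extendsTo (hD : IsToric (Dual P)) {r s : R.Obj}
    {x : ModelSpace (Dual (R.Mon r))} {y : ModelSpace (Dual (R.Mon s))}
    (h : ∀ l c, ExtendsTo (emb ψ r) x l c ↔ ExtendsTo (emb ψ s) y l c) : Glue ψ r s x y := by
  obtain ⟨l, u, v, hlu, hlv, hu, hv⟩ := S.exists_separating hD r s
  have hxu : x u ≠ 0 := by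
    obtain ⟨a, b, e, hb, -⟩ := (h (-l) (y v)).2 ⟨v, 0, fun t => by simp [hlv],
      by simp [y.map_zero], by simp [y.map_zero]⟩
    have : b = a + u := by
      ext t
      have := e t
      rw [AddMonoidHom.neg_apply, hlu] at this
      rw [AddMonoidHom.add_apply]
      omega
    rw [this, x.map_add] at hb
    exact right_ne_zero_of_mul hb
  have hyv : y v ≠ 0 := by
    obtain ⟨a, b, e, hb, -⟩ := (h l (x u)).1 ⟨u, 0, fun t => by simp [hlu],
      by simp [x.map_zero], by simp [x.map_zero]⟩
    have : b = a + v := by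
      ext t
      have := e t
      rw [hlv] at this
      rw [AddMonoidHom.add_apply]
      omega
    rw [this, y.map_add] at hb
    exact right_ne_zero_of_mul hb
  have hx := (S.mem_locSpace_iff hu).2 hxu
  have hy := (S.mem_locSpace_iff hv).2 hyv
  exact ⟨hx, hy, fun l a b c d hb hd e e' =>
    ExtendsTo.unique ((h _ _).1 ⟨a, b, e, hx b hb, rfl⟩) ⟨c, d, e', hy d hd, rfl⟩⟩

/-- The gluings are given by an equivalence relation already: two points are identified iff their
extensions agree. -/
theorem glue_iff (hD : IsToric (Dual P)) {r s : R.Obj} (hr : IsFull (emb ψ r))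
    (hs : IsFull (emb ψ s)) {x : ModelSpace (Dual (R.Mon r))} {y : ModelSpace (Dual (R.Mon s))} :
    Glue ψ r s x y ↔ ∀ l c, ExtendsTo (emb ψ r) x l c ↔ ExtendsTo (emb ψ s) y l c :=
  ⟨fun h _ _ => ⟨S.extendsTo_of_glue hD hr h, S.extendsTo_of_glue hD hs h.symm⟩,
    S.glue_of_extendsTo hD⟩

theorem eq_of_glue (hD : IsToric (Dual P)) {r : R.Obj} (hr : IsFull (emb ψ r))
    {x y : ModelSpace (Dual (R.Mon r))} (h : Glue ψ r r x y) : x = y := by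
  refine ModelSpace.ext fun q => ?_
  obtain ⟨l, hl⟩ := S.exists_extend hD hr ((Nat.castAddMonoidHom ℤ).comp q)
  have key : ∀ z : ModelSpace (Dual (R.Mon r)), ExtendsTo (emb ψ r) z l (z q) := fun z =>
    ⟨q, 0, fun t => by simp [hl], by simp [z.map_zero], by simp [z.map_zero]⟩
  exact ((S.glue_iff hD hr hr).1 h l (x q) |>.1 (key x)).unique (key y)

/-- The transition functions between the charts of the blow-up. -/
theorem exists_transition (hD : IsToric (Dual P)) {r s : R.Obj} (hs : IsFull (emb ψ s))
    {u : Dual (R.Mon r)} (hu : ∀ a, u a = 0 ↔ emb ψ r a ∈ AddMonoidHom.mrange (emb ψ s)) :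
    ∃ g : ModelSpace (Dual (R.Mon r)) → ModelSpace (Dual (R.Mon s)),
      (∀ x, x u ≠ 0 → Glue ψ r s x (g x)) ∧
      ∀ q, ∃ (n : ℕ) (A : Dual (R.Mon r)), (∀ a b, emb ψ r a = emb ψ s b → A a = q b) ∧
        ∀ x, x u ≠ 0 → g x q = x A / x u ^ n := by
  classical
  choose l n A hl hA using fun q => S.exists_pullback hD hs hu q
  have hAq : ∀ q a b, emb ψ r a = emb ψ s b → A q a = q b := by
    intro q a b hab
    have := hA q a
    rw [hab, hl, (hu a).2 ⟨b, hab.symm⟩] at this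
    simpa using this
  have hrel : ∀ (q q' : Dual (R.Mon s)) (t : R.Mon r),
      l (q + q') (emb ψ r t) = l q (emb ψ r t) + l q' (emb ψ r t) := by
    intro q q' t
    refine S.ext_of_full hs (l' := l q + l q') (fun t => ?_) _
    rw [AddMonoidHom.add_apply, hl, hl, hl, AddMonoidHom.add_apply, Nat.cast_add]
  have hg : ∀ x : ModelSpace (Dual (R.Mon r)), ∃ y : ModelSpace (Dual (R.Mon s)),
      x u ≠ 0 → ∀ q, y q = x (A q) / x u ^ n q := by
    intro x
    by_cases hx : x u ≠ 0
    swap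
    · exact ⟨onePoint, fun h => absurd h hx⟩
    refine ⟨⟨fun q => x (A q) / x u ^ n q, by
      have : A 0 = n 0 • u := by
        ext t
        have h0 : l 0 (emb ψ r t) = 0 :=
          S.ext_of_full hs (l' := 0) (fun t => by rw [hl]; simp) _
        have := hA 0 t
        rw [h0] at this
        simp only [AddMonoidHom.nsmul_apply, smul_eq_mul]
        zify
        linarith
      dsimp only
      rw [this, x.map_nsmul, div_self (pow_ne_zero _ hx)], fun q q' => by
      have : A (q + q') + (n q + n q') • u = A q + A q' + n (q + q') • u := by
        ext t
        have h0 := hrel q q' t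
        have h1 := hA q t
        have h2 := hA q' t
        have h3 := hA (q + q') t
        simp only [AddMonoidHom.nsmul_apply, smul_eq_mul, AddMonoidHom.add_apply]
        zify
        rw [h1, h2, h3, h0]
        ring
      dsimp only
      rw [div_mul_div_comm, div_eq_div_iff (pow_ne_zero _ hx)
        (mul_ne_zero (pow_ne_zero _ hx) (pow_ne_zero _ hx)), ← pow_add,
        ← x.map_nsmul (n q + n q') u, ← x.map_nsmul (n (q + q')) u,
        ← x.map_add (A (q + q')), ← x.map_add (A q) (A q'), ← x.map_add, this]⟩, fun _ _ => rfl⟩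
  choose g hg using hg
  refine ⟨g, fun x hx => ?_, fun q => ⟨n q, A q, hAq q, fun x hx => hg x hx q⟩⟩
  · refine ⟨(S.mem_locSpace_iff hu).2 hx, fun d hd => ?_, fun m a b c d hb hd e e' => ?_⟩
    · rw [hg x hx]
      refine div_ne_zero ((S.mem_locSpace_iff hu).2 hx _ fun a ha => ?_) (pow_ne_zero _ hx)
      obtain ⟨b, hb⟩ := ha
      rw [hAq d a b hb.symm]
      exact hd b ⟨a, hb.symm⟩
    · have hxb := (S.mem_locSpace_iff hu).2 hx b hb
      have hAd : x (A d) ≠ 0 := (S.mem_locSpace_iff hu).2 hx _ fun a ha => by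
        obtain ⟨b, hb⟩ := ha
        rw [hAq d a b hb.symm]
        exact hd b ⟨a, hb.symm⟩
      have hm : ∀ t, (m + l d) t = l c t := S.ext_of_full hs fun t => by
        rw [AddMonoidHom.add_apply, hl, hl, e']
        ring
      have : a + A d + n c • u = A c + b + n d • u := by
        ext t
        have h0 := hm (emb ψ r t)
        rw [AddMonoidHom.add_apply, e] at h0
        have h1 := hA c t
        have h2 := hA d t
        simp only [AddMonoidHom.nsmul_apply, smul_eq_mul, AddMonoidHom.add_apply]
        zify
        rw [h1, h2, ← h0]
        ring
      have h3 : x a * x (A d) * x u ^ n c = x (A c) * x b * x u ^ n d := by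
        rw [← x.map_add a (A d), ← x.map_nsmul (n c) u, ← x.map_add (a + A d) (n c • u),
          ← x.map_add (A c) b, ← x.map_nsmul (n d) u, ← x.map_add (A c + b) (n d • u), this]
      rw [hg x hx, hg x hx, div_div_div_eq,
        div_eq_div_iff hxb (mul_ne_zero (pow_ne_zero _ hx) hAd), mul_right_comm (x (A c)), ← h3]
      ring

end IsSubdivision

end Glue

end GCorners

namespace GCorners

/-! ### The topology of the blow-up -/

variable {P : Type u} [AddCommMonoid P] {R : MonoidalData.{v, w}}
  {ψ : R.Hom (faceComplex (Dual P))}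

theorem BlowUp.exists_mk (m : BlowUp ψ) : ∃ r x, BlowUp.mk ψ r x = m := by
  induction m using Quot.ind with
  | mk z => exact ⟨z.1, z.2, rfl⟩

theorem BlowUp.continuous_mk (r : MaxObj ψ) : Continuous (BlowUp.mk ψ r) :=
  continuous_quot_mk.comp continuous_sigmaMk

theorem BlowUp.isOpen_iff {U : Set (BlowUp ψ)} :
    IsOpen U ↔ ∀ r, IsOpen (BlowUp.mk ψ r ⁻¹' U) := by
  refine isQuotientMap_quot_mk.isOpen_preimage.symm.trans ?_
  rw [isOpen_sigma_iff]
  rfl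

theorem BlowUp.mk_onePoint (r s : MaxObj ψ) : BlowUp.mk ψ r onePoint = BlowUp.mk ψ s onePoint :=
  Quot.sound ⟨fun _ _ => one_ne_zero, fun _ _ => one_ne_zero, fun _ _ _ _ _ _ _ _ _ => rfl⟩

namespace IsSubdivision

variable (S : IsSubdivision (emb ψ)) (hP : AddMonoid.FG P)

include S hP

theorem isFull_iff (r : R.Obj) : IsFull (emb ψ r) ↔ monDim (R.Mon r) = monDim (Dual P) :=
  (monDim_eq_iff (isToric_dual hP) (emb ψ r) (S.injective r)).symm

theorem mk_eq_iff {r s : MaxObj ψ} {x : ModelSpace (Dual (R.Mon r.1))}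
    {y : ModelSpace (Dual (R.Mon s.1))} :
    BlowUp.mk ψ r x = BlowUp.mk ψ s y ↔ Glue ψ r.1 s.1 x y := by
  have hD := isToric_dual hP
  refine ⟨fun h => ?_, fun h => Quot.sound h⟩
  let E : BlowUp ψ → (Dual P →+ ℤ) → ℝ≥0 → Prop :=
    Quot.lift (fun z => ExtendsTo (emb ψ z.1.1) z.2) fun z z' h => by
      funext l c
      exact propext ((S.glue_iff hD ((S.isFull_iff hP _).2 z.1.2)
        ((S.isFull_iff hP _).2 z'.1.2)).1 h l c)
  have hE : E (BlowUp.mk ψ r x) = E (BlowUp.mk ψ s y) := congrArg E h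
  exact S.glue_of_extendsTo hD fun l c => iff_of_eq (congrFun (congrFun hE l) c)

theorem mk_injective (r : MaxObj ψ) : Function.Injective (BlowUp.mk ψ r) := fun _ _ h =>
  S.eq_of_glue (isToric_dual hP) ((S.isFull_iff hP _).2 r.2) ((S.mk_eq_iff hP).1 h)

/-- The part of the chart `r` which also lies in the chart `s` is the locus where an
element `u` does not vanish, and the transition function to `s` is an interior b-map there. -/
theorem exists_chart_transition (r s : MaxObj ψ) :
    ∃ (u : Dual (R.Mon r.1)) (g : ModelSpace (Dual (R.Mon r.1)) → ModelSpace (Dual (R.Mon s.1))),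
      (∀ a, u a = 0 ↔ emb ψ r.1 a ∈ AddMonoidHom.mrange (emb ψ s.1)) ∧
      (∀ x, BlowUp.mk ψ r x ∈ Set.range (BlowUp.mk ψ s) ↔ x u ≠ 0) ∧
      (∀ x, x u ≠ 0 → BlowUp.mk ψ s (g x) = BlowUp.mk ψ r x) ∧
      ∀ q, ∃ (A : Dual (R.Mon r.1)) (h : ModelSpace (Dual (R.Mon r.1)) → ℝ),
        (∀ a b, emb ψ r.1 a = emb ψ s.1 b → A a = q b) ∧
        ∀ x, x u ≠ 0 → SmoothAt h x ∧ 0 < h x ∧ (g x q : ℝ) = h x * (x A : ℝ) := by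
  have hD := isToric_dual hP
  obtain ⟨-, u, -, -, -, hu, -⟩ := S.exists_separating hD r.1 s.1
  obtain ⟨g, hg, hq⟩ := S.exists_transition hD ((S.isFull_iff hP _).2 s.2) hu
  have hg' : ∀ x, x u ≠ 0 → BlowUp.mk ψ s (g x) = BlowUp.mk ψ r x := fun x hx =>
    ((S.mk_eq_iff hP).2 (hg x hx)).symm
  refine ⟨u, g, hu, fun x => ⟨?_, fun hx => ⟨g x, hg' x hx⟩⟩, hg', fun q => ?_⟩
  · rintro ⟨y, hy⟩
    exact (S.mem_locSpace_iff hu).1 ((S.mk_eq_iff hP).1 hy.symm).1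
  · obtain ⟨n, A, hA, hgA⟩ := hq q
    refine ⟨A, fun x => ((x (n • u) : ℝ≥0) : ℝ)⁻¹, hA, fun x hx => ?_⟩
    have hpos : (0 : ℝ) < (x (n • u) : ℝ≥0) := by
      rw [x.map_nsmul]
      exact_mod_cast pow_pos (pos_iff_ne_zero.2 hx) n
    refine ⟨(smoothAt_coord _ x).inv hpos, inv_pos.2 hpos, ?_⟩
    beta_reduce
    rw [hgA x hx, x.map_nsmul]
    push_cast
    rw [div_eq_inv_mul]

omit S hP in
theorem hasExponent_of_forall {N N' : Type*} [AddCommMonoid N] [AddCommMonoid N'] {u A : N}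
    {q : N'} {g : ModelSpace N → ModelSpace N'} {h : ModelSpace N → ℝ}
    (H : ∀ x, x u ≠ 0 → SmoothAt h x ∧ 0 < h x ∧ (g x q : ℝ) = h x * (x A : ℝ))
    {x : ModelSpace N} (hx : x u ≠ 0) : HasExponent (fun x' => g x' q) x A := by
  refine ⟨h, (H x hx).1, (H x hx).2.1, ?_⟩
  filter_upwards [(continuous_coord u).continuousAt.eventually_ne hx] with x' hx'
  exact (H x' hx').2.2

theorem isOpenEmbedding_mk (r : MaxObj ψ) : IsOpenEmbedding (BlowUp.mk ψ r) := by
  refine IsOpenEmbedding.of_continuous_injective_isOpenMap (BlowUp.continuous_mk r)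
    (S.mk_injective hP r) fun U hU => BlowUp.isOpen_iff.2 fun s => ?_
  obtain ⟨u, g, -, hr, hg, hq⟩ := S.exists_chart_transition hP s r
  have : BlowUp.mk ψ s ⁻¹' (BlowUp.mk ψ r '' U) = {x | x u ≠ 0} ∩ g ⁻¹' U := by
    ext x
    constructor
    · rintro ⟨y, hy, h⟩
      have hx : x u ≠ 0 := (hr x).1 ⟨y, h⟩
      refine ⟨hx, ?_⟩
      rwa [mem_preimage, S.mk_injective hP r ((hg x hx).trans h.symm)]
    · rintro ⟨hx, h⟩
      exact ⟨g x, h, hg x hx⟩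
  rw [this]
  have ho : IsOpen {x : ModelSpace (Dual (R.Mon s.1)) | x u ≠ 0} :=
    isOpen_ne_fun (continuous_coord u) continuous_const
  refine ContinuousOn.isOpen_inter_preimage (fun x hx => ContinuousAt.continuousWithinAt ?_) ho hU
  refine ModelSpace.continuousAt_of_smoothAt fun q => ?_
  obtain ⟨A, h, -, H⟩ := hq q
  exact (hasExponent_of_forall H hx).smoothAt

theorem t2Space : T2Space (BlowUp ψ) := by
  have hD := isToric_dual hP
  refine ⟨fun m m' hne => ?_⟩
  have same : ∀ (r : MaxObj ψ) x y, BlowUp.mk ψ r x ≠ BlowUp.mk ψ r y →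
      ∃ U V, IsOpen U ∧ IsOpen V ∧ BlowUp.mk ψ r x ∈ U ∧ BlowUp.mk ψ r y ∈ V ∧ Disjoint U V := by
    intro r x y hxy
    obtain ⟨U, V, hU, hV, hx, hy, hUV⟩ := t2_separation fun h : x = y => hxy (h ▸ rfl)
    have ho := S.isOpenEmbedding_mk hP r
    exact ⟨_, _, ho.isOpenMap U hU, ho.isOpenMap V hV, mem_image_of_mem _ hx,
      mem_image_of_mem _ hy, (disjoint_image_iff ho.injective).2 hUV⟩
  obtain ⟨r, x, rfl⟩ := m.exists_mk
  obtain ⟨s, y, rfl⟩ := m'.exists_mk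
  obtain ⟨l, u, v, hlu, hlv, hu, hv⟩ := S.exists_separating hD r.1 s.1
  have hs := (S.isFull_iff hP _).2 s.2
  have hr := (S.isFull_iff hP _).2 r.2
  by_cases hx : x u = 0
  swap
  · obtain ⟨g, hg, -⟩ := S.exists_transition hD hs hu
    have h := (S.mk_eq_iff hP).2 (hg x hx)
    rw [h] at hne ⊢
    exact same s _ _ hne
  by_cases hy : y v = 0
  swap
  · obtain ⟨g, hg, -⟩ := S.exists_transition hD hr hv
    have h := (S.mk_eq_iff hP).2 (hg y hy)
    rw [h] at hne ⊢
    exact same r _ _ hne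
  -- on the overlap of the two charts, the functions of `u` and `v` are inverse to each other
  have hmul : ∀ x' y', Glue ψ r.1 s.1 x' y' → x' u * y' v = 1 := by
    intro x' y' h
    have := h.2.2 l u 0 0 v (fun _ _ => rfl) (fun a ha => (hv a).2 ha) (fun t => by simp [hlu])
      (fun t => by simp [hlv])
    have hy' : y' v ≠ 0 := (S.mem_locSpace_iff hv).1 h.2.1
    rw [x'.map_zero, y'.map_zero, div_one] at this
    rw [this, one_div, inv_mul_cancel₀ hy']
  refine ⟨BlowUp.mk ψ r '' {x' | x' u < 1}, BlowUp.mk ψ s '' {y' | y' v < 1},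
    (S.isOpenEmbedding_mk hP r).isOpenMap _ (isOpen_lt (continuous_coord u) continuous_const),
    (S.isOpenEmbedding_mk hP s).isOpenMap _ (isOpen_lt (continuous_coord v) continuous_const),
    ⟨x, by simp [hx], rfl⟩, ⟨y, by simp [hy], rfl⟩, ?_⟩
  rw [Set.disjoint_left]
  rintro _ ⟨x', hx', rfl⟩ ⟨y', hy', h⟩
  have h1 := hmul x' y' ((S.mk_eq_iff hP).1 h.symm)
  have h2 : x' u * y' v < 1 := mul_lt_one_of_nonneg_of_lt_one_left zero_le hx' (le_of_lt hy')
  exact h2.ne h1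

theorem countable_obj : Countable R.Obj := by
  have := (isToric_dual hP).countable isSharp_dual
  choose a ha using fun i => exists_mem_monInterior (S.complex.toric i).fg
  refine Function.Injective.countable (f := fun i => emb ψ i (a i)) fun i j h => ?_
  exact (S.partition _).unique ⟨a i, ha i, rfl⟩ ⟨a j, ha j, h.symm⟩

omit hP in
theorem isSharp_mon (r : R.Obj) : IsSharp (R.Mon r) := fun a b h => by
  have := isSharp_dual (emb ψ r a) (emb ψ r b) (by rw [← map_add, h, map_zero])
  exact S.injective r (by rw [this, map_zero])

theorem secondCountable : SecondCountableTopology (BlowUp ψ) := by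
  have := S.countable_obj hP
  have : Countable (MaxObj ψ) := inferInstanceAs (Countable {r : R.Obj // _})
  have hsc : ∀ r : MaxObj ψ, SecondCountableTopology (Set.range (BlowUp.mk ψ r)) := fun r => by
    have := (isToric_dual (S.complex.toric r.1).fg).secondCountable isSharp_dual
    exact (S.isOpenEmbedding_mk hP r).toIsEmbedding.toHomeomorph.symm.secondCountableTopology
  refine TopologicalSpace.secondCountableTopology_of_countable_cover
    (U := fun r => Set.range (BlowUp.mk ψ r))
    (fun r => (S.isOpenEmbedding_mk hP r).isOpen_range) ?_
  refine eq_univ_of_forall fun m => ?_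
  obtain ⟨r, x, rfl⟩ := m.exists_mk
  exact mem_iUnion.2 ⟨r, x, rfl⟩

omit hP in
theorem connectedSpace (hne : Nonempty (MaxObj ψ)) : ConnectedSpace (BlowUp ψ) := by
  obtain ⟨r₀⟩ := hne
  have : IsPreconnected (univ : Set (BlowUp ψ)) := by
    refine isPreconnected_of_forall (BlowUp.mk ψ r₀ onePoint) fun m _ => ?_
    obtain ⟨r, x, rfl⟩ := m.exists_mk
    refine ⟨Set.range (BlowUp.mk ψ r), subset_univ _, ⟨_, BlowUp.mk_onePoint r r₀⟩, ⟨x, rfl⟩, ?_⟩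
    rw [← image_univ]
    exact ((isToric_dual (S.complex.toric r.1).fg).isPreconnected_univ isSharp_dual).image _
      (BlowUp.continuous_mk r).continuousOn
  have : PreconnectedSpace (BlowUp ψ) := ⟨this⟩
  exact { toNonempty := ⟨BlowUp.mk ψ r₀ onePoint⟩ }

/-! ### The blow-up as a manifold -/

omit hP in
/-- The identification of the double dual of `R.Mon r` with a submonoid of `P^∨`. -/
noncomputable def chartCone (r : MaxObj ψ) : Dual (Dual (R.Mon r.1)) →+ Dual P :=
  (emb ψ r.1).comp
    ((S.complex.toric r.1).bidual (S.isSharp_mon r.1)).symm.toAddMonoidHom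

omit hP in
theorem chartCone_bidual (r : MaxObj ψ) (a : R.Mon r.1) :
    S.chartCone r ((S.complex.toric r.1).bidual (S.isSharp_mon r.1) a) = emb ψ r.1 a :=
  congrArg (emb ψ r.1) (AddEquiv.symm_apply_apply _ a)

theorem isFanAtlas_blowUp : IsFanAtlas (blowUpAtlas ψ) (S.chartCone) where
  dom_eq _ := rfl
  toric r := isToric_dual (S.complex.toric r.1).fg
  injective r := (S.injective r.1).comp (AddEquiv.injective _)
  isOpenEmbedding := S.isOpenEmbedding_mk hP
  cover := BlowUp.exists_mk
  transition r s x y hxy q := by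
    obtain ⟨u, g, hu, hr, hg, hq⟩ := S.exists_chart_transition hP r s
    obtain ⟨A, h, hA, H⟩ := hq q
    have hx : x u ≠ 0 := (hr x).1 ⟨y, hxy.symm⟩
    refine ⟨A, (hasExponent_of_forall H hx).congr ?_, fun α hα => ?_⟩
    · filter_upwards [(continuous_coord u).continuousAt.eventually_ne hx] with x' hx'
      have : chartInv (blowUpAtlas ψ) s (BlowUp.mk ψ r x') = g x' := by
        rw [← hg x' hx']
        exact Function.leftInverse_invFun (S.mk_injective hP s) (g x')
      change g x' q = chartInv (blowUpAtlas ψ) s (BlowUp.mk ψ r x') q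
      rw [this]
    · obtain ⟨a, rfl⟩ := ((S.complex.toric r.1).bidual (S.isSharp_mon r.1)).surjective α
      obtain ⟨b, hb⟩ := (hu a).1 (hα u hx)
      have hgx : g x = y := S.mk_injective hP s ((hg x hx).trans hxy)
      refine ⟨(S.complex.toric s.1).bidual (S.isSharp_mon s.1) b, fun q' hq' => ?_, ?_,
        (hA a b hb.symm).symm⟩
      · obtain ⟨A', h', hA', H'⟩ := hq q'
        change q' b = 0
        rw [← hA' a b hb.symm]
        refine hα A' fun h0 => hq' ?_
        have := (H' x hx).2.2
        rw [h0, hgx] at this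
        simpa using this
      · rw [chartCone_bidual, chartCone_bidual, hb]
  range r s x h := by
    obtain ⟨u, g, hu, hr, hg, hq⟩ := S.exists_chart_transition hP r s
    refine (hr x).2 ?_
    rw [(isToric_dual (S.complex.toric r.1).fg).ne_zero_iff]
    intro α hα
    obtain ⟨β, hβ⟩ := h α hα
    obtain ⟨a, rfl⟩ := ((S.complex.toric r.1).bidual (S.isSharp_mon r.1)).surjective α
    obtain ⟨b, rfl⟩ := ((S.complex.toric s.1).bidual (S.isSharp_mon s.1)).surjective β
    rw [chartCone_bidual, chartCone_bidual] at hβ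
    exact (hu a).2 ⟨b, hβ⟩

theorem isManifold (hne : Nonempty (MaxObj ψ)) : (blowUpAtlas ψ).IsManifold where
  hausdorff := S.t2Space hP
  secondCountable := S.secondCountable hP
  connected := S.connectedSpace hne
  toric r := isToric_dual (S.complex.toric r.1).fg
  isOpen_dom _ := isOpen_univ
  isOpenEmbedding r := (S.isOpenEmbedding_mk hP r).comp isOpen_univ.isOpenEmbedding_subtypeVal
  cover m := by
    obtain ⟨r, x, h⟩ := m.exists_mk
    exact ⟨r, x, mem_univ _, h⟩
  transition r s := by
    obtain ⟨u, g, hu, hr, hg, hq⟩ := S.exists_chart_transition hP r s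
    have hmem : ∀ x, BlowUp.mk ψ r x ∈ BlowUp.mk ψ s '' univ → x u ≠ 0 := fun x hx =>
      (hr x).1 (by rwa [image_univ] at hx)
    refine ⟨g, fun x _ hx => ⟨mem_univ _, hg x (hmem x hx)⟩, fun q => ?_⟩
    obtain ⟨A, h, -, H⟩ := hq q
    exact ⟨A, h, fun x hx => H x (hmem x hx.2)⟩
  embedded := (S.isFanAtlas_blowUp hP).facesEmbedded

end IsSubdivision

/-- The model space, with its only chart, and with the dual monoid as ambient monoid. -/
theorem isFanAtlas_model (hP : IsToric P) :
    IsFanAtlas (modelAtlas P) (fun _ => AddMonoidHom.id (Dual P)) where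
  dom_eq _ := rfl
  toric _ := hP
  injective _ := Function.injective_id
  isOpenEmbedding _ := IsOpenEmbedding.id
  cover m := ⟨(), m, rfl⟩
  transition _ _ x y h q := by
    obtain rfl : x = y := h
    refine ⟨q, (hasExponent_coord q x).congr ?_, fun α hα => ⟨α, hα, rfl, rfl⟩⟩
    refine Eventually.of_forall fun x' => ?_
    have : chartInv (modelAtlas P) () x' = x' :=
      Function.leftInverse_invFun (f := (id : ModelSpace P → ModelSpace P))
        Function.injective_id x'
    exact congrArg (fun z : ModelSpace P => z q) this.symm
  range _ _ x _ := ⟨x, rfl⟩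

end GCorners

namespace GCorners

/-! ### Transport of morphisms along isomorphisms of monoidal complexes -/

section Transport

theorem map_mem_monInterior {N N' : Type*} [AddCommMonoid N] [AddCommMonoid N'] (f : N ≃+ N')
    {a : N} (ha : a ∈ monInterior N) : f a ∈ monInterior N' := by
  rw [mem_monInterior] at ha ⊢
  intro b
  obtain ⟨k, d, h⟩ := ha (f.symm b)
  refine ⟨k, f d, ?_⟩
  rw [← map_nsmul, h, map_add, f.apply_symm_apply]

variable {C : MonoidalData.{u, v}} {C' : MonoidalData.{u', v'}} {E : MonoidalData.{w, w'}}

/-- The composition of a morphism with an isomorphism. -/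
def MonoidalData.Hom.compIso (ψ : C.Hom C') (σ : C'.Iso E) : C.Hom E where
  obj i := σ.obj (ψ.obj i)
  map i := (σ.map (ψ.obj i)).toAddMonoidHom.comp (ψ.map i)
  interior i a ha := map_mem_monInterior (σ.map (ψ.obj i)) (ψ.interior i a ha)
  comm i j f hf := by
    obtain ⟨g, hg, h⟩ := ψ.comm i j f hf
    refine ⟨_, (σ.arrows_iff _ _ g).1 hg, AddMonoidHom.ext fun a => ?_⟩
    have h1 : ψ.map j (f a) = g (ψ.map i a) := congrArg (fun k => k a) h
    have h2 := (σ.map (ψ.obj i)).symm_apply_apply (ψ.map i a)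
    change σ.map (ψ.obj j) (ψ.map j (f a)) =
      σ.map (ψ.obj j) (g ((σ.map (ψ.obj i)).symm (σ.map (ψ.obj i) (ψ.map i a))))
    rw [h1, h2]

/-- A morphism can be precomposed with the inverse of an isomorphism. -/
theorem exists_hom_total_comp (Φ : C.Iso C') (χ : C.Hom E) :
    ∃ χ' : C'.Hom E, χ'.total ∘ Φ.total = χ.total := by
  obtain ⟨z, hz⟩ : ∃ z : ∀ j, Σ o, (C'.Mon j →+ E.Mon o),
      ∀ i, z (Φ.obj i) = ⟨χ.obj i, (χ.map i).comp (Φ.map i).symm.toAddMonoidHom⟩ :=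
    ⟨Equiv.piCongrLeft (fun j => Σ o, (C'.Mon j →+ E.Mon o)) Φ.obj
      fun i => ⟨χ.obj i, (χ.map i).comp (Φ.map i).symm.toAddMonoidHom⟩,
      fun i => Equiv.piCongrLeft_apply_apply _ _ _ _⟩
  refine ⟨⟨fun j => (z j).1, fun j => (z j).2, fun j a ha => ?_, fun j k f hf => ?_⟩, ?_⟩
  · obtain ⟨i, rfl⟩ := Φ.obj.surjective j
    rw [hz i]
    exact χ.interior i _ (map_mem_monInterior (Φ.map i).symm ha)
  · obtain ⟨i, rfl⟩ := Φ.obj.surjective j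
    obtain ⟨l, rfl⟩ := Φ.obj.surjective k
    rw [hz i, hz l]
    have hf' : ((Φ.map l).symm.toAddMonoidHom.comp f).comp (Φ.map i).toAddMonoidHom ∈
        C.arrows i l := by
      rw [Φ.arrows_iff]
      convert hf
      ext a
      simp
    obtain ⟨g, hg, h⟩ := χ.comm i l _ hf'
    refine ⟨g, hg, AddMonoidHom.ext fun a => ?_⟩
    have := congrArg (fun k => k ((Φ.map i).symm a)) h
    simpa using this
  · funext ⟨i, a⟩
    have key : ∀ y : Σ o, (C'.Mon (Φ.obj i) →+ E.Mon o),
        y = ⟨χ.obj i, (χ.map i).comp (Φ.map i).symm.toAddMonoidHom⟩ →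
        (⟨y.1, y.2 (Φ.map i a)⟩ : Σ o, E.Mon o) = ⟨χ.obj i, χ.map i a⟩ := by
      rintro _ rfl
      simp
    exact key _ (hz i)

end Transport

/-! ### The blow-down map -/

variable {P : Type u} [AddCommMonoid P] {R : MonoidalData.{v, w}}
  {ψ : R.Hom (faceComplex (Dual P))}

theorem continuous_blowDown : Continuous (blowDown ψ) := by
  refine continuous_def.2 fun U hU => BlowUp.isOpen_iff.2 fun r => ?_
  have : Continuous fun x : ModelSpace (Dual (R.Mon r.1)) => x.comap (dualEmb ψ r.1) :=
    ModelSpace.continuous_iff.2 fun p => continuous_coord _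
  exact hU.preimage this

theorem bMapOn_blowDown (U : Set (BlowUp ψ)) :
    (blowUpAtlas ψ).BMapOn (modelAtlas P) (blowDown ψ) U :=
  ⟨continuous_blowDown.continuousOn, fun r _ => ⟨fun x => x.comap (dualEmb ψ r.1),
    fun _ _ _ _ => ⟨mem_univ _, rfl⟩, fun q => ⟨dualEmb ψ r.1 q, fun _ => 1, fun x _ =>
      ⟨smoothAt_const 1 x, one_pos, (one_mul _).symm⟩⟩⟩⟩

namespace IsSubdivision

open IsFanAtlas

variable (S : IsSubdivision (emb ψ))

include S

theorem mem_mcone_mk (hP : AddMonoid.FG P) {r : MaxObj ψ} {x : ModelSpace (Dual (R.Mon r.1))}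
    {t : Dual P} : t ∈ mcone (A := blowUpAtlas ψ) S.chartCone (BlowUp.mk ψ r x) ↔
      ∃ a, emb ψ r.1 a = t ∧ ∀ q, x q ≠ 0 → q a = 0 := by
  have h := (S.isFanAtlas_blowUp hP).mcone_param r x
  constructor
  · intro ht
    obtain ⟨α, hα, rfl⟩ := h.le ht
    obtain ⟨a, rfl⟩ := ((S.complex.toric r.1).bidual (S.isSharp_mon r.1)).surjective α
    exact ⟨a, (S.chartCone_bidual r a).symm, hα⟩
  · rintro ⟨a, rfl, ha⟩
    exact h.ge ⟨(S.complex.toric r.1).bidual (S.isSharp_mon r.1) a, ha, S.chartCone_bidual r a⟩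

theorem blowDown_ne_zero_iff (hP : AddMonoid.FG P) (m : BlowUp ψ) (p : P) :
    blowDown ψ m p ≠ 0 ↔ ∀ t ∈ mcone (A := blowUpAtlas ψ) S.chartCone m, t p = 0 := by
  obtain ⟨r, x, rfl⟩ := m.exists_mk
  refine ((isToric_dual (S.complex.toric r.1).fg).ne_zero_iff x (dualEmb ψ r.1 p)).trans ?_
  constructor
  · intro h t ht
    obtain ⟨a, rfl, ha⟩ := (S.mem_mcone_mk hP).1 ht
    exact h ((S.complex.toric r.1).bidual (S.isSharp_mon r.1) a) ha
  · intro h α hα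
    obtain ⟨a, rfl⟩ := ((S.complex.toric r.1).bidual (S.isSharp_mon r.1)).surjective α
    exact h _ ((S.mem_mcone_mk hP).2 ⟨a, rfl, hα⟩)

theorem exists_mcone_eq (hP : AddMonoid.FG P)
    (hmax : ∀ t : Dual P, ∃ r : MaxObj ψ, ∃ a, emb ψ r.1 a = t) (i : R.Obj) :
    ∃ m, mcone (A := blowUpAtlas ψ) S.chartCone m = AddMonoidHom.mrange (emb ψ i) := by
  obtain ⟨a, ha⟩ := exists_mem_monInterior (S.complex.toric i).fg
  obtain ⟨r, b, hb⟩ := hmax (emb ψ i a)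
  obtain ⟨f, hf, -⟩ := S.exists_arrow_of_interior ha hb
  let B := (S.complex.toric r.1).bidual (S.isSharp_mon r.1)
  have hface : IsFace ((AddMonoidHom.mrange f).map B.toAddMonoidHom) := by
    rintro α β ⟨c, hc, h⟩
    refine ⟨B.symm α, S.complex.isFace i r.1 f hf _ (B.symm β) ?_, B.apply_symm_apply α⟩
    rw [← map_add, ← h]
    change B.symm (B c) ∈ _
    rwa [B.symm_apply_apply]
  obtain ⟨x, hx⟩ := exists_cone_eq (isToric_dual (S.complex.toric r.1).fg).fg hface
  refine ⟨BlowUp.mk ψ r x, ?_⟩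
  ext t
  rw [S.mem_mcone_mk hP]
  constructor
  · rintro ⟨c, rfl, hc⟩
    have : B c ∈ cone x := hc
    rw [hx] at this
    obtain ⟨_, ⟨d, rfl⟩, h⟩ := this
    exact ⟨d, by rw [← B.injective h, S.comp_arrow _ _ f hf]⟩
  · rintro ⟨d, rfl⟩
    have : B (f d) ∈ cone x := hx ▸ ⟨f d, ⟨d, rfl⟩, rfl⟩
    exact ⟨f d, S.comp_arrow _ _ f hf d, this⟩

theorem exists_mrange_eq (hP : AddMonoid.FG P) (m : BlowUp ψ) :
    ∃ i, mcone (A := blowUpAtlas ψ) S.chartCone m = AddMonoidHom.mrange (emb ψ i) := by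
  obtain ⟨r, x, rfl⟩ := m.exists_mk
  let B := (S.complex.toric r.1).bidual (S.isSharp_mon r.1)
  have hface : IsFace ((cone x).comap B.toAddMonoidHom) := fun a b h =>
    isFace_cone x (B a) (B b) (by rw [← map_add]; exact h)
  obtain ⟨⟨i, f⟩, ⟨hf, hr⟩, -⟩ := S.complex.existsUnique r.1 _ hface
  dsimp only at hf hr
  refine ⟨i, ?_⟩
  ext t
  rw [S.mem_mcone_mk hP]
  constructor
  · rintro ⟨a, rfl, ha⟩
    obtain ⟨b, rfl⟩ := hr.ge (show a ∈ (cone x).comap B.toAddMonoidHom from ha)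
    exact ⟨b, (S.comp_arrow _ _ f hf b).symm⟩
  · rintro ⟨b, rfl⟩
    exact ⟨f b, S.comp_arrow _ _ f hf b, hr.le ⟨b, rfl⟩⟩

/-! ### The interior -/

theorem stratum_zero (hP : AddMonoid.FG P) :
    (blowUpAtlas ψ).stratum 0 = blowDown ψ ⁻¹' modelInterior P := by
  ext m
  refine ((S.isFanAtlas_blowUp hP).codim_eq_zero_iff m).trans ?_
  constructor
  · intro h p
    refine (S.blowDown_ne_zero_iff hP m p).2 fun t ht => ?_
    rw [h] at ht
    rw [(AddSubmonoid.mem_bot).1 ht, AddMonoidHom.zero_apply]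
  · intro h
    refine eq_bot_iff.2 fun t ht => AddSubmonoid.mem_bot.2 (AddMonoidHom.ext fun p => ?_)
    exact (S.blowDown_ne_zero_iff hP m p).1 (h p) t ht

omit S in
theorem isOpen_modelInterior (hP : AddMonoid.FG P) : IsOpen (modelInterior P) := by
  obtain ⟨s, hs⟩ := exists_mem_monInterior hP
  have : modelInterior P = {x | x s ≠ 0} := by
    ext x
    refine ⟨fun h => h s, fun h p => ?_⟩
    obtain ⟨k, d, e⟩ := mem_monInterior.1 hs p
    have : x p * x d ≠ 0 := by
      rw [← x.map_add, ← e, x.map_nsmul]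
      exact pow_ne_zero k h
    exact left_ne_zero_of_mul this
  rw [this]
  exact isOpen_ne_fun (continuous_coord s) continuous_const

variable (hP : IsToric P) (hsharp : IsSharp P)

include hP hsharp

/-- On a monoid of full dimension, all functionals are differences of elements of `P`. -/
theorem exists_dualEmb_sub (r : MaxObj ψ) (q : Dual (R.Mon r.1)) :
    ∃ a b : P, q + dualEmb ψ r.1 b = dualEmb ψ r.1 a := by
  have hD := isToric_dual hP.fg
  obtain ⟨l, hl⟩ := S.exists_extend hD ((S.isFull_iff hP.fg _).2 r.2)
    ((Nat.castAddMonoidHom ℤ).comp q)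
  obtain ⟨α, β, h⟩ := hD.exists_eq_sub isSharp_dual l
  obtain ⟨a, ha⟩ := hP.exists_eval_eq hsharp α
  obtain ⟨b, hb⟩ := hP.exists_eval_eq hsharp β
  refine ⟨a, b, AddMonoidHom.ext fun t => ?_⟩
  have h1 := h (emb ψ r.1 t)
  rw [hl, ha, hb] at h1
  change q t + emb ψ r.1 t b = emb ψ r.1 t a
  have h2 : ((q t : ℕ) : ℤ) = (emb ψ r.1 t a : ℤ) - emb ψ r.1 t b := h1
  omega

theorem dualEmb_injective (r : MaxObj ψ) : Function.Injective (dualEmb ψ r.1) := fun p p' h => by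
  refine hP.eq_of_forall_eq hsharp fun α => ?_
  have := S.ext_of_full ((S.isFull_iff hP.fg _).2 r.2)
    (l := (Nat.castAddMonoidHom ℤ).comp (AddMonoidHom.eval p))
    (l' := (Nat.castAddMonoidHom ℤ).comp (AddMonoidHom.eval p')) (fun t => ?_) α
  · exact Nat.cast_injective (R := ℤ) this
  · exact congrArg (Nat.cast (R := ℤ)) (congrArg (fun k => k t) h)

/-- The inverse of the blow-down map on the interior, in the chart `r`. -/
theorem exists_inverse (r : MaxObj ψ) :
    ∃ g : ModelSpace P → ModelSpace (Dual (R.Mon r.1)),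
      (∀ z ∈ modelInterior P, blowDown ψ (BlowUp.mk ψ r (g z)) = z) ∧
      ∀ q, ∃ (p : P) (h : ModelSpace P → ℝ),
        ∀ z ∈ modelInterior P, SmoothAt h z ∧ 0 < h z ∧ (g z q : ℝ) = h z * (z p : ℝ) := by
  choose a b hab using S.exists_dualEmb_sub hP hsharp r
  have hg : ∀ z : ModelSpace P, ∃ y : ModelSpace (Dual (R.Mon r.1)),
      z ∈ modelInterior P → ∀ q, y q = z (a q) / z (b q) := by
    intro z
    by_cases hz : z ∈ modelInterior P
    swap
    · exact ⟨onePoint, fun h => absurd h hz⟩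
    refine ⟨⟨fun q => z (a q) / z (b q), ?_, fun q q' => ?_⟩, fun _ _ => rfl⟩
    · have : b 0 = a 0 := S.dualEmb_injective hP hsharp r (by rw [← hab, zero_add])
      dsimp only
      rw [this, div_self (hz _)]
    · have : a (q + q') + (b q + b q') = a q + a q' + b (q + q') := by
        refine S.dualEmb_injective hP hsharp r ?_
        simp only [map_add, ← hab]
        abel
      dsimp only
      rw [div_mul_div_comm, div_eq_div_iff (hz _) (mul_ne_zero (hz _) (hz _)),
        ← z.map_add (b q) (b q'), ← z.map_add (a q) (a q'), ← z.map_add (a (q + q')),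
        ← z.map_add (a q + a q'), this]
  choose g hg using hg
  refine ⟨g, fun z hz => ModelSpace.ext fun p => ?_, fun q => ⟨a q, fun z => ((z (b q) : ℝ≥0) : ℝ)⁻¹,
    fun z hz => ?_⟩⟩
  · change g z (dualEmb ψ r.1 p) = z p
    have : a (dualEmb ψ r.1 p) = p + b (dualEmb ψ r.1 p) :=
      S.dualEmb_injective hP hsharp r (by rw [← hab, map_add])
    rw [hg z hz, div_eq_iff (hz _), ← z.map_add, this]
  · have hpos : (0 : ℝ) < (z (b q) : ℝ≥0) := by
      exact_mod_cast pos_iff_ne_zero.2 (hz (b q))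
    refine ⟨(smoothAt_coord _ z).inv hpos, inv_pos.2 hpos, ?_⟩
    beta_reduce
    rw [hg z hz]
    push_cast
    rw [div_eq_inv_mul]

theorem injOn_blowDown : InjOn (blowDown ψ) (blowDown ψ ⁻¹' modelInterior P) := by
  have F := S.isFanAtlas_blowUp hP.fg
  intro m hm m' hm' h
  obtain ⟨r, x, rfl⟩ := m.exists_mk
  have hbot : mcone (A := blowUpAtlas ψ) S.chartCone m' = ⊥ :=
    (F.codim_eq_zero_iff m').1 ((S.stratum_zero hP.fg).ge hm')
  obtain ⟨y, rfl⟩ := F.exists_param_eq_of_le (i := r) (x := x) (m := m')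
    (hbot.trans_le bot_le)
  congr 1
  refine ModelSpace.ext fun q => ?_
  obtain ⟨a, b, hab⟩ := S.exists_dualEmb_sub hP hsharp r q
  have h' : ∀ p, x (dualEmb ψ r.1 p) = y (dualEmb ψ r.1 p) := fun p =>
    congrArg (fun z : ModelSpace P => z p) h
  have h1 := x.map_add q (dualEmb ψ r.1 b)
  have h2 := y.map_add q (dualEmb ψ r.1 b)
  rw [hab, h'] at h1
  rw [hab, h1, ← h'] at h2
  exact mul_right_cancel₀ (hm b) h2

theorem diffeoOn_blowDown (hne : Nonempty (MaxObj ψ)) :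
    (blowUpAtlas ψ).DiffeoOn (modelAtlas P) (blowDown ψ) ((blowUpAtlas ψ).stratum 0)
      (modelInterior P) := by
  obtain ⟨r₀⟩ := hne
  choose g hg hq using S.exists_inverse hP hsharp
  have hV := isOpen_modelInterior hP.fg
  rw [S.stratum_zero hP.fg]
  have hmem : ∀ r, ∀ z ∈ modelInterior P,
      BlowUp.mk ψ r (g r z) ∈ blowDown ψ ⁻¹' modelInterior P := fun r z hz => by
    rw [mem_preimage, hg r z hz]
    exact hz
  refine ⟨hV.preimage continuous_blowDown, hV, fun z => BlowUp.mk ψ r₀ (g r₀ z),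
    fun m hm => hm, hmem r₀, ⟨fun m hm => ?_, hg r₀⟩, bMapOn_blowDown _, ?_, fun _ s => ?_⟩
  · exact S.injOn_blowDown hP hsharp (hmem r₀ _ hm) hm (hg r₀ _ hm)
  · refine (BlowUp.continuous_mk r₀).comp_continuousOn fun z hz =>
      ContinuousAt.continuousWithinAt (ModelSpace.continuousAt_of_smoothAt fun q => ?_)
    obtain ⟨p, h, H⟩ := hq r₀ q
    refine ((H z hz).1.mul (smoothAt_coord p z)).congr ?_
    filter_upwards [hV.mem_nhds hz] with z' hz' using (H z' hz').2.2.symm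
  · refine ⟨g s, fun z _ hz _ => ⟨mem_univ _, ?_⟩, fun q => ?_⟩
    · exact S.injOn_blowDown hP hsharp (hmem s z hz) (hmem r₀ z hz)
        ((hg s z hz).trans (hg r₀ z hz).symm)
    · obtain ⟨p, h, H⟩ := hq s q
      exact ⟨p, h, fun z hz => H z hz.2.1⟩

end IsSubdivision

end GCorners

namespace GCorners

/-! ### The monoidal complexes of the blow-up and of the model space -/

variable {P : Type u} [AddCommMonoid P] {R : MonoidalData.{v, w}}
  {ψ : R.Hom (faceComplex (Dual P))}

open IsFanAtlas

theorem mcone_model (hP : IsToric P) (x : ModelSpace P) :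
    mcone (A := modelAtlas P) (fun _ => AddMonoidHom.id (Dual P)) x = cone x :=
  ((isFanAtlas_model hP).mcone_param () x).trans (AddSubmonoid.map_id _)

/-- The canonical isomorphism of the complex of faces of `P^∨` with the monoidal complex of the
model space, given by the cones of the points. -/
theorem exists_modelIso (hP : IsToric P) :
    ∃ σ : (faceComplex (Dual P)).Iso (modelAtlas P).complex, ∀ Q,
      GCAtlas.BoundaryFace.int (σ.obj Q) = {x | cone x = Q.1} ∧
      ∀ (a : Q.1) (x : GCAtlas.BoundaryFace.carrier (σ.obj Q)) (hd : _),
        Subtype.val (p := (· ∈ (modelAtlas P).flatSections _)) (σ.map Q a) x =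
          (isFanAtlas_model hP).orderHom (m := (x : ModelSpace P)) (d := (a : Dual P)) hd := by
  obtain ⟨σ, hσ⟩ := (isFanAtlas_model hP).exists_complexIso (faceComplex (Dual P))
    (fun Q => Q.1.subtype) (fun Q => Subtype.val_injective) (fun _ _ _ => Iff.rfl)
    (fun Q Q' h => Subtype.ext (by simpa using h))
    (fun Q => by
      obtain ⟨x, hx⟩ := exists_cone_eq hP.fg Q.2
      exact ⟨x, by rw [mcone_model hP, hx, AddSubmonoid.mrange_subtype]⟩)
    (fun x => ⟨⟨cone x, isFace_cone x⟩, by rw [mcone_model hP, AddSubmonoid.mrange_subtype]⟩)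
  refine ⟨σ, fun Q => ⟨(hσ Q).1.trans ?_, (hσ Q).2⟩⟩
  ext x
  rw [Set.mem_ofPred_eq, Set.mem_ofPred_eq, mcone_model hP, AddSubmonoid.mrange_subtype]

theorem carrier_of_int_eq (hP : IsToric P) {G : (modelAtlas P).BoundaryFace}
    {Q : AddSubmonoid (Dual P)} (hQ : IsFace Q) (h : G.int = {x | cone x = Q}) :
    G.carrier = {x | Q ≤ cone x} := by
  obtain ⟨x₀, rfl⟩ := exists_cone_eq hP.fg hQ
  have := (isFanAtlas_model hP).closure_mcone_eq x₀
  simp only [mcone_model hP] at this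
  rw [← this, ← h]
  rfl

theorem isCanonical_of_int_eq (hP : IsToric P)
    {σ : (faceComplex (Dual P)).Iso (modelAtlas P).complex}
    (hσ : ∀ Q, GCAtlas.BoundaryFace.int (σ.obj Q) = {x | cone x = Q.1} ∧
      ∀ (a : Q.1) (x : GCAtlas.BoundaryFace.carrier (σ.obj Q)) (hd : _),
        Subtype.val (p := (· ∈ (modelAtlas P).flatSections _)) (σ.map Q a) x =
          (isFanAtlas_model hP).orderHom (m := (x : ModelSpace P)) (d := (a : Dual P)) hd) :
    IsCanonical σ := by
  intro Q
  have hc := carrier_of_int_eq hP Q.2 (hσ Q).1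
  refine ⟨?_, fun α x p => ?_⟩
  · rw [hc]
    ext x
    constructor
    · rintro h p ⟨α, hα, hp⟩
      by_contra hx
      exact hp (h hα p hx)
    · intro h α hα p hx
      by_contra hp
      exact hx (h p ⟨α, hα, hp⟩)
  · have hα : (α : Dual P) ∈ cone (x : ModelSpace P) := hc.le x.2 α.2
    have hE := hasExponent_coord p (x : ModelSpace P)
    have hb : (modelAtlas P).BFunAt (fun y => y p) x :=
      ((isFanAtlas_model hP).bFunAt_param_iff (i := ()) (x := (x : ModelSpace P))).2 ⟨p, hE⟩
    have hd : (α : Dual P) ∈ mcone (A := modelAtlas P) (fun _ => AddMonoidHom.id (Dual P))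
        (x : ModelSpace P) := by rwa [mcone_model hP]
    refine ⟨hb, ?_⟩
    rw [(hσ Q).2 α x hd]
    exact (isFanAtlas_model hP).orderHom_param (i := ()) (x := (x : ModelSpace P)) hb hE hα hd

namespace IsSubdivision

variable (S : IsSubdivision (emb ψ))

include S

/-- The monoidal complex of the blow-up is the refinement it is constructed from. -/
theorem exists_blowUpIso (hP : AddMonoid.FG P)
    (hmax : ∀ t : Dual P, ∃ r : MaxObj ψ, ∃ a, emb ψ r.1 a = t) :
    ∃ Φ : R.Iso (blowUpAtlas ψ).complex, ∀ i,
      GCAtlas.BoundaryFace.int (Φ.obj i) =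
        {m | mcone (A := blowUpAtlas ψ) S.chartCone m = AddMonoidHom.mrange (emb ψ i)} ∧
      ∀ (a : R.Mon i) (x : GCAtlas.BoundaryFace.carrier (Φ.obj i)) (hd : _),
        Subtype.val (p := (· ∈ (blowUpAtlas ψ).flatSections _)) (Φ.map i a) x =
          (S.isFanAtlas_blowUp hP).orderHom (m := (x : BlowUp ψ)) (d := emb ψ i a) hd :=
  (S.isFanAtlas_blowUp hP).exists_complexIso R (emb ψ) S.injective
    (fun _ _ _ => S.mem_arrows_iff) (fun _ _ => S.eq_of_mrange_eq) (S.exists_mcone_eq hP hmax)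
    (S.exists_mrange_eq hP)

/-- The blow-down map takes a point with cone `ψ_i(R_i)` into the boundary face that corresponds to
the face of `P^∨` which contains `ψ_i(R_i)` and meets its interior. -/
theorem cone_blowDown (hP : IsToric P) (hsharp : IsSharp P) {i : R.Obj} {m : BlowUp ψ}
    (hm : mcone (A := blowUpAtlas ψ) S.chartCone m = AddMonoidHom.mrange (emb ψ i)) :
    cone (blowDown ψ m) = (ψ.obj i).1 := by
  obtain ⟨a, ha⟩ := exists_mem_monInterior (S.complex.toric i).fg
  have hQ : (ψ.obj i).1 = faceOf (emb ψ i a) :=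
    (ψ.obj i).2.eq_faceOf (x := ψ.map i a) (ψ.interior i a ha)
  have hne : ∀ p, blowDown ψ m p ≠ 0 ↔ emb ψ i a p = 0 := fun p => by
    rw [S.blowDown_ne_zero_iff hP.fg, hm]
    refine ⟨fun h => h _ ⟨a, rfl⟩, ?_⟩
    rintro h _ ⟨b, rfl⟩
    have hb : emb ψ i b ∈ faceOf (emb ψ i a) := hQ ▸ (ψ.map i b).2
    exact eq_zero_of_mem_faceOf (AddMonoidHom.eval p) hb h
  rw [hQ]
  ext β
  constructor
  · intro hβ
    refine (isToric_dual hP.fg).mem_faceOf_of_forall fun φ hφ => ?_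
    obtain ⟨p, hp⟩ := hP.exists_eval_eq hsharp φ
    rw [hp] at hφ ⊢
    exact hβ p ((hne p).2 hφ)
  · intro hβ p hp
    exact eq_zero_of_mem_faceOf (AddMonoidHom.eval p) hβ ((hne p).1 hp)

theorem cone_blowDown_le (hP : IsToric P) (hsharp : IsSharp P) {i : R.Obj} {m m' : BlowUp ψ}
    (hm : mcone (A := blowUpAtlas ψ) S.chartCone m = AddMonoidHom.mrange (emb ψ i))
    (hm' : AddMonoidHom.mrange (emb ψ i) ≤ mcone (A := blowUpAtlas ψ) S.chartCone m') :
    (ψ.obj i).1 ≤ cone (blowDown ψ m') := by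
  rw [← S.cone_blowDown hP hsharp hm, hP.cone_le_iff]
  intro p hp
  rw [S.blowDown_ne_zero_iff hP.fg] at hp ⊢
  exact fun t ht => hp t (hm' (hm ▸ ht))

/-- The b-differential of the blow-down map is given by the inclusion of the cones into `P^∨`. -/
theorem orderHom_blowDown (hP : IsToric P) {m : BlowUp ψ} {t : Dual P}
    (hd : t ∈ mcone (A := blowUpAtlas ψ) S.chartCone m)
    (hd' : t ∈ mcone (A := modelAtlas P) (fun _ => AddMonoidHom.id (Dual P)) (blowDown ψ m))
    (b : ModelSpace P → ℝ≥0) (hb : (modelAtlas P).BFunAt b (blowDown ψ m)) :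
    ∃ hb' : (blowUpAtlas ψ).BFunAt (b ∘ blowDown ψ) m,
      (isFanAtlas_model hP).orderHom hd' ((modelAtlas P).germ b hb) =
        (S.isFanAtlas_blowUp hP.fg).orderHom hd ((blowUpAtlas ψ).germ (b ∘ blowDown ψ) hb') := by
  obtain ⟨r, x, rfl⟩ := m.exists_mk
  obtain ⟨p, hp⟩ := ((isFanAtlas_model hP).bFunAt_param_iff (i := ())).1 hb
  have hE : HasExponent ((b ∘ blowDown ψ) ∘ BlowUp.mk ψ r) x (dualEmb ψ r.1 p) :=
    HasExponent.comp (g := fun y => y.comap (dualEmb ψ r.1))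
      (fun q => ⟨dualEmb ψ r.1 q, hasExponent_coord _ x⟩) hp (hasExponent_coord _ x)
  have hb' : (blowUpAtlas ψ).BFunAt (b ∘ blowDown ψ) (BlowUp.mk ψ r x) :=
    ((S.isFanAtlas_blowUp hP.fg).bFunAt_param_iff (i := r)).2 ⟨_, hE⟩
  refine ⟨hb', ?_⟩
  have h1 : (isFanAtlas_model hP).orderHom hd' ((modelAtlas P).germ b hb) = t p := by
    refine (isFanAtlas_model hP).orderHom_param (i := ()) hb hp ?_ hd'
    rwa [mcone_model hP] at hd'
  obtain ⟨a, rfl, ha⟩ := (S.mem_mcone_mk hP.fg).1 hd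
  rw [h1]
  have hα : S.chartCone r ((S.complex.toric r.1).bidual (S.isSharp_mon r.1) a) = emb ψ r.1 a :=
    S.chartCone_bidual r a
  exact ((S.isFanAtlas_blowUp hP.fg).orderHom_germ hd hb' ⟨r, x, dualEmb ψ r.1 p,
    (S.complex.toric r.1).bidual (S.isSharp_mon r.1) a, ha, rfl, hE, hα, rfl⟩).symm

theorem exists_induced (hP : IsToric P) (hsharp : IsSharp P)
    (hmax : ∀ t : Dual P, ∃ r : MaxObj ψ, ∃ a, emb ψ r.1 a = t) :
    ∃ (σ : (faceComplex (Dual P)).Iso (modelAtlas P).complex)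
        (Φ : R.Iso (blowUpAtlas ψ).complex)
        (β' : (blowUpAtlas ψ).complex.Hom (modelAtlas P).complex),
      IsCanonical σ ∧ GCAtlas.IsInduced (blowDown ψ) β' ∧
      β'.total ∘ Φ.total = σ.total ∘ ψ.total := by
  obtain ⟨σ, hσ⟩ := exists_modelIso hP
  obtain ⟨Φ, hΦ⟩ := S.exists_blowUpIso hP.fg hmax
  obtain ⟨β', hβ'⟩ := exists_hom_total_comp Φ (ψ.compIso σ)
  refine ⟨σ, Φ, β', isCanonical_of_int_eq hP hσ, fun G => ?_, hβ'⟩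
  obtain ⟨i, rfl⟩ := Φ.obj.surjective G
  obtain ⟨m₀, hm₀⟩ := S.exists_mcone_eq hP.fg hmax i
  have hcl : GCAtlas.BoundaryFace.carrier (Φ.obj i) = {m | AddMonoidHom.mrange (emb ψ i) ≤
      mcone (A := blowUpAtlas ψ) S.chartCone m} := by
    rw [← hm₀, ← (S.isFanAtlas_blowUp hP.fg).closure_mcone_eq, hm₀, ← (hΦ i).1]
    rfl
  have hc := carrier_of_int_eq hP (ψ.obj i).2 (hσ (ψ.obj i)).1
  have heq : ∀ a, (⟨β'.obj (Φ.obj i), β'.map (Φ.obj i) (Φ.map i a)⟩ :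
      Σ G, (modelAtlas P).complex.Mon G) = ⟨σ.obj (ψ.obj i), σ.map _ (ψ.map i a)⟩ := fun a =>
    congrFun hβ' ⟨i, a⟩
  constructor
  · have h0 : β'.obj (Φ.obj i) = σ.obj (ψ.obj i) := congrArg Sigma.fst (heq 0)
    rw [h0, (hσ _).1, (hΦ i).1]
    exact fun m hm => S.cone_blowDown hP hsharp hm
  · intro s x
    obtain ⟨a, rfl⟩ := (Φ.map i).surjective s
    have hle := S.cone_blowDown_le hP hsharp hm₀ (hcl.le x.2)
    have hd : emb ψ i a ∈ mcone (A := blowUpAtlas ψ) S.chartCone (x : BlowUp ψ) :=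
      hcl.le x.2 ⟨a, rfl⟩
    have hd' : emb ψ i a ∈ mcone (A := modelAtlas P) (fun _ => AddMonoidHom.id (Dual P))
        (blowDown ψ x) := by
      rw [mcone_model hP]
      exact hle (ψ.map i a).2
    have key : ∀ z : Σ G, (modelAtlas P).complex.Mon G,
        z = ⟨σ.obj (ψ.obj i), σ.map _ (ψ.map i a)⟩ →
        ∃ hx : blowDown ψ x ∈ GCAtlas.BoundaryFace.carrier z.1,
        ∀ (b : ModelSpace P → ℝ≥0) (hb : (modelAtlas P).BFunAt b (blowDown ψ x)),
          ∃ hb' : (blowUpAtlas ψ).BFunAt (b ∘ blowDown ψ) x,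
          Subtype.val (p := (· ∈ (modelAtlas P).flatSections _)) z.2 ⟨blowDown ψ x, hx⟩
            ((modelAtlas P).germ b hb) =
            Subtype.val (p := (· ∈ (blowUpAtlas ψ).flatSections _)) (Φ.map i a) x
              ((blowUpAtlas ψ).germ (b ∘ blowDown ψ) hb') := by
      rintro _ rfl
      refine ⟨hc.ge hle, fun b hb => ?_⟩
      obtain ⟨hb', h⟩ := S.orderHom_blowDown hP hd hd' b hb
      refine ⟨hb', ?_⟩
      rw [(hΦ i).2 a x hd, ← h]
      have e := (hσ _).2 (ψ.map i a) ⟨blowDown ψ x, hc.ge hle⟩ hd'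
      exact DFunLike.congr_fun e ((modelAtlas P).germ b hb)
    exact key _ (heq a)

end IsSubdivision

end GCorners

theorem proposition3p2 {P : Type u} [AddCommMonoid P] (hP : IsToric P) (hsharp : IsSharp P)
    (R : MonoidalData.{v, w}) (hR : R.IsComplex)
    (ψ : R.Hom (faceComplex (Dual P))) (hψ : ψ.IsRefinement)
    (hmax : Finite R.Obj ∨ ∀ t : Dual P, ∃ r : MaxObj ψ, ∃ a, emb ψ r.1 a = t) :
    (blowUpAtlas ψ).IsManifold ∧
    (∀ (r s : MaxObj ψ) (x : ModelSpace (Dual (R.Mon r.1))) (y : ModelSpace (Dual (R.Mon s.1))),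
      BlowUp.mk ψ r x = BlowUp.mk ψ s y ↔ Glue ψ r.1 s.1 x y) ∧
    (blowUpAtlas ψ).BMapOn (modelAtlas P) (blowDown ψ) Set.univ ∧
    (∀ F : (blowUpAtlas ψ).BoundaryFace, (blowUpAtlas ψ).NormalTrivial F.carrier) ∧
    (∃ (σ : (faceComplex (Dual P)).Iso (modelAtlas P).complex)
        (Φ : R.Iso (blowUpAtlas ψ).complex)
        (β' : (blowUpAtlas ψ).complex.Hom (modelAtlas P).complex),
      IsCanonical σ ∧ GCAtlas.IsInduced (blowDown ψ) β' ∧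
      β'.total ∘ Φ.total = σ.total ∘ ψ.total) ∧
    (blowUpAtlas ψ).DiffeoOn (modelAtlas P) (blowDown ψ)
      ((blowUpAtlas ψ).stratum 0) (modelInterior P) := by
  have S := isSubdivision_emb hR hψ
  have hD := isToric_dual hP.fg
  have hcov : ∀ t : Dual P, ∃ r : MaxObj ψ, ∃ a, emb ψ r.1 a = t := by
    rcases hmax with hfin | hmax
    · intro t
      obtain ⟨r, hr, a, ha⟩ := S.exists_full_of_finite hD t
      exact ⟨⟨r, (S.isFull_iff hP.fg r).1 hr⟩, a, ha⟩
    · exact hmax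
  have hne : Nonempty (MaxObj ψ) := (hcov 0).nonempty
  exact ⟨S.isManifold hP.fg hne, fun _ _ _ _ => S.mk_eq_iff hP.fg, bMapOn_blowDown _,
    (S.isFanAtlas_blowUp hP.fg).normalTrivial, S.exists_induced hP hsharp hcov,
    S.diffeoOn_blowDown hP hsharp hne⟩
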